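/- Let $X=(X_t)_{t\ge 0}$ be a real-valued Lévy process with càdlàg paths, started at $0$ under the probability measure $\mathbb P$, with characteristic exponent $\varPsi$, i.e. $\mathbb P[\mathrm e^{\mathrm i\lambda X_t}]=\mathrm e^{-t\varPsi(\lambda)}$ for all $t\ge 0$, $\lambda\in\mathbb R$. Assume that $X$ is recurrent, i.e. $\mathbb P\left[\int_0^\infty 1_{\{|X_t-a|<\varepsilon\}}\,\mathrm dt\right]=\infty$ for all $a\in\mathbb R$ and $\varepsilon>0$, and that (A) $\displaystyle\int_0^\infty\left|\frac{1}{q+\varPsi(\lambda)}\right|\mathrm d\lambda<\infty$ for every $q>0$. Let $m^2=\mathbb P[X_1^2]$, with $1/m^2:=0$ if $m^2=\infty$. For $q>0$ let $r_q$ be the bounded continuous $q$-resolvent density of $X$, i.e. the bounded continuous function $r_q\colon\mathbb R\to[0,\infty)$ such that $\int_{\mathbb R}f(x)r_q(x)\,\mathrm dx=\mathbb P\left[\int_0^\infty\mathrm e^{-qt}f(X_t)\,\mathrm dt\right]$ for all measurable $f\ge 0$; put $h_q(x)=r_q(0)-r_q(-x)$ and let $h(x)=\lim_{q\to0+}h_q(x)$,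 $x\in\mathbb R$, be the renormalized zero resolvent. Then $m^2\in(0,\infty]$, the density $r_q$ exists for every $q>0$, the limit $h(x)$ exists and is finite for every $x\in\mathbb R$, and: 1. $\displaystyle\lim_{x\to\infty}\frac{h(x)}{|x|}=\lim_{x\to-\infty}\frac{h(x)}{|x|}=\frac1{m^2}\in[0,\infty)$; 2. for every $x\in\mathbb R$, $\displaystyle\lim_{y\to\infty}\{h(x+y)-h(y)\}=\frac{x}{m^2}$ and $\displaystyle\lim_{y\to-\infty}\{h(x+y)-h(y)\}=-\frac{x}{m^2}$. -/

import Mathlib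

open MeasureTheory ProbabilityTheory Filter Topology Set
open scoped NNReal ENNReal

noncomputable section

namespace Levy

variable {Ω : Type*} [MeasurableSpace Ω]

/-- `X` is a real-valued Lévy process started at `0` under `P`: a process with càdlàg paths,
`X 0 = 0` almost surely, and independent and stationary increments. -/
structure IsLevyProcess (X : ℝ≥0 → Ω → ℝ) (P : Measure Ω) : Prop where
  measurable : ∀ t, Measurable (X t)
  right_continuous : ∀ ω t, ContinuousWithinAt (fun s => X s ω) (Ici t) t
  left_limits : ∀ ω t, ∃ l : ℝ, Tendsto (fun s => X s ω) (𝓝[<] t) (𝓝 l)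
  start_zero : ∀ᵐ ω ∂P, X 0 ω = 0
  indep_increments : HasIndepIncrements X P
  stationary_increments : ∀ s t, IdentDistrib (fun ω => X (s + t) ω - X s ω) (X t) P P

/-- Recurrence: the expected time spent in every interval `(a - ε, a + ε)` is infinite. -/
def IsRecurrent (X : ℝ≥0 → Ω → ℝ) (P : Measure Ω) : Prop :=
  ∀ a ε : ℝ, 0 < ε →
    ∫⁻ ω, (∫⁻ t in Ioi (0 : ℝ),
      {x : ℝ | |x - a| < ε}.indicator (fun _ => (1 : ℝ≥0∞)) (X t.toNNReal ω)) ∂P = ∞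

/-- The characteristic exponent `Ψ`: `Ψ ξ` is the unique complex number such that
`E[exp (i ξ X_t)] = exp (-t Ψ(ξ))` for all `t ≥ 0`. -/
def charExponent (X : ℝ≥0 → Ω → ℝ) (P : Measure Ω) (ξ : ℝ) : ℂ :=
  Classical.epsilon fun z : ℂ =>
    ∀ t : ℝ≥0, charFun (P.map (X t)) ξ = Complex.exp (-((t : ℝ) : ℂ) * z)

/-- Condition (A): `∫_0^∞ |1 / (q + Ψ(ξ))| dξ < ∞` for every `q > 0`. -/
def ConditionA (X : ℝ≥0 → Ω → ℝ) (P : Measure Ω) : Prop :=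
  ∀ q : ℝ, 0 < q → ∫⁻ ξ in Ioi (0 : ℝ), ‖1 / ((q : ℂ) + charExponent X P ξ)‖ₑ < ∞

/-- `r` is the bounded continuous `q`-resolvent density of the process:
`∫ f(x) r(x) dx = E[∫_0^∞ exp (-q t) f(X_t) dt]` for all measurable `f ≥ 0`. -/
structure IsResolventDensity (X : ℝ≥0 → Ω → ℝ) (P : Measure Ω) (q : ℝ) (r : ℝ → ℝ) : Prop where
  continuous : Continuous r
  nonneg : ∀ x, 0 ≤ r x
  bounded : ∃ C, ∀ x, r x ≤ C
  lintegral_eq : ∀ f : ℝ → ℝ≥0∞, Measurable f →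
    ∫⁻ x, f x * ENNReal.ofReal (r x) =
      ∫⁻ ω, (∫⁻ t in Ioi (0 : ℝ),
        ENNReal.ofReal (Real.exp (-q * t)) * f (X t.toNNReal ω)) ∂P

/-- The bounded continuous `q`-resolvent density `r_q` (unique when it exists). -/
def resolventDensity (X : ℝ≥0 → Ω → ℝ) (P : Measure Ω) (q : ℝ) : ℝ → ℝ :=
  Classical.epsilon fun r => IsResolventDensity X P q r

/-- `h_q(x) = r_q(0) - r_q(-x)`. -/
def hq (X : ℝ≥0 → Ω → ℝ) (P : Measure Ω) (q x : ℝ) : ℝ :=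
  resolventDensity X P q 0 - resolventDensity X P q (-x)

/-- The renormalized zero resolvent `h(x) = lim_{q → 0+} h_q(x)`. -/
def renormalizedZeroResolvent (X : ℝ≥0 → Ω → ℝ) (P : Measure Ω) (x : ℝ) : ℝ :=
  limUnder (𝓝[>] (0 : ℝ)) fun q => hq X P q x

/-- The second moment `m² = E[X_1²]`, possibly infinite. -/
def secondMoment (X : ℝ≥0 → Ω → ℝ) (P : Measure Ω) : ℝ≥0∞ :=
  ∫⁻ ω, ENNReal.ofReal (X 1 ω ^ 2) ∂P

/-- `1 / m²` as a real number, equal to `0` when `m² = ∞`. -/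
def invSecondMoment (X : ℝ≥0 → Ω → ℝ) (P : Measure Ω) : ℝ :=
  (secondMoment X P)⁻¹.toReal

end Levy

end

/-! Everything is carried by the resolvent measures `U q`, whose characteristic function is `1 / (q
+ Ψ)`. Condition (A) makes it integrable, so Fourier inversion gives the continuous density `r_q`.
The probabilistic facts about hitting `0` are replaced by a domination principle
(`kernel_le_of_le_zero`): if `w` is `q`-excessive and `c r_q(0) ≤ w(0)`, then `c r_q(-x) ≤ w(x)`
everywhere. It shows that `r_q` is maximal at `0`, that the kernel killed at `0` is nonnegative, and
that `h_q` is subadditive. The cocycle `h_q(x) + h_q(y) - h_q(x + y)` is the sum of a killed kernel,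
monotone in `q`, and of `h_q(x) h_q(y) / r_q(0)`, which vanishes because recurrence means `r_q(0) →
∞`. So the cocycle converges as `q → 0+`, and then so does `h_q(x) - x h_q(1)`: only the single
bounded number `h_q(1)` remains open.

Let `h` be any subsequential limit. Its mixed second differences are Fourier integrals of an
integrable function, so by Riemann–Lebesgue they vanish at infinity, and the increment `h(y + x) -
h(y)` is asymptotically `x` times the unit increment (`tendsto_increment_sub_mul`). It remains to
find the limit of the unit increment at each end.

If the second moment `M` of `U 1` is infinite, then `h(x) / |x| → 0`; any limit point `c` of the
unit increments satisfies `x c ≤ h(x)` for all real `x` by subadditivity, so `c = 0`. If `M` is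
finite, recurrence forces mean zero. The Poisson equation `∫ h(x + y) U_1(dy) = h(x) + r_1(-x)`,
integrated in `x`, shows that the unit increments converge to some `a` at `+∞` and `b` at `-∞` with
`a - b = 2 / M` (`exists_tendsto_increment`). A diffusive scaling limit together with subadditivity
gives `h(x) ≥ |x| / M` (`abs_div_le`), hence `a ≥ 1 / M` and `-b ≥ 1 / M`, and both are equalities.

All subsequential limits thus have the same slope at `+∞`, while two of them differ by a linear
function; so they coincide and `h_q` converges (`exists_tendsto_renormKernel`). Finally `M = m²`,
since `1 / (1 + Ψ)` and `exp (-Ψ)` have the same quadratic behaviour at the origin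
(`lintegral_sq_eq`). -/

namespace Levy

open Real

/-! ### Fourier inversion for finite measures on the line -/

section

open FourierTransform

/-- The inverse Fourier integral `x ↦ (2π)⁻¹ ∫ Re (exp (-i l x) φ(l)) dl`. -/
noncomputable def invDensity (φ : ℝ → ℂ) (x : ℝ) : ℝ :=
  (2 * π)⁻¹ * ∫ l : ℝ, (Complex.exp (-(l * x : ℝ) * Complex.I) * φ l).re

theorem norm_exp_neg_mul_I (l x : ℝ) : ‖Complex.exp (-(l * x : ℝ) * Complex.I)‖ = 1 := by
  rw [← Complex.ofReal_neg, Complex.norm_exp_ofReal_mul_I]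

theorem integrable_exp_mul {φ : ℝ → ℂ} (hφ : Integrable φ) (x : ℝ) :
    Integrable fun l : ℝ => Complex.exp (-(l * x : ℝ) * Complex.I) * φ l := by
  refine hφ.bdd_mul (c := 1) (by fun_prop) ?_
  exact Eventually.of_forall fun l => (norm_exp_neg_mul_I l x).le

theorem fourier_comp_two_pi (φ : ℝ → ℂ) (x : ℝ) :
    𝓕 (fun l : ℝ => φ (2 * π * l)) x =
      ((2 * π)⁻¹ : ℝ) * ∫ l : ℝ, Complex.exp (-(l * x : ℝ) * Complex.I) * φ l := by
  rw [fourier_real_eq_integral_exp_smul]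
  have h := Measure.integral_comp_mul_left
    (fun l : ℝ => Complex.exp (-(l * x : ℝ) * Complex.I) * φ l) (2 * π)
  rw [abs_of_pos (by positivity)] at h
  rw [← Complex.real_smul, ← h]
  refine integral_congr_ae (Eventually.of_forall fun l => ?_)
  simp only [smul_eq_mul]
  congr 2
  push_cast
  ring

/-- Riemann–Lebesgue, rescaled from the `2π` normalisation of `𝓕`. Integrability need not be
assumed: otherwise the integral has the default value `0` for every `x`. -/
theorem tendsto_integral_exp_mul_cocompact (φ : ℝ → ℂ) :
    Tendsto (fun x : ℝ => ∫ l : ℝ, Complex.exp (-(l * x : ℝ) * Complex.I) * φ l)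
      (cocompact ℝ) (𝓝 0) := by
  have h := (zero_at_infty_fourier (fun l : ℝ => φ (2 * π * l))).const_mul ((2 * π : ℝ) : ℂ)
  simp only [mul_zero] at h
  refine h.congr fun x => ?_
  rw [fourier_comp_two_pi, ← mul_assoc, ← Complex.ofReal_mul, mul_inv_cancel₀ (by positivity)]
  simp

theorem integral_exp_mul_re {φ : ℝ → ℂ} (hφ : Integrable φ) (x : ℝ) :
    ∫ l : ℝ, (Complex.exp (-(l * x : ℝ) * Complex.I) * φ l).re =
      (∫ l : ℝ, Complex.exp (-(l * x : ℝ) * Complex.I) * φ l).re :=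
  integral_re (integrable_exp_mul hφ x)

theorem invDensity_eq_fourier_re {φ : ℝ → ℂ} (hφ : Integrable φ) (x : ℝ) :
    invDensity φ x = (𝓕 (fun l : ℝ => φ (2 * π * l)) x).re := by
  rw [fourier_comp_two_pi, Complex.re_ofReal_mul, invDensity, integral_exp_mul_re hφ]

theorem continuous_invDensity {φ : ℝ → ℂ} (hφ : Integrable φ) : Continuous (invDensity φ) := by
  refine continuous_const.mul ?_
  refine continuous_of_dominated (bound := fun l => ‖φ l‖)
    (fun x => (integrable_exp_mul hφ x).re.aestronglyMeasurable) (fun x => ?_) hφ.norm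
    (Eventually.of_forall fun l => ?_)
  · refine Eventually.of_forall fun l => ?_
    refine (Complex.abs_re_le_norm _).trans ?_
    rw [norm_mul, norm_exp_neg_mul_I, one_mul]
  · fun_prop

theorem tendsto_invDensity_cocompact {φ : ℝ → ℂ} (hφ : Integrable φ) :
    Tendsto (invDensity φ) (cocompact ℝ) (𝓝 0) := by
  have h := (Complex.continuous_re.tendsto 0).comp (tendsto_integral_exp_mul_cocompact φ)
  have h2 := h.const_mul (2 * π)⁻¹
  simp only [Complex.zero_re, mul_zero] at h2
  refine h2.congr fun x => ?_
  rw [invDensity, integral_exp_mul_re hφ]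
  rfl

/-- Parseval: write `g` as the Fourier transform of `𝓕⁻ g`, move the transform onto `μ` (`e1`),
reflect the variable (`e3`), and move the transform back from `g` onto the characteristic function
(`e2`). Test functions make every exchange legitimate. -/
theorem integral_contDiff_eq_integral_invDensity {μ : Measure ℝ} [IsFiniteMeasure μ]
    (hμ : Integrable (charFun μ)) {g : ℝ → ℝ} (hg : ContDiff ℝ ((⊤ : ℕ∞) : WithTop ℕ∞) g)
    (hgc : HasCompactSupport g) :
    ∫ x, g x ∂μ = ∫ x, g x * invDensity (charFun μ) x := by
  have hgc' : HasCompactSupport (fun x => (g x : ℂ)) := hgc.comp_left (g := Complex.ofReal) rfl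
  have hg' : ContDiff ℝ ((⊤ : ℕ∞) : WithTop ℕ∞) (fun x => (g x : ℂ)) :=
    Complex.ofRealCLM.contDiff.comp hg
  let G := hgc'.toSchwartzMap hg'
  have hG : (G : ℝ → ℂ) = fun x => (g x : ℂ) := rfl
  have hGi : Integrable (fun x => (g x : ℂ)) := hG ▸ G.integrable
  have hFi : Integrable (𝓕 (fun x => (g x : ℂ))) := by
    rw [← hG, ← SchwartzMap.fourier_coe]; exact (𝓕 G).integrable
  have hFi' : Integrable (𝓕⁻ (fun x => (g x : ℂ))) := by
    rw [← hG, ← SchwartzMap.fourierInv_coe]; exact (𝓕⁻ G).integrable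
  have hinv := hg'.continuous.fourier_fourierInv_eq hGi hFi
  have hcont : Continuous fun p : ℝ × ℝ => (innerₗ ℝ p.1) p.2 := by
    simp only [innerₗ_apply_apply]; fun_prop
  have e1 := VectorFourier.integral_fourierIntegral_smul_eq_flip (μ := (volume : Measure ℝ))
    (ν := μ) (L := innerₗ ℝ) continuous_fourierChar hcont hFi'
    (integrable_const (1 : ℂ))
  have e2 := VectorFourier.integral_fourierIntegral_smul_eq_flip (μ := (volume : Measure ℝ))
    (ν := (volume : Measure ℝ)) (L := innerₗ ℝ) (g := fun l => charFun μ (2 * π * l))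
    continuous_fourierChar hcont hGi (hμ.comp_mul_left' (by positivity))
  have hflip : (innerₗ ℝ).flip = innerₗ ℝ := by
    ext; simp
  rw [hflip] at e1 e2
  change ∫ ξ, (𝓕 (𝓕⁻ (fun x => (g x : ℂ)))) ξ • (1 : ℂ) ∂μ = _ at e1
  change ∫ ξ, (𝓕 (fun x => (g x : ℂ))) ξ • charFun μ (2 * π * ξ) =
    ∫ x, (g x : ℂ) • 𝓕 (fun l : ℝ => charFun μ (2 * π * l)) x at e2
  have hcf (x : ℝ) : VectorFourier.fourierIntegral 𝐞 μ (innerₗ ℝ) (fun _ => (1 : ℂ)) x =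
      charFun μ (2 * π * (-x)) := by
    rw [charFun_eq_fourierIntegral']
    congr 1
    simp only [smul_eq_mul]
    field_simp
  have e3 : ∫ x, (𝓕⁻ (fun x => (g x : ℂ))) x • charFun μ (2 * π * (-x)) =
      ∫ x, (𝓕 (fun x => (g x : ℂ))) x • charFun μ (2 * π * x) := by
    rw [← integral_neg_eq_self]
    refine integral_congr_ae (Eventually.of_forall fun x => ?_)
    simp only [neg_neg, fourierInv_eq_fourier_neg]
  rw [hinv] at e1
  simp_rw [hcf] at e1
  rw [e3, e2] at e1
  simp only [smul_eq_mul, mul_one] at e1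
  rw [integral_complex_ofReal] at e1
  have hint : Integrable fun x => (g x : ℂ) * 𝓕 (fun l : ℝ => charFun μ (2 * π * l)) x := by
    have hc : Continuous (𝓕 (fun l : ℝ => charFun μ (2 * π * l))) :=
      VectorFourier.fourierIntegral_continuous continuous_fourierChar hcont
        (hμ.comp_mul_left' (by positivity))
    exact (hg'.continuous.mul hc).integrable_of_hasCompactSupport hgc'.mul_right
  have e4 := congrArg Complex.re e1
  rw [Complex.ofReal_re] at e4
  rw [e4]
  refine (integral_re hint).symm.trans ?_
  refine integral_congr_ae (Eventually.of_forall fun x => ?_)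
  simp only [RCLike.re_to_complex, Complex.re_ofReal_mul]
  rw [invDensity_eq_fourier_re hμ]

/-- The indicator of `(a, b)` is the bounded limit of the test functions `smoothTransition (n f)`,
where `f ≥ 0` is smooth with support exactly `(a, b)`. -/
theorem measureReal_Ioo_eq_integral_invDensity {μ : Measure ℝ} [IsFiniteMeasure μ]
    (hμ : Integrable (charFun μ)) (a b : ℝ) :
    μ.real (Ioo a b) = ∫ x in Ioo a b, invDensity (charFun μ) x := by
  obtain ⟨f, hfs, hfd, hfr⟩ := (isOpen_Ioo (a := a) (b := b)).exists_contDiff_support_eq (n := ⊤)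
  have hf0 (x : ℝ) : 0 ≤ f x := (hfr (mem_range_self x)).1
  let g : ℕ → ℝ → ℝ := fun n x => smoothTransition (n * f x)
  have hg0 (n : ℕ) (x : ℝ) (hx : x ∉ Ioo a b) : g n x = 0 := by
    have : f x = 0 := by rw [← hfs] at hx; simpa using hx
    simp [g, this]
  have hgind (n : ℕ) (x : ℝ) : |g n x| ≤ (Ioo a b).indicator (fun _ => (1 : ℝ)) x := by
    by_cases hx : x ∈ Ioo a b
    · rw [indicator_of_mem hx, abs_of_nonneg (smoothTransition.nonneg _)]
      exact smoothTransition.le_one _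
    · simp [hx, hg0 n x hx]
  have hglim (x : ℝ) :
      Tendsto (fun n => g n x) atTop (𝓝 ((Ioo a b).indicator (fun _ => (1 : ℝ)) x)) := by
    by_cases hx : x ∈ Ioo a b
    · rw [indicator_of_mem hx]
      have hpos : 0 < f x := lt_of_le_of_ne (hf0 x) (by rw [← hfs] at hx; exact Ne.symm hx)
      refine tendsto_const_nhds.congr' ?_
      have : Tendsto (fun n : ℕ => (n : ℝ) * f x) atTop atTop :=
        tendsto_natCast_atTop_atTop.atTop_mul_const hpos
      filter_upwards [this.eventually_ge_atTop 1] with n hn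
      exact (smoothTransition.one_of_one_le hn).symm
    · simp [hx, hg0 _ x hx]
  have hgd (n : ℕ) : ContDiff ℝ ((⊤ : ℕ∞) : WithTop ℕ∞) (g n) :=
    smoothTransition.contDiff.comp (contDiff_const.mul hfd)
  have hgc (n : ℕ) : HasCompactSupport (g n) :=
    HasCompactSupport.intro (isCompact_Icc (a := a) (b := b))
      fun x hx => hg0 n x fun h => hx (Ioo_subset_Icc_self h)
  have hcont := continuous_invDensity hμ
  have h1 : Tendsto (fun n => ∫ x, g n x ∂μ) atTop
      (𝓝 (∫ x, (Ioo a b).indicator (fun _ => (1 : ℝ)) x ∂μ)) :=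
    tendsto_integral_of_dominated_convergence ((Ioo a b).indicator fun _ => (1 : ℝ))
      (fun n => (hgd n).continuous.aestronglyMeasurable)
      ((integrable_const _).indicator measurableSet_Ioo)
      (fun n => Eventually.of_forall (hgind n)) (Eventually.of_forall hglim)
  have h2 : Tendsto (fun n => ∫ x, g n x * invDensity (charFun μ) x) atTop
      (𝓝 (∫ x, (Ioo a b).indicator (fun _ => (1 : ℝ)) x * invDensity (charFun μ) x)) := by
    refine tendsto_integral_of_dominated_convergence
      ((Ioo a b).indicator fun x => |invDensity (charFun μ) x|)
      (fun n => ((hgd n).continuous.mul hcont).aestronglyMeasurable) ?_ ?_ ?_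
    · rw [integrable_indicator_iff measurableSet_Ioo]
      exact (hcont.abs.integrableOn_Icc).mono_set Ioo_subset_Icc_self
    · refine fun n => Eventually.of_forall fun x => ?_
      rw [norm_mul, norm_eq_abs, norm_eq_abs]
      refine (mul_le_mul_of_nonneg_right (hgind n x) (abs_nonneg _)).trans ?_
      by_cases hx : x ∈ Ioo a b <;> simp [hx]
    · exact Eventually.of_forall fun x => (hglim x).mul_const _
  have h3 := tendsto_nhds_unique
    (h1.congr fun n => integral_contDiff_eq_integral_invDensity hμ (hgd n) (hgc n)) h2
  rw [integral_indicator_const _ measurableSet_Ioo, smul_eq_mul, mul_one] at h3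
  rw [h3, ← integral_indicator measurableSet_Ioo]
  refine integral_congr_ae (Eventually.of_forall fun x => ?_)
  by_cases hx : x ∈ Ioo a b <;> simp [hx]

/-- If the continuous function were negative at `x`, its integral over a small interval around `x`
would be negative, yet that integral is a measure. -/
theorem invDensity_charFun_nonneg {μ : Measure ℝ} [IsFiniteMeasure μ]
    (hμ : Integrable (charFun μ)) (x : ℝ) : 0 ≤ invDensity (charFun μ) x := by
  by_contra! hx
  have hcont := continuous_invDensity hμ
  obtain ⟨δ, hδ, hball⟩ := Metric.eventually_nhds_iff_ball.1
    (hcont.continuousAt.eventually_lt (continuousAt_const (y := (0 : ℝ))) hx)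
  rw [Real.ball_eq_Ioo] at hball
  have h := measureReal_Ioo_eq_integral_invDensity hμ (x - δ) (x + δ)
  have hint : IntegrableOn (invDensity (charFun μ)) (Ioo (x - δ) (x + δ)) :=
    (hcont.integrableOn_Icc).mono_set Ioo_subset_Icc_self
  have h2 : 0 < ∫ y in Ioo (x - δ) (x + δ), -invDensity (charFun μ) y := by
    refine (setIntegral_pos_iff_support_of_nonneg_ae
      (f := fun y => -invDensity (charFun μ) y) ?_ hint.neg).2 ?_
    · refine (ae_restrict_iff' measurableSet_Ioo).2 (Eventually.of_forall fun y hy => ?_)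
      simpa using (hball y hy).le
    · refine lt_of_lt_of_le (b := volume (Ioo (x - δ) (x + δ))) ?_ (measure_mono fun y hy => ?_)
      · rw [Real.volume_Ioo]; simp; linarith
      · exact ⟨by simpa using (hball y hy).ne, hy⟩
  rw [integral_neg, ← h] at h2
  have := measureReal_nonneg (μ := μ) (s := Ioo (x - δ) (x + δ))
  linarith

/-- A finite measure on `ℝ` with integrable characteristic function has a continuous density,
given by the inversion formula. -/
theorem withDensity_invDensity_charFun {μ : Measure ℝ} [IsFiniteMeasure μ]
    (hμ : Integrable (charFun μ)) :
    μ = volume.withDensity fun x => ENNReal.ofReal (invDensity (charFun μ) x) := by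
  refine Real.measure_ext_Ioo_rat fun a b => ?_
  rw [withDensity_apply _ measurableSet_Ioo, ← ofReal_integral_eq_lintegral_ofReal,
    ← measureReal_Ioo_eq_integral_invDensity hμ, ofReal_measureReal]
  · exact ((continuous_invDensity hμ).integrableOn_Icc).mono_set Ioo_subset_Icc_self
  · exact Eventually.of_forall (invDensity_charFun_nonneg hμ)

end

/-! ### Second moments read off from characteristic functions -/

theorem charFun_re (μ : Measure ℝ) [IsFiniteMeasure μ] (l : ℝ) :
    (charFun μ l).re = ∫ x, cos (l * x) ∂μ := by
  rw [charFun_apply_real]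
  have hint : Integrable (fun x : ℝ => Complex.exp (l * x * Complex.I)) μ := by
    refine (integrable_const (1 : ℝ)).mono' (by fun_prop) (Eventually.of_forall fun x => ?_)
    rw [← Complex.ofReal_mul, Complex.norm_exp_ofReal_mul_I]
  refine (integral_re hint).symm.trans (integral_congr_ae (Eventually.of_forall fun x => ?_))
  simp only [RCLike.re_to_complex]
  rw [← Complex.ofReal_mul, Complex.exp_ofReal_mul_I_re]

theorem integrable_cos_mul (μ : Measure ℝ) [IsFiniteMeasure μ] (l : ℝ) :
    Integrable (fun x => cos (l * x)) μ :=
  (integrable_const (1 : ℝ)).mono' (by fun_prop) (Eventually.of_forall fun x => abs_cos_le_one _)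

theorem one_sub_cos_le_sq_half (x : ℝ) : 1 - cos x ≤ x ^ 2 / 2 := by
  linarith [one_sub_sq_div_two_le_cos (x := x)]

theorem ofReal_one_sub_charFun_re_div_sq (μ : Measure ℝ) [IsProbabilityMeasure μ] (l : ℝ) :
    ENNReal.ofReal (2 * (1 - (charFun μ l).re) / l ^ 2) =
      ∫⁻ x, ENNReal.ofReal (2 * (1 - cos (l * x)) / l ^ 2) ∂μ := by
  rw [← ofReal_integral_eq_lintegral_ofReal]
  · rw [integral_div, integral_const_mul, integral_sub (integrable_const _)
      (integrable_cos_mul μ l), charFun_re]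
    simp
  · exact ((((integrable_const _).sub (integrable_cos_mul μ l)).const_mul _).div_const _)
  · refine Eventually.of_forall fun x => ?_
    have := cos_le_one (l * x)
    exact div_nonneg (by linarith) (sq_nonneg l)

theorem two_mul_one_sub_cos_div_sq_le (l x : ℝ) : 2 * (1 - cos (l * x)) / l ^ 2 ≤ x ^ 2 := by
  rcases eq_or_ne l 0 with rfl | hl
  · simp [sq_nonneg]
  rw [div_le_iff₀ (by positivity)]
  nlinarith [one_sub_cos_le_sq_half (l * x)]

theorem tendsto_two_mul_one_sub_cos_div_sq (x : ℝ) :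
    Tendsto (fun l : ℝ => 2 * (1 - cos (l * x)) / l ^ 2) (𝓝[≠] 0) (𝓝 (x ^ 2)) := by
  have h1 : Tendsto (fun l : ℝ => (x * sinc (l * x / 2)) ^ 2) (𝓝 0) (𝓝 (x ^ 2)) := by
    have : Continuous fun l : ℝ => (x * sinc (l * x / 2)) ^ 2 := by fun_prop
    simpa using this.tendsto 0
  refine (h1.mono_left nhdsWithin_le_nhds).congr' ?_
  filter_upwards [self_mem_nhdsWithin] with l hl
  have hl : l ≠ 0 := hl
  rcases eq_or_ne x 0 with rfl | hx
  · simp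
  rw [sinc_of_ne_zero (by simp [hl, hx])]
  have : cos (l * x) = 1 - 2 * sin (l * x / 2) ^ 2 := by
    have h := cos_sq' (l * x / 2)
    have h2 := cos_sq (l * x / 2)
    rw [show 2 * (l * x / 2) = l * x by ring] at h2
    linarith
  rw [this]
  field_simp
  ring

/-- The second moment of a probability measure, finite or not, is read off from the real part of
its characteristic function at the origin. -/
theorem tendsto_one_sub_charFun_re_div_sq (μ : Measure ℝ) [IsProbabilityMeasure μ] :
    Tendsto (fun l : ℝ => ENNReal.ofReal (2 * (1 - (charFun μ l).re) / l ^ 2)) (𝓝[≠] 0)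
      (𝓝 (∫⁻ x, ENNReal.ofReal (x ^ 2) ∂μ)) := by
  refine tendsto_of_seq_tendsto fun u hu => ?_
  have hle (l : ℝ) : ENNReal.ofReal (2 * (1 - (charFun μ l).re) / l ^ 2) ≤
      ∫⁻ x, ENNReal.ofReal (x ^ 2) ∂μ := by
    rw [ofReal_one_sub_charFun_re_div_sq]
    exact lintegral_mono fun x => ENNReal.ofReal_le_ofReal (two_mul_one_sub_cos_div_sq_le l x)
  -- Fatou's lemma bounds the lower limit. The upper limit needs no integrability, since `2 (1 - cos
  -- (l x)) / l²` never exceeds `x²`.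
  refine tendsto_of_le_liminf_of_limsup_le ?_ ?_
  · simp_rw [ofReal_one_sub_charFun_re_div_sq]
    refine le_trans (lintegral_mono fun x => ?_) (lintegral_liminf_le fun n => by fun_prop)
    refine le_of_eq (Tendsto.liminf_eq ?_).symm
    exact (ENNReal.continuous_ofReal.tendsto _).comp
      ((tendsto_two_mul_one_sub_cos_div_sq x).comp hu)
  · exact limsup_le_of_le (h := Eventually.of_forall fun n => hle (u n))

theorem charFun_taylor_two {μ : Measure ℝ} [IsProbabilityMeasure μ]
    (hμ : MemLp id 2 μ) :
    (fun l : ℝ => charFun μ l - (1 + ((∫ x, x ∂μ : ℝ) : ℂ) * l * Complex.I -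
      ((∫ x, x ^ 2 ∂μ : ℝ) : ℂ) * l ^ 2 / 2)) =o[𝓝 0] fun l : ℝ => l ^ 2 := by
  have h := taylor_isLittleO_univ (x₀ := (0 : ℝ)) (n := 2) (contDiff_charFun (n := 2) hμ)
  simp only [sub_zero] at h
  refine h.congr_left fun l => ?_
  rw [taylorWithinEval_charFun_zero hμ]
  simp [Finset.sum_range_succ, ← integral_complex_ofReal]
  ring_nf
  simp
  ring

/-! ### Resolvent families and resolvent equations -/

/-- `U q`, `q > 0`, are finite measures whose characteristic functions `1 / (q + Ψ)` are
integrable, where `Ψ` has nonnegative real part and vanishes at `0`. -/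
structure ResolventFamily (Ψ : ℝ → ℂ) (U : ℝ → Measure ℝ) : Prop where
  re_nonneg : ∀ l, 0 ≤ (Ψ l).re
  zero : Ψ 0 = 0
  finite : ∀ q, 0 < q → IsFiniteMeasure (U q)
  charFun_eq : ∀ q, 0 < q → ∀ l, charFun (U q) l = ((q : ℂ) + Ψ l)⁻¹
  integrable_inv : ∀ q : ℝ, 0 < q → Integrable fun l => ((q : ℂ) + Ψ l)⁻¹

/-- The continuous density of the `q`-resolvent measure with exponent `Ψ`. -/
noncomputable def resolventKernel (Ψ : ℝ → ℂ) (q x : ℝ) : ℝ :=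
  invDensity (fun l => ((q : ℂ) + Ψ l)⁻¹) x

namespace ResolventFamily

variable {Ψ : ℝ → ℂ} {U : ℝ → Measure ℝ}

theorem le_norm_add (S : ResolventFamily Ψ U) (q l : ℝ) : q ≤ ‖(q : ℂ) + Ψ l‖ := by
  refine le_trans ?_ (Complex.re_le_norm _)
  simpa using S.re_nonneg l

theorem add_ne_zero (S : ResolventFamily Ψ U) {q : ℝ} (hq : 0 < q) (l : ℝ) :
    (q : ℂ) + Ψ l ≠ 0 :=
  norm_pos_iff.1 (hq.trans_le (S.le_norm_add q l))

theorem norm_le_norm_add (S : ResolventFamily Ψ U) {q : ℝ} (hq : 0 ≤ q) (l : ℝ) :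
    ‖Ψ l‖ ≤ ‖(q : ℂ) + Ψ l‖ := by
  refine le_of_sq_le_sq ?_ (norm_nonneg _)
  rw [Complex.sq_norm, Complex.sq_norm, Complex.normSq_apply, Complex.normSq_apply]
  simp only [Complex.add_re, Complex.ofReal_re, Complex.add_im, Complex.ofReal_im, zero_add]
  nlinarith [S.re_nonneg l]

theorem charFun_eq' (S : ResolventFamily Ψ U) {q : ℝ} (hq : 0 < q) :
    charFun (U q) = fun l => ((q : ℂ) + Ψ l)⁻¹ := funext (S.charFun_eq q hq)

theorem kernel_eq (S : ResolventFamily Ψ U) {q : ℝ} (hq : 0 < q) :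
    resolventKernel Ψ q = invDensity (charFun (U q)) := by
  rw [S.charFun_eq' hq]; rfl

theorem integrable_charFun (S : ResolventFamily Ψ U) {q : ℝ} (hq : 0 < q) :
    Integrable (charFun (U q)) := by
  rw [S.charFun_eq' hq]; exact S.integrable_inv q hq

theorem continuous_kernel (S : ResolventFamily Ψ U) {q : ℝ} (hq : 0 < q) :
    Continuous (resolventKernel Ψ q) := continuous_invDensity (S.integrable_inv q hq)

theorem tendsto_kernel_cocompact (S : ResolventFamily Ψ U) {q : ℝ} (hq : 0 < q) :
    Tendsto (resolventKernel Ψ q) (cocompact ℝ) (𝓝 0) :=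
  tendsto_invDensity_cocompact (S.integrable_inv q hq)

theorem kernel_nonneg (S : ResolventFamily Ψ U) {q : ℝ} (hq : 0 < q) (x : ℝ) :
    0 ≤ resolventKernel Ψ q x := by
  have := S.finite q hq
  rw [S.kernel_eq hq]
  exact invDensity_charFun_nonneg (S.integrable_charFun hq) x

theorem withDensity_kernel (S : ResolventFamily Ψ U) {q : ℝ} (hq : 0 < q) :
    U q = volume.withDensity fun x => ENNReal.ofReal (resolventKernel Ψ q x) := by
  have := S.finite q hq
  rw [S.kernel_eq hq]
  exact withDensity_invDensity_charFun (S.integrable_charFun hq)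

theorem integral_eq_integral_mul_kernel (S : ResolventFamily Ψ U) {q : ℝ} (hq : 0 < q)
    (f : ℝ → ℝ) : ∫ x, f x ∂(U q) = ∫ x, f x * resolventKernel Ψ q x := by
  rw [S.withDensity_kernel hq, integral_withDensity_eq_integral_toReal_smul
    (by have := (S.continuous_kernel hq).measurable; fun_prop) (by simp)]
  refine integral_congr_ae (Eventually.of_forall fun x => ?_)
  simp only [smul_eq_mul, ENNReal.toReal_ofReal (S.kernel_nonneg hq x)]
  ring

theorem measureReal_univ (S : ResolventFamily Ψ U) {q : ℝ} (hq : 0 < q) :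
    (U q).real univ = q⁻¹ := by
  have h := S.charFun_eq q hq 0
  rw [charFun_zero, S.zero, add_zero, ← Complex.ofReal_inv] at h
  exact_mod_cast h

theorem integrable_kernel (S : ResolventFamily Ψ U) {q : ℝ} (hq : 0 < q) :
    Integrable (resolventKernel Ψ q) := by
  have := S.finite q hq
  refine ⟨(S.continuous_kernel hq).aestronglyMeasurable, ?_⟩
  rw [hasFiniteIntegral_iff_ofReal (Eventually.of_forall (S.kernel_nonneg hq))]
  have h : U q univ < ∞ := measure_lt_top _ _
  rwa [S.withDensity_kernel hq, withDensity_apply _ MeasurableSet.univ, setLIntegral_univ] at h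

theorem integral_kernel (S : ResolventFamily Ψ U) {q : ℝ} (hq : 0 < q) :
    ∫ x, resolventKernel Ψ q x = q⁻¹ := by
  have := S.finite q hq
  have h := S.integral_eq_integral_mul_kernel hq fun _ => 1
  simp only [integral_const, smul_eq_mul, mul_one, one_mul, S.measureReal_univ hq] at h
  exact h.symm

theorem bddAbove_kernel (S : ResolventFamily Ψ U) {q : ℝ} (hq : 0 < q) :
    ∃ C, ∀ x, |resolventKernel Ψ q x| ≤ C := by
  refine ⟨(2 * π)⁻¹ * ∫ l, ‖((q : ℂ) + Ψ l)⁻¹‖, fun x => ?_⟩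
  rw [resolventKernel, invDensity, abs_mul, abs_of_pos (by positivity)]
  refine mul_le_mul_of_nonneg_left ?_ (by positivity)
  rw [← norm_eq_abs]
  refine norm_integral_le_of_norm_le (S.integrable_inv q hq).norm (Eventually.of_forall fun l => ?_)
  refine (Complex.abs_re_le_norm _).trans ?_
  rw [norm_mul, norm_exp_neg_mul_I, one_mul]

/-- The resolvent equation for measures. -/
theorem resolvent_measure (S : ResolventFamily Ψ U) {p q : ℝ} (hq : 0 < q) (hqp : q < p) :
    U q = U p + ENNReal.ofReal (p - q) • (U p ∗ U q) := by
  have hp := hq.trans hqp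
  have := S.finite q hq
  have := S.finite p hp
  have : IsFiniteMeasure (ENNReal.ofReal (p - q) • (U p ∗ U q)) :=
    ⟨by simpa using ENNReal.mul_lt_top ENNReal.ofReal_lt_top (measure_lt_top _ _)⟩
  refine Measure.ext_of_charFun (funext fun l => ?_)
  have hadd : charFun (U p + ENNReal.ofReal (p - q) • (U p ∗ U q)) l =
      charFun (U p) l + (p - q : ℝ) * (charFun (U p) l * charFun (U q) l) := by
    have hint (μ : Measure ℝ) [IsFiniteMeasure μ] :
        Integrable (fun x : ℝ => Complex.exp (l * x * Complex.I)) μ := by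
      refine (integrable_const (1 : ℝ)).mono' (by fun_prop) (Eventually.of_forall fun x => ?_)
      rw [← Complex.ofReal_mul, Complex.norm_exp_ofReal_mul_I]
    rw [← charFun_conv, charFun_apply_real, charFun_apply_real, charFun_apply_real,
      integral_add_measure (hint _) (hint _), integral_smul_measure,
      ENNReal.toReal_ofReal (by linarith), Complex.real_smul]
  rw [hadd, S.charFun_eq q hq, S.charFun_eq p hp]
  have h1 := S.add_ne_zero hq l
  have h2 := S.add_ne_zero hp l
  push_cast
  field_simp
  ring

theorem integrable_of_bounded (S : ResolventFamily Ψ U) {q : ℝ} (hq : 0 < q) {f : ℝ → ℝ}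
    (hf : Continuous f) {C : ℝ} (hC : ∀ x, |f x| ≤ C) : Integrable f (U q) := by
  have := S.finite q hq
  exact (integrable_const C).mono' hf.aestronglyMeasurable (Eventually.of_forall hC)

/-- The resolvent equation for potentials of bounded continuous functions. -/
theorem resolvent_integral (S : ResolventFamily Ψ U) {p q : ℝ} (hq : 0 < q) (hqp : q < p)
    {f : ℝ → ℝ} (hf : Continuous f) {C : ℝ} (hC : ∀ x, |f x| ≤ C) (x : ℝ) :
    ∫ y, f (x + y) ∂(U q) =
      ∫ y, f (x + y) ∂(U p) + (p - q) * ∫ y, ∫ z, f (x + y + z) ∂(U q) ∂(U p) := by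
  have hp := hq.trans hqp
  have := S.finite q hq
  have := S.finite p hp
  have hint (μ : Measure ℝ) [IsFiniteMeasure μ] : Integrable (fun y => f (x + y)) μ :=
    (integrable_const C).mono' (by fun_prop) (Eventually.of_forall fun y => hC _)
  conv_lhs => rw [S.resolvent_measure hq hqp]
  rw [integral_add_measure (hint _), integral_smul_measure, ENNReal.toReal_ofReal (by linarith),
    smul_eq_mul, integral_conv (hint _)]
  · simp_rw [add_assoc]
  · exact (hint _).smul_measure ENNReal.ofReal_ne_top

/-- The resolvent equation for densities. -/
theorem resolvent_kernel (S : ResolventFamily Ψ U) {p q : ℝ} (hp : 0 < p) (hq : 0 < q) (x : ℝ) :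
    resolventKernel Ψ q x - resolventKernel Ψ p x =
      (p - q) * ∫ y, resolventKernel Ψ q (x - y) * resolventKernel Ψ p y := by
  have := S.finite p hp
  rw [← S.integral_eq_integral_mul_kernel hp fun y => resolventKernel Ψ q (x - y)]
  have hq' := S.integrable_inv q hq
  have hp' := S.integrable_inv p hp
  have hprod : Integrable fun l => ((q : ℂ) + Ψ l)⁻¹ * ((p : ℂ) + Ψ l)⁻¹ := by
    refine hp'.bdd_mul (c := q⁻¹) hq'.aestronglyMeasurable (Eventually.of_forall fun l => ?_)
    rw [norm_inv]
    exact inv_anti₀ hq (S.le_norm_add q l)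
  -- By Fubini, convolving with `U p` multiplies the transform by `1 / (p + Ψ)`. The claim then
  -- reduces to the partial fraction identity for `1 / (q + Ψ) - 1 / (p + Ψ)`.
  have key : ∫ y, resolventKernel Ψ q (x - y) ∂(U p) =
      invDensity (fun l => ((q : ℂ) + Ψ l)⁻¹ * ((p : ℂ) + Ψ l)⁻¹) x := by
    unfold resolventKernel invDensity
    rw [integral_const_mul]
    congr 1
    have hF : Integrable (Function.uncurry fun (y l : ℝ) =>
        Complex.exp (-(l * (x - y) : ℝ) * Complex.I) * ((q : ℂ) + Ψ l)⁻¹)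
        ((U p).prod volume) := by
      have h1 : Integrable (fun z : ℝ × ℝ => ((q : ℂ) + Ψ z.2)⁻¹) ((U p).prod volume) :=
        hq'.comp_snd (U p)
      refine h1.bdd_mul (c := 1) (by fun_prop) (Eventually.of_forall fun z => ?_)
      exact (norm_exp_neg_mul_I _ _).le
    simp_rw [integral_exp_mul_re hq', integral_exp_mul_re hprod]
    have hFi := hF.integral_prod_left
    refine (integral_re hFi).trans ?_
    simp only [Function.uncurry_apply_pair, RCLike.re_to_complex]
    congr 1
    rw [integral_integral_swap hF]
    refine integral_congr_ae (Eventually.of_forall fun l => ?_)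
    simp only
    rw [integral_mul_const, ← S.charFun_eq p hp, charFun_apply_real]
    have : ∀ y : ℝ, Complex.exp (-(l * (x - y) : ℝ) * Complex.I) =
        Complex.exp (-(l * x : ℝ) * Complex.I) * Complex.exp (l * y * Complex.I) := by
      intro y
      rw [← Complex.exp_add]
      congr 1
      push_cast
      ring
    simp_rw [this]
    rw [integral_const_mul]
    ring
  rw [key]
  unfold resolventKernel invDensity
  have hsub := integral_sub (integrable_exp_mul hq' x).re (integrable_exp_mul hp' x).re
  simp only [RCLike.re_to_complex] at hsub
  beta_reduce
  rw [← mul_sub, ← hsub, mul_left_comm (p - q) (2 * π)⁻¹, ← integral_const_mul (p - q)]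
  congr 1
  refine integral_congr_ae (Eventually.of_forall fun l => ?_)
  beta_reduce
  rw [← Complex.re_ofReal_mul, ← Complex.sub_re]
  congr 1
  have h1 := S.add_ne_zero hq l
  have h2 := S.add_ne_zero hp l
  push_cast
  field_simp
  ring

end ResolventFamily

/-! ### Continuity of the exponent and the domination principle -/

namespace ResolventFamily

variable {Ψ : ℝ → ℂ} {U : ℝ → Measure ℝ}

theorem exponent_eq (S : ResolventFamily Ψ U) : Ψ = fun l => (charFun (U 1) l)⁻¹ - 1 := by
  funext l
  rw [S.charFun_eq 1 one_pos, inv_inv]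
  push_cast
  ring

theorem continuous_exponent (S : ResolventFamily Ψ U) : Continuous Ψ := by
  have := S.finite 1 one_pos
  rw [S.exponent_eq]
  refine (continuous_charFun.inv₀ fun l => ?_).sub continuous_const
  rw [S.charFun_eq 1 one_pos]
  exact inv_ne_zero (S.add_ne_zero one_pos l)

/-- The probability measure `α U_α` has characteristic function `α / (α + Ψ)`, which tends to `1`
boundedly, so it concentrates at the origin. This locality lets the domination principle see only a
neighbourhood of a maximum point. -/
theorem tendsto_mul_measureReal_abs_gt (S : ResolventFamily Ψ U) {d : ℝ} (hd : 0 < d) :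
    Tendsto (fun α : ℝ => α * (U α).real {y | d < |y|}) atTop (𝓝 0) := by
  have hΨ := S.continuous_exponent
  have hlim : Tendsto (fun α : ℝ => 2⁻¹ * d *
      ‖∫ t in (-2 * d⁻¹)..(2 * d⁻¹), Ψ t / ((α : ℂ) + Ψ t)‖) atTop (𝓝 0) := by
    have h0 : Tendsto (fun α : ℝ => ∫ t in (-2 * d⁻¹)..(2 * d⁻¹), Ψ t / ((α : ℂ) + Ψ t))
        atTop (𝓝 (∫ t in (-2 * d⁻¹)..(2 * d⁻¹), (0 : ℂ))) := by
      refine intervalIntegral.tendsto_integral_filter_of_dominated_convergence (fun _ => 1)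
        ?_ ?_ (by simp) ?_
      · filter_upwards [eventually_gt_atTop 0] with α hα
        exact (hΨ.div (by fun_prop) fun t => S.add_ne_zero hα t).aestronglyMeasurable
      · filter_upwards [eventually_gt_atTop 0] with α hα
        refine Eventually.of_forall fun t _ => ?_
        rw [norm_div]
        exact div_le_one_of_le₀ (S.norm_le_norm_add hα.le t) (norm_nonneg _)
      · refine Eventually.of_forall fun t _ => ?_
        rw [tendsto_zero_iff_norm_tendsto_zero]
        refine squeeze_zero' (g := fun α : ℝ => ‖Ψ t‖ / α)
          (Eventually.of_forall fun _ => norm_nonneg _) ?_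
          (tendsto_const_nhds.div_atTop tendsto_id)
        filter_upwards [eventually_gt_atTop 0] with α hα
        rw [norm_div]
        exact div_le_div_of_nonneg_left (norm_nonneg _) hα (S.le_norm_add α t)
    have := h0.norm.const_mul (2⁻¹ * d)
    simpa using this
  refine squeeze_zero' ?_ ?_ hlim
  · filter_upwards [eventually_gt_atTop 0] with α hα
    positivity
  · filter_upwards [eventually_gt_atTop 0] with α hα
    have := S.finite α hα
    have hprob : IsProbabilityMeasure (ENNReal.ofReal α • U α) := by
      refine ⟨?_⟩
      have h := S.measureReal_univ hα
      rw [Measure.smul_apply, ← ofReal_measureReal, h, smul_eq_mul, ← ENNReal.ofReal_mul hα.le,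
        mul_inv_cancel₀ hα.ne', ENNReal.ofReal_one]
    have h := measureReal_abs_gt_le_integral_charFun (μ := ENNReal.ofReal α • U α) hd
    rw [measureReal_ennreal_smul_apply, ENNReal.toReal_ofReal hα.le] at h
    refine h.trans (le_of_eq ?_)
    congr 2
    refine intervalIntegral.integral_congr fun t _ => ?_
    have h1 : charFun (ENNReal.ofReal α • U α) t = α * charFun (U α) t := by
      rw [charFun_apply_real, charFun_apply_real, integral_smul_measure,
        ENNReal.toReal_ofReal hα.le, Complex.real_smul]
    have h2 := S.add_ne_zero hα t
    simp only [h1, S.charFun_eq α hα]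
    field_simp
    ring

theorem continuous_potential (S : ResolventFamily Ψ U) {q : ℝ} (hq : 0 < q) {f : ℝ → ℝ}
    (hf : Continuous f) {C : ℝ} (hC : ∀ x, |f x| ≤ C) :
    Continuous fun x => ∫ y, f (x + y) ∂(U q) := by
  have := S.finite q hq
  exact continuous_of_dominated (bound := fun _ => C) (fun x => by fun_prop)
    (fun x => Eventually.of_forall fun y => hC _) (integrable_const C)
    (Eventually.of_forall fun y => by fun_prop)

theorem abs_potential_le (S : ResolventFamily Ψ U) {q : ℝ} (hq : 0 < q) {f : ℝ → ℝ}
    {C : ℝ} (hC : ∀ x, |f x| ≤ C) (x : ℝ) :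
    |∫ y, f (x + y) ∂(U q)| ≤ C * q⁻¹ := by
  have := S.finite q hq
  rw [← S.measureReal_univ hq]
  rw [← norm_eq_abs]
  exact norm_integral_le_of_norm_le_const (Eventually.of_forall fun y => hC (x + y))

theorem tendsto_potential_cocompact (S : ResolventFamily Ψ U) {q : ℝ} (hq : 0 < q) {f : ℝ → ℝ}
    (hf : Continuous f) {C : ℝ} (hC : ∀ x, |f x| ≤ C) (h0 : Tendsto f (cocompact ℝ) (𝓝 0)) :
    Tendsto (fun x => ∫ y, f (x + y) ∂(U q)) (cocompact ℝ) (𝓝 0) := by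
  have := S.finite q hq
  have : (cocompact ℝ).IsCountablyGenerated := by
    rw [cocompact_eq_atBot_atTop]; infer_instance
  have h := tendsto_integral_filter_of_dominated_convergence (μ := U q) (l := cocompact ℝ)
    (F := fun x y => f (x + y)) (f := fun _ => 0) (fun _ => C)
    (Eventually.of_forall fun x => by fun_prop)
    (Eventually.of_forall fun x => Eventually.of_forall fun y => hC _) (integrable_const C)
    (Eventually.of_forall fun y =>
      h0.comp (Homeomorph.addRight y).isClosedEmbedding.tendsto_cocompact)
  simpa using h

/-- Domination principle for potentials of continuous functions of compact support. -/
theorem potential_le_of_le_on_support (S : ResolventFamily Ψ U) {q : ℝ} (hq : 0 < q)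
    {g w : ℝ → ℝ} {ε K C c : ℝ} (hg : Continuous g) (hg0 : ∀ x, 0 ≤ g x) (hgK : ∀ x, g x ≤ K)
    (hgs : ∀ x, ε < |x| → g x = 0) (hw : Continuous w) (hw0 : ∀ x, 0 ≤ w x)
    (hwC : ∀ x, w x ≤ C) (hc : 0 ≤ c)
    (hexc : ∀ α, q < α → ∀ x, (α - q) * ∫ y, w (x + y) ∂(U α) ≤ w x)
    (hle : ∀ x, |x| ≤ ε → c * ∫ y, g (x + y) ∂(U q) ≤ w x) (x : ℝ) :
    c * ∫ y, g (x + y) ∂(U q) ≤ w x := by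
  by_contra! hx
  have hgK' : ∀ x, |g x| ≤ K := fun x => by rw [abs_of_nonneg (hg0 x)]; exact hgK x
  have hwC' : ∀ x, |w x| ≤ C := fun x => by rw [abs_of_nonneg (hw0 x)]; exact hwC x
  set v : ℝ → ℝ := fun x => ∫ y, g (x + y) ∂(U q) with hv
  have hvc : Continuous v := S.continuous_potential hq hg hgK'
  have hvb : ∀ x, |v x| ≤ K * q⁻¹ := S.abs_potential_le hq hgK'
  have hgc : HasCompactSupport g := HasCompactSupport.intro (isCompact_Icc (a := -ε) (b := ε))
    fun x hx => hgs x (by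
      by_contra! h
      exact hx (abs_le.1 h))
  have hv0 : Tendsto v (cocompact ℝ) (𝓝 0) :=
    S.tendsto_potential_cocompact hq hg hgK' (by
      simpa using hgc.is_zero_at_infty)
  set f : ℝ → ℝ := fun x => c * v x - w x with hf
  have hfc : Continuous f := (continuous_const.mul hvc).sub hw
  have hfx : 0 < f x := by simp only [hf]; linarith
  -- The maximum of `f = c v - w` is attained: `v` vanishes at infinity and `w ≥ 0`, so outside a
  -- compact set `f` stays below its positive value at `x`.
  obtain ⟨x₀, hx₀⟩ := hfc.exists_forall_ge' x (by
    have h1 := hv0.const_mul c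
    rw [mul_zero] at h1
    filter_upwards [h1.eventually_lt_const hfx] with y hy
    have := hw0 y
    simp only [hf] at hy ⊢
    linarith)
  have hpos : 0 < f x₀ := hfx.trans_le (hx₀ x)
  have hx₀ε : ε < |x₀| := by
    by_contra! h
    have := hle x₀ h
    simp only [hf] at hpos
    linarith
  set d := (|x₀| - ε) / 2 with hd
  have hdpos : 0 < d := by rw [hd]; linarith
  -- At the maximum point the resolvent equation for `v` and the excessivity of `w` give `f(x₀) ≤ c
  -- U_α g(x₀) + (α - q) U_α f(x₀)`, and the last term is at most `(α - q) / α` times `f(x₀)`. A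
  -- displacement of size at most `d` from `x₀` stays off the support of `g`, which bounds the first
  -- term. After multiplication by `α` the right side tends to `0`, a contradiction.
  have hbound (α : ℝ) (hα : q < α) : q * f x₀ ≤ c * K * (α * (U α).real {y | d < |y|}) := by
    have hα0 := hq.trans hα
    have := S.finite α hα0
    have hcv : Integrable (fun y => c * v (x₀ + y)) (U α) :=
      (S.integrable_of_bounded hα0 (f := fun y => v (x₀ + y)) (by fun_prop)
        fun y => hvb _).const_mul c
    have hwi : Integrable (fun y => w (x₀ + y)) (U α) :=
      S.integrable_of_bounded hα0 (by fun_prop) fun y => hwC' _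
    have e1 : v x₀ = ∫ y, g (x₀ + y) ∂(U α) + (α - q) * ∫ y, v (x₀ + y) ∂(U α) :=
      S.resolvent_integral hq hα hg hgK' x₀
    have e2 : ∫ y, f (x₀ + y) ∂(U α) ≤ f x₀ * α⁻¹ := by
      rw [← S.measureReal_univ hα0]
      have h := integral_mono (μ := U α) (hcv.sub hwi) (integrable_const (f x₀))
        fun y => hx₀ (x₀ + y)
      rw [integral_const, smul_eq_mul, mul_comm] at h
      exact h
    have e3 : ∫ y, f (x₀ + y) ∂(U α) =
        c * ∫ y, v (x₀ + y) ∂(U α) - ∫ y, w (x₀ + y) ∂(U α) := by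
      rw [← integral_const_mul, ← integral_sub hcv hwi]
    have e4 : ∫ y, g (x₀ + y) ∂(U α) ≤ K * (U α).real {y | d < |y|} := by
      have hset : MeasurableSet {y : ℝ | d < |y|} := measurableSet_lt (by fun_prop) (by fun_prop)
      have h : ∀ y, g (x₀ + y) ≤ {y : ℝ | d < |y|}.indicator (fun _ => K) y := by
        intro y
        by_cases hy : d < |y|
        · rw [indicator_of_mem (by exact hy)]
          exact hgK _
        · rw [indicator_of_notMem (by exact hy), hgs]
          have := abs_sub_abs_le_abs_sub x₀ (-y)
          rw [abs_neg, sub_neg_eq_add] at this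
          rw [hd] at hy
          linarith
      have h' := integral_mono (μ := U α)
        (S.integrable_of_bounded hα0 (f := fun y => g (x₀ + y)) (by fun_prop) fun y => hgK' _)
        ((integrable_const K).indicator hset) h
      rwa [integral_indicator_const _ hset, smul_eq_mul, mul_comm] at h'
    have e5 := hexc α hα x₀
    have e6 : f x₀ ≤ c * ∫ y, g (x₀ + y) ∂(U α) + (α - q) * ∫ y, f (x₀ + y) ∂(U α) := by
      rw [e3]
      have : f x₀ = c * v x₀ - w x₀ := rfl
      rw [this, e1]
      linarith
    have e7 := mul_le_mul_of_nonneg_left e2 (sub_nonneg.2 hα.le)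
    have e8 := mul_le_mul_of_nonneg_left e4 hc
    have e9 : f x₀ ≤ c * (K * (U α).real {y | d < |y|}) + (α - q) * (f x₀ * α⁻¹) := by linarith
    have e10 := mul_le_mul_of_nonneg_left e9 hα0.le
    have e11 : α * ((α - q) * (f x₀ * α⁻¹)) = (α - q) * f x₀ := by field_simp
    linarith
  have hlim := (S.tendsto_mul_measureReal_abs_gt hdpos).const_mul (c * K)
  rw [mul_zero] at hlim
  have := ge_of_tendsto hlim ((eventually_gt_atTop q).mono hbound)
  have h2 : 0 < q * f x₀ := mul_pos hq hpos
  linarith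

/-- Domination principle for the resolvent density. -/
theorem kernel_le_of_le_zero (S : ResolventFamily Ψ U) {q : ℝ} (hq : 0 < q)
    {w : ℝ → ℝ} {C c : ℝ} (hw : Continuous w) (hw0 : ∀ x, 0 ≤ w x)
    (hwC : ∀ x, w x ≤ C) (hc : 0 ≤ c)
    (hexc : ∀ α, q < α → ∀ x, (α - q) * ∫ y, w (x + y) ∂(U α) ≤ w x)
    (hle : c * resolventKernel Ψ q 0 ≤ w 0) (x : ℝ) :
    c * resolventKernel Ψ q (-x) ≤ w x := by
  have huc : UniformContinuous (resolventKernel Ψ q) :=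
    (S.continuous_kernel hq).uniformContinuous_of_tendsto_cocompact
      (S.tendsto_kernel_cocompact hq)
  refine le_of_forall_pos_le_add fun η' hη' => ?_
  -- The final loss is `3 c η + η`: potential against kernel costs `c η` at `x`, and the lifting of
  -- `w` below costs `2 c η + η`.
  set η := η' / (3 * c + 1) with hη
  have hη0 : 0 < η := by positivity
  obtain ⟨ε₁, hε₁, h₁⟩ := Metric.uniformContinuous_iff.1 huc η hη0
  obtain ⟨ε₂, hε₂, h₂⟩ := Metric.continuousAt_iff.1 (hw.continuousAt (x := 0)) η hη0
  set ε := min ε₁ ε₂ / 2 with hε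
  have hε0 : 0 < ε := by positivity
  have hεε₁ : ε < ε₁ := by
    have := min_le_left ε₁ ε₂
    have : 0 < min ε₁ ε₂ := by positivity
    rw [hε]; linarith
  have hεε₂ : ε < ε₂ := by
    have := min_le_right ε₁ ε₂
    have : 0 < min ε₁ ε₂ := by positivity
    rw [hε]; linarith
  -- A bump of integral one near `0` approximates the point mass, so by uniform continuity of the
  -- kernel its potential is within `η` of `r_q(-x)`, uniformly in `x`.
  let φ : ContDiffBump (0 : ℝ) := ⟨ε / 2, ε, by positivity, by linarith⟩
  set g : ℝ → ℝ := φ.normed volume with hgdef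
  have hg : Continuous g := φ.continuous_normed
  have hg0 : ∀ x, 0 ≤ g x := φ.nonneg_normed
  obtain ⟨K, hK⟩ := hg.bounded_above_of_compact_support φ.hasCompactSupport_normed
  have hgs : ∀ x, ε ≤ |x| → g x = 0 := by
    intro x hx
    have : x ∉ Function.support g := by
      rw [hgdef, φ.support_normed_eq]
      simpa [φ] using hx
    simpa using this
  have hgi : ∫ x, g x = 1 := φ.integral_normed
  have hgint : Integrable g := φ.integrable_normed
  have hv (x : ℝ) : |∫ y, g (x + y) ∂(U q) - resolventKernel Ψ q (-x)| ≤ η := by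
    rw [S.integral_eq_integral_mul_kernel hq]
    have e1 : ∫ y, g (x + y) * resolventKernel Ψ q y =
        ∫ z, g z * resolventKernel Ψ q (z - x) := by
      rw [← integral_add_left_eq_self (fun z => g z * resolventKernel Ψ q (z - x)) x]
      simp
    obtain ⟨D, hD⟩ := S.bddAbove_kernel hq
    have hk := S.continuous_kernel hq
    have hi : Integrable fun z => g z * resolventKernel Ψ q (z - x) :=
      hgint.mul_bdd (c := D) (by fun_prop) (Eventually.of_forall fun z => hD _)
    have e2 : ∫ z, g z * resolventKernel Ψ q (-x) = resolventKernel Ψ q (-x) := by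
      rw [integral_mul_const, hgi, one_mul]
    rw [e1]
    conv_lhs => rw [← e2]
    rw [← integral_sub hi (hgint.mul_const _)]
    have e3 : ∫ z, g z * η = η := by rw [integral_mul_const, hgi, one_mul]
    conv_rhs => rw [← e3]
    rw [← norm_eq_abs]
    refine norm_integral_le_of_norm_le (hgint.mul_const _) (Eventually.of_forall fun z => ?_)
    rw [← mul_sub, norm_mul, norm_of_nonneg (hg0 z)]
    rcases lt_or_ge |z| ε with hz | hz
    · refine mul_le_mul_of_nonneg_left ?_ (hg0 z)
      have := h₁ (a := z - x) (b := -x) (by rw [dist_eq]; simpa using hz.trans hεε₁)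
      rw [dist_eq] at this
      exact this.le
    · simp [hgs z hz]
  have hcη : 0 ≤ c * η := by positivity
  -- Adding the constant `2 c η + η` to `w` turns the hypothesis at the single point `0` into an
  -- inequality on all of `[-ε, ε]`; nonnegative constants are `q`-excessive because `(α - q) / α ≤
  -- 1`.
  have main := S.potential_le_of_le_on_support hq (g := g)
    (w := fun x => w x + (2 * c * η + η)) (ε := ε) (K := K) (C := C + (2 * c * η + η)) (c := c)
    hg hg0 (fun x => (le_abs_self _).trans (hK x)) (fun x hx => hgs x hx.le) (by fun_prop)
    (fun x => by have := hw0 x; linarith) (fun x => by have := hwC x; linarith) hc ?_ ?_ x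
  · have h1 := (abs_le.1 (hv x)).1
    have h2 := mul_le_mul_of_nonneg_left h1 hc
    have h3 : (3 * c + 1) * η = η' := by rw [hη]; field_simp
    linarith
  · intro α hα y
    have hα0 := hq.trans hα
    have := S.finite α hα0
    rw [integral_add (S.integrable_of_bounded hα0 (by fun_prop) (C := C)
      fun z => by rw [abs_of_nonneg (hw0 _)]; exact hwC _) (integrable_const _),
      integral_const, S.measureReal_univ hα0, smul_eq_mul, mul_add]
    refine add_le_add (hexc α hα y) ?_
    rw [← mul_assoc]
    refine mul_le_of_le_one_left (by positivity) ?_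
    rw [mul_inv_le_iff₀ hα0]
    linarith
  · intro y hy
    have h1 := (abs_le.1 (hv y)).2
    have h2 := h₁ (a := -y) (b := 0) (by rw [dist_eq]; simpa using hy.trans_lt hεε₁)
    have h3 := h₂ (x := y) (by rw [dist_eq]; simpa using hy.trans_lt hεε₂)
    rw [dist_eq] at h2 h3
    have h2' := (abs_lt.1 h2).2
    have h3' := (abs_lt.1 h3).1
    have h4 := mul_le_mul_of_nonneg_left
      (show ∫ z, g (y + z) ∂(U q) ≤ resolventKernel Ψ q 0 + 2 * η by linarith) hc
    linarith

end ResolventFamily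

/-! ### Killed kernels, subadditivity and monotonicity in `q` -/

/-- The renormalized resolvent density `r_q(0) - r_q(-x)`. -/
noncomputable def renormKernel (Ψ : ℝ → ℂ) (q x : ℝ) : ℝ :=
  resolventKernel Ψ q 0 - resolventKernel Ψ q (-x)

/-- The resolvent density of the process killed on hitting `0`. -/
noncomputable def killedKernel (Ψ : ℝ → ℂ) (q x a : ℝ) : ℝ :=
  resolventKernel Ψ q (a - x) -
    resolventKernel Ψ q (-x) * resolventKernel Ψ q a / resolventKernel Ψ q 0

namespace ResolventFamily

variable {Ψ : ℝ → ℂ} {U : ℝ → Measure ℝ}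

/-- Domination by the constant excessive function `r_q(0)`. -/
theorem kernel_le_kernel_zero (S : ResolventFamily Ψ U) {q : ℝ} (hq : 0 < q) (x : ℝ) :
    resolventKernel Ψ q x ≤ resolventKernel Ψ q 0 := by
  have h0 := S.kernel_nonneg hq 0
  have h := S.kernel_le_of_le_zero hq (w := fun _ => resolventKernel Ψ q 0)
    (C := resolventKernel Ψ q 0) (c := 1) continuous_const (fun _ => h0) (fun _ => le_rfl)
    zero_le_one ?_ (by simp) (-x)
  · simpa using h
  · intro α hα y
    have hα0 := hq.trans hα
    rw [integral_const, S.measureReal_univ hα0, smul_eq_mul, ← mul_assoc]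
    refine mul_le_of_le_one_left h0 ?_
    rw [mul_inv_le_iff₀ hα0]
    linarith

theorem kernel_zero_pos (S : ResolventFamily Ψ U) {q : ℝ} (hq : 0 < q) :
    0 < resolventKernel Ψ q 0 := by
  refine lt_of_le_of_ne (S.kernel_nonneg hq 0) fun h => ?_
  have h2 : resolventKernel Ψ q = fun _ => 0 := funext fun x =>
    le_antisymm ((S.kernel_le_kernel_zero hq x).trans h.symm.le) (S.kernel_nonneg hq x)
  have h3 := S.integral_kernel hq
  rw [h2, integral_zero] at h3
  exact (inv_pos.2 hq).ne h3

/-- Domination by `r_q(a - ·)`, which is `q`-excessive by the resolvent equation. Probabilistically,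
`r_q(-x) / r_q(0)` is the Laplace transform of the time to reach `0` from `x`, and visiting `0`
first contributes only part of the potential at `a`. -/
theorem kernel_mul_kernel_le (S : ResolventFamily Ψ U) {q : ℝ} (hq : 0 < q) (x a : ℝ) :
    resolventKernel Ψ q (-x) * resolventKernel Ψ q a ≤
      resolventKernel Ψ q 0 * resolventKernel Ψ q (a - x) := by
  have h0 := S.kernel_zero_pos hq
  have hk := S.continuous_kernel hq
  have h := S.kernel_le_of_le_zero hq (w := fun x => resolventKernel Ψ q (a - x))
    (C := resolventKernel Ψ q 0) (c := resolventKernel Ψ q a / resolventKernel Ψ q 0)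
    (by fun_prop) (fun x => S.kernel_nonneg hq _) (fun x => S.kernel_le_kernel_zero hq _)
    (div_nonneg (S.kernel_nonneg hq _) h0.le) ?_ ?_ x
  · rw [div_mul_eq_mul_div, div_le_iff₀ h0] at h
    linarith
  · intro α hα y
    have hα0 := hq.trans hα
    rw [S.integral_eq_integral_mul_kernel hα0]
    have e := S.resolvent_kernel hα0 hq (a - y)
    have e2 := S.kernel_nonneg hα0 (a - y)
    simp only [sub_sub] at e ⊢ e2
    linarith
  · simp only [sub_zero]
    rw [div_mul_cancel₀ _ h0.ne']

theorem killedKernel_nonneg (S : ResolventFamily Ψ U) {q : ℝ} (hq : 0 < q) (x a : ℝ) :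
    0 ≤ killedKernel Ψ q x a := by
  rw [killedKernel, sub_nonneg, div_le_iff₀ (S.kernel_zero_pos hq), mul_comm _
    (resolventKernel Ψ q 0)]
  exact S.kernel_mul_kernel_le hq x a

theorem renormKernel_nonneg (S : ResolventFamily Ψ U) {q : ℝ} (hq : 0 < q) (x : ℝ) :
    0 ≤ renormKernel Ψ q x := sub_nonneg.2 (S.kernel_le_kernel_zero hq _)

theorem renormKernel_zero (Ψ : ℝ → ℂ) (q : ℝ) : renormKernel Ψ q 0 = 0 := by
  simp [renormKernel]

/-- An algebraic identity on which the limit `q → 0+` rests: both terms on the right are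
nonnegative, the first is monotone in `q`, and the second is removed by `r_q(0) → ∞`. -/
theorem renormKernel_sub_eq (S : ResolventFamily Ψ U) {q : ℝ} (hq : 0 < q) (x a : ℝ) :
    renormKernel Ψ q x + renormKernel Ψ q (-a) - renormKernel Ψ q (x - a) =
      killedKernel Ψ q x a +
        renormKernel Ψ q x * renormKernel Ψ q (-a) / resolventKernel Ψ q 0 := by
  have h0 := (S.kernel_zero_pos hq).ne'
  simp only [renormKernel, killedKernel, neg_neg, neg_sub]
  field_simp
  ring

theorem renormKernel_add_le (S : ResolventFamily Ψ U) {q : ℝ} (hq : 0 < q) (x y : ℝ) :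
    renormKernel Ψ q (x + y) ≤ renormKernel Ψ q x + renormKernel Ψ q y := by
  have h := S.renormKernel_sub_eq hq x (-y)
  rw [neg_neg, sub_neg_eq_add] at h
  have h1 := S.killedKernel_nonneg hq x (-y)
  have h2 : 0 ≤ renormKernel Ψ q x * renormKernel Ψ q y / resolventKernel Ψ q 0 :=
    div_nonneg (mul_nonneg (S.renormKernel_nonneg hq x) (S.renormKernel_nonneg hq y))
      (S.kernel_zero_pos hq).le
  linarith

theorem renormKernel_natCast_mul_le (S : ResolventFamily Ψ U) {q : ℝ} (hq : 0 < q) (n : ℕ)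
    (x : ℝ) : renormKernel Ψ q (n * x) ≤ n * renormKernel Ψ q x := by
  induction n with
  | zero => simp [renormKernel_zero]
  | succ n ih =>
    have := S.renormKernel_add_le hq (n * x) x
    push_cast
    rw [add_mul, one_mul, add_mul, one_mul]
    linarith

theorem continuous_renormKernel (S : ResolventFamily Ψ U) {q : ℝ} (hq : 0 < q) :
    Continuous (renormKernel Ψ q) :=
  continuous_const.sub ((S.continuous_kernel hq).comp continuous_neg)

theorem integrable_kernel_mul_kernel (S : ResolventFamily Ψ U) {p q : ℝ} (hp : 0 < p)
    (hq : 0 < q) (x a : ℝ) :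
    Integrable fun y => resolventKernel Ψ q (y - x) * resolventKernel Ψ p (a - y) := by
  have hk := S.continuous_kernel hp
  obtain ⟨C, hC⟩ := S.bddAbove_kernel hp
  exact ((S.integrable_kernel hq).comp_sub_right x).mul_bdd (c := C) (by fun_prop)
    (Eventually.of_forall fun y => hC _)

theorem integral_kernel_mul_kernel (S : ResolventFamily Ψ U) {p q : ℝ} (hp : 0 < p)
    (hq : 0 < q) (x a : ℝ) :
    (p - q) * ∫ y, resolventKernel Ψ q (y - x) * resolventKernel Ψ p (a - y) =
      resolventKernel Ψ q (a - x) - resolventKernel Ψ p (a - x) := by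
  rw [S.resolvent_kernel hp hq, ← integral_sub_left_eq_self
    (fun y => resolventKernel Ψ q (a - x - y) * resolventKernel Ψ p y) volume a]
  congr 1
  refine integral_congr_ae (Eventually.of_forall fun y => ?_)
  beta_reduce
  congr 2
  ring

/-- The resolvent equation of the killed process. -/
theorem killed_resolvent (S : ResolventFamily Ψ U) {p q : ℝ} (hp : 0 < p)
    (hq : 0 < q) (x a : ℝ) :
    killedKernel Ψ q x a - killedKernel Ψ p x a =
      (p - q) * ∫ y, killedKernel Ψ q x y * killedKernel Ψ p y a := by
  have hq0 := (S.kernel_zero_pos hq).ne'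
  have hp0 := (S.kernel_zero_pos hp).ne'
  have i1 := S.integrable_kernel_mul_kernel hp hq x a
  have i2 := S.integrable_kernel_mul_kernel hp hq x 0
  have i3 := S.integrable_kernel_mul_kernel hp hq 0 a
  have i4 := S.integrable_kernel_mul_kernel hp hq 0 0
  have e1 := S.integral_kernel_mul_kernel hp hq x a
  have e2 := S.integral_kernel_mul_kernel hp hq x 0
  have e3 := S.integral_kernel_mul_kernel hp hq 0 a
  have e4 := S.integral_kernel_mul_kernel hp hq 0 0
  set A := resolventKernel Ψ q (-x) / resolventKernel Ψ q 0 with hA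
  set B := resolventKernel Ψ p a / resolventKernel Ψ p 0 with hB
  -- The killed kernels are rank-one corrections of the free ones, so the product expands into four
  -- integrals, each evaluated by the free resolvent equation.
  have key : ∫ y, killedKernel Ψ q x y * killedKernel Ψ p y a =
      (∫ y, resolventKernel Ψ q (y - x) * resolventKernel Ψ p (a - y)) -
      B * (∫ y, resolventKernel Ψ q (y - x) * resolventKernel Ψ p (0 - y)) -
      A * (∫ y, resolventKernel Ψ q (y - 0) * resolventKernel Ψ p (a - y)) +
      A * B * (∫ y, resolventKernel Ψ q (y - 0) * resolventKernel Ψ p (0 - y)) := by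
    have j1 : Integrable fun y => resolventKernel Ψ q (y - x) * resolventKernel Ψ p (a - y) -
        B * (resolventKernel Ψ q (y - x) * resolventKernel Ψ p (0 - y)) := i1.sub (i2.const_mul B)
    have j2 : Integrable fun y => resolventKernel Ψ q (y - x) * resolventKernel Ψ p (a - y) -
        B * (resolventKernel Ψ q (y - x) * resolventKernel Ψ p (0 - y)) -
        A * (resolventKernel Ψ q (y - 0) * resolventKernel Ψ p (a - y)) := j1.sub (i3.const_mul A)
    rw [← integral_const_mul, ← integral_const_mul, ← integral_const_mul,
      ← integral_sub i1 (i2.const_mul B), ← integral_sub j1 (i3.const_mul A),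
      ← integral_add j2 (i4.const_mul (A * B))]
    refine integral_congr_ae (Eventually.of_forall fun y => ?_)
    simp only [killedKernel, hA, hB, sub_zero, zero_sub]
    ring
  rw [key, mul_add, mul_sub, mul_sub, mul_left_comm _ B, mul_left_comm _ A, mul_left_comm _ (A * B),
    e1, e2, e3, e4]
  simp only [killedKernel, hA, hB, sub_zero, zero_sub]
  field_simp
  ring

theorem killedKernel_antitone (S : ResolventFamily Ψ U) {p q : ℝ} (hq : 0 < q) (hqp : q ≤ p)
    (x a : ℝ) : killedKernel Ψ p x a ≤ killedKernel Ψ q x a := by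
  have hp := hq.trans_le hqp
  rw [← sub_nonneg, S.killed_resolvent hp hq]
  exact mul_nonneg (sub_nonneg.2 hqp) (integral_nonneg fun y =>
    mul_nonneg (S.killedKernel_nonneg hq _ _) (S.killedKernel_nonneg hp _ _))

end ResolventFamily

/-! ### Bounds uniform in `q` from the size of the exponent -/

/-- A bound for the increments of the renormalized resolvent densities, uniform in `q`. -/
noncomputable def renormBound (Ψ : ℝ → ℂ) (x : ℝ) : ℝ :=
  π⁻¹ * ∫ l, (1 - cos (l * x)) / ‖Ψ l‖

namespace ResolventFamily

variable {Ψ : ℝ → ℂ} {U : ℝ → Measure ℝ}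

theorem isProbabilityMeasure_one (S : ResolventFamily Ψ U) : IsProbabilityMeasure (U 1) := by
  have := S.finite 1 one_pos
  have h := S.measureReal_univ one_pos
  exact ⟨by rw [← ofReal_measureReal, h]; simp⟩

theorem measure_eq_zero_of_countable (S : ResolventFamily Ψ U) {s : Set ℝ} (hs : s.Countable) :
    U 1 s = 0 := by
  rw [S.withDensity_kernel one_pos]
  exact withDensity_absolutelyContinuous _ _ (hs.measure_zero volume)

/-- If `Ψ l = 0`, then `∫ cos (l x) U_1(dx) = 1`, so `U 1` lives on the countable set where `cos (l
x) = 1`, although it has a density. -/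
theorem exponent_ne_zero (S : ResolventFamily Ψ U) {l : ℝ} (hl : l ≠ 0) : Ψ l ≠ 0 := by
  intro h
  have := S.isProbabilityMeasure_one
  have h1 := S.charFun_eq 1 one_pos l
  have h2 : (charFun (U 1) l).re = 1 := by rw [h1, h]; simp
  rw [charFun_re] at h2
  have hi : Integrable (fun x => 1 - cos (l * x)) (U 1) :=
    (integrable_const _).sub (integrable_cos_mul _ l)
  have h3 : ∫ x, (1 - cos (l * x)) ∂(U 1) = 0 := by
    rw [integral_sub (integrable_const _) (integrable_cos_mul _ l), h2]
    simp
  rw [integral_eq_zero_iff_of_nonneg (fun x => sub_nonneg.2 (cos_le_one _)) hi] at h3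
  have hc : {x : ℝ | cos (l * x) = 1}.Countable := by
    refine (countable_range fun n : ℤ => (n : ℝ) * (2 * π) / l).mono fun x hx => ?_
    obtain ⟨n, hn⟩ := (cos_eq_one_iff _).1 hx
    exact ⟨n, by beta_reduce; rw [hn]; field_simp⟩
  have h4 := S.measure_eq_zero_of_countable hc
  have h5 : ∀ᵐ x ∂(U 1), False := by
    filter_upwards [h3, compl_mem_ae_iff.2 h4] with x hx hx'
    refine hx' ?_
    have hx : 1 - cos (l * x) = 0 := hx
    exact (sub_eq_zero.1 hx).symm
  exact (IsProbabilityMeasure.ne_zero (U 1)) (by simpa using h5)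

theorem lintegral_sq_ne_zero (S : ResolventFamily Ψ U) :
    ∫⁻ x, ENNReal.ofReal (x ^ 2) ∂(U 1) ≠ 0 := by
  intro h
  have := S.isProbabilityMeasure_one
  rw [lintegral_eq_zero_iff (by fun_prop)] at h
  have h5 : ∀ᵐ x ∂(U 1), False := by
    filter_upwards [h, compl_mem_ae_iff.2 (S.measure_eq_zero_of_countable (countable_singleton 0))]
      with x hx hx'
    refine hx' ?_
    simpa [sq_nonpos_iff] using hx
  exact (IsProbabilityMeasure.ne_zero (U 1)) (by simpa using h5)

theorem one_sub_re_charFun_le (S : ResolventFamily Ψ U) (l : ℝ) :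
    1 - (charFun (U 1) l).re ≤ ‖Ψ l‖ := by
  have h0 := S.add_ne_zero one_pos l
  have h : 1 - charFun (U 1) l = Ψ l / (((1 : ℝ) : ℂ) + Ψ l) := by
    rw [S.charFun_eq 1 one_pos]
    field_simp
    simp
  calc 1 - (charFun (U 1) l).re = (1 - charFun (U 1) l).re := by simp
    _ ≤ ‖1 - charFun (U 1) l‖ := Complex.re_le_norm _
    _ = ‖Ψ l‖ / ‖((1 : ℝ) : ℂ) + Ψ l‖ := by rw [h, norm_div]
    _ ≤ ‖Ψ l‖ := div_le_self (norm_nonneg _) (S.le_norm_add 1 l)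

/-- Any constant below half the second moment of `U 1` bounds `‖Ψ l‖ / l ^ 2` near `0`. -/
theorem eventually_mul_sq_le_norm (S : ResolventFamily Ψ U) {c : ℝ}
    (hcM : ENNReal.ofReal (2 * c) < ∫⁻ x, ENNReal.ofReal (x ^ 2) ∂(U 1)) :
    ∀ᶠ l in 𝓝 (0 : ℝ), c * l ^ 2 ≤ ‖Ψ l‖ := by
  have := S.isProbabilityMeasure_one
  have h := (tendsto_one_sub_charFun_re_div_sq (U 1)).eventually_const_lt hcM
  rw [eventually_nhdsWithin_iff] at h
  filter_upwards [h] with l hl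
  rcases eq_or_ne l 0 with rfl | hl0
  · simp
  have h1 := (ENNReal.ofReal_lt_ofReal_iff'.1 (hl hl0)).1
  rw [lt_div_iff₀ (by positivity)] at h1
  have := S.one_sub_re_charFun_le l
  linarith

theorem exists_mul_sq_le_norm (S : ResolventFamily Ψ U) :
    ∃ c > 0, ∃ δ > 0, ∀ l, |l| ≤ δ → c * l ^ 2 ≤ ‖Ψ l‖ := by
  obtain ⟨b, hb0, hb⟩ := ENNReal.lt_iff_exists_real_btwn.1 (pos_iff_ne_zero.2 S.lintegral_sq_ne_zero)
  have hbpos : 0 < b := by simpa using hb.1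
  have h := S.eventually_mul_sq_le_norm (c := b / 2) (by
    rw [show 2 * (b / 2) = b by ring]; exact hb.2)
  obtain ⟨δ, hδ, hball⟩ := Metric.eventually_nhds_iff_ball.1 h
  refine ⟨b / 2, by positivity, δ / 2, by positivity, fun l hl => hball l ?_⟩
  rw [Metric.mem_ball, dist_zero_right, norm_eq_abs]
  linarith

theorem tendsto_charFun_cocompact (S : ResolventFamily Ψ U) :
    Tendsto (charFun (U 1)) (cocompact ℝ) (𝓝 0) := by
  have h := tendsto_integral_exp_mul_cocompact fun x => (resolventKernel Ψ 1 x : ℂ)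
  have h2 := h.comp (Homeomorph.neg ℝ).isClosedEmbedding.tendsto_cocompact
  refine h2.congr fun l => ?_
  simp only [Function.comp, Homeomorph.coe_neg]
  rw [charFun_apply_real, S.withDensity_kernel one_pos,
    integral_withDensity_eq_integral_toReal_smul
    (by have := (S.continuous_kernel one_pos).measurable; fun_prop) (by simp)]
  refine integral_congr_ae (Eventually.of_forall fun x => ?_)
  simp only [ENNReal.toReal_ofReal (S.kernel_nonneg one_pos x), Complex.real_smul]
  rw [mul_comm]
  congr 2
  push_cast
  ring

/-- At infinity `1 / (1 + Ψ) → 0` by Riemann–Lebesgue, which gives `‖Ψ‖ ≥ 1` there; on the remaining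
compact set the continuous function `‖Ψ‖` has a positive minimum. -/
theorem exists_le_norm_of_le_abs (S : ResolventFamily Ψ U) {δ : ℝ} (hδ : 0 < δ) :
    ∃ c > 0, ∀ l, δ ≤ |l| → c ≤ ‖Ψ l‖ := by
  have h1 : ∀ᶠ l in cocompact ℝ, 1 ≤ ‖Ψ l‖ := by
    have h := S.tendsto_charFun_cocompact.norm
    rw [norm_zero] at h
    filter_upwards [h.eventually_lt_const (show (0 : ℝ) < 1 / 2 by norm_num)] with l hl
    rw [S.charFun_eq 1 one_pos, norm_inv] at hl
    have hpos : 0 < ‖((1 : ℝ) : ℂ) + Ψ l‖ := norm_pos_iff.2 (S.add_ne_zero one_pos l)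
    rw [inv_lt_comm₀ hpos (by norm_num)] at hl
    have h3 := norm_add_le ((1 : ℝ) : ℂ) (Ψ l)
    simp only [Complex.ofReal_one, norm_one] at h3 hl
    norm_num at hl
    linarith
  obtain ⟨R, hR⟩ := (Metric.closedBall_compl_subset_of_mem_cocompact h1 (0 : ℝ))
  have hK : IsCompact (Metric.closedBall (0 : ℝ) R ∩ {l | δ ≤ |l|}) :=
    (isCompact_closedBall 0 R).inter_right (isClosed_le continuous_const continuous_abs)
  rcases (Metric.closedBall (0 : ℝ) R ∩ {l | δ ≤ |l|}).eq_empty_or_nonempty with he | hne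
  · refine ⟨1, one_pos, fun l hl => hR fun hl' => ?_⟩
    have : l ∈ (∅ : Set ℝ) := he ▸ ⟨hl', hl⟩
    exact this
  · obtain ⟨l₀, hl₀, hmin⟩ := hK.exists_isMinOn hne S.continuous_exponent.norm.continuousOn
    have hl₀' : l₀ ≠ 0 := by
      rintro rfl
      have : δ ≤ |(0 : ℝ)| := hl₀.2
      rw [abs_zero] at this
      linarith
    refine ⟨min 1 ‖Ψ l₀‖, lt_min one_pos (norm_pos_iff.2 (S.exponent_ne_zero hl₀')),
      fun l hl => ?_⟩
    by_cases hl' : l ∈ Metric.closedBall (0 : ℝ) R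
    · exact (min_le_right _ _).trans (hmin ⟨hl', hl⟩)
    · exact (min_le_left _ _).trans (hR hl')

theorem exists_inv_norm_le (S : ResolventFamily Ψ U) {δ : ℝ} (hδ : 0 < δ) :
    ∃ C, 0 ≤ C ∧ ∀ l, δ ≤ |l| → ‖Ψ l‖⁻¹ ≤ C * ‖(((1 : ℝ) : ℂ) + Ψ l)⁻¹‖ := by
  obtain ⟨c, hc, h⟩ := S.exists_le_norm_of_le_abs hδ
  refine ⟨1 + c⁻¹, by positivity, fun l hl => ?_⟩
  have h1 := h l hl
  have hpos : 0 < ‖Ψ l‖ := hc.trans_le h1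
  have hpos2 : 0 < ‖((1 : ℝ) : ℂ) + Ψ l‖ := norm_pos_iff.2 (S.add_ne_zero one_pos l)
  have h3 := norm_add_le ((1 : ℝ) : ℂ) (Ψ l)
  rw [norm_inv, inv_le_iff_one_le_mul₀ hpos, mul_assoc, inv_mul_eq_div, ← mul_div_assoc,
    one_le_div₀ hpos2]
  simp only [Complex.ofReal_one, norm_one] at h3
  have h4 : 1 ≤ c⁻¹ * ‖Ψ l‖ := by
    rw [inv_mul_eq_div, one_le_div₀ hc]
    exact h1
  simp only [Complex.ofReal_one]
  linarith

theorem measurable_norm_exponent (S : ResolventFamily Ψ U) : Measurable fun l => ‖Ψ l‖ :=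
  S.continuous_exponent.norm.measurable

theorem integrableOn_inv_norm (S : ResolventFamily Ψ U) {δ : ℝ} (hδ : 0 < δ) :
    IntegrableOn (fun l => ‖Ψ l‖⁻¹) {l | δ ≤ |l|} := by
  obtain ⟨C, hC, h⟩ := S.exists_inv_norm_le hδ
  have hs : MeasurableSet {l : ℝ | δ ≤ |l|} := measurableSet_le (by fun_prop) (by fun_prop)
  refine ((S.integrable_inv 1 one_pos).norm.const_mul C).integrableOn.mono'
    S.measurable_norm_exponent.inv.aestronglyMeasurable ?_
  refine (ae_restrict_iff' hs).2 (Eventually.of_forall fun l hl => ?_)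
  rw [norm_inv, norm_norm]
  exact h l hl

/-- Near the origin `‖Ψ l‖ ≥ c l²`; away from it `1 / ‖Ψ‖` is comparable to the integrable `1 / ‖1 +
Ψ‖`. This function dominates the integrands in the limits `q → 0+` whose numerator is of order `l²`.
-/
theorem integrable_min_sq_div_norm (S : ResolventFamily Ψ U) :
    Integrable fun l => min 1 (l ^ 2) / ‖Ψ l‖ := by
  obtain ⟨c, hc, δ, hδ, h⟩ := S.exists_mul_sq_le_norm
  have h1 : IntegrableOn (fun l => min 1 (l ^ 2) / ‖Ψ l‖) (Icc (-δ) δ) := by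
    refine Measure.integrableOn_of_bounded (M := c⁻¹) (by simp) ?_ ?_
    · have := S.measurable_norm_exponent
      exact Measurable.aestronglyMeasurable (by fun_prop)
    · refine (ae_restrict_iff' measurableSet_Icc).2 (Eventually.of_forall fun l hl => ?_)
      have h2 := h l (abs_le.2 hl)
      rw [norm_of_nonneg (by positivity)]
      rcases eq_or_ne l 0 with rfl | hl0
      · simpa using hc.le
      have : 0 < ‖Ψ l‖ := norm_pos_iff.2 (S.exponent_ne_zero hl0)
      rw [div_le_iff₀ this, inv_mul_eq_div, le_div_iff₀ hc]
      have := min_le_right 1 (l ^ 2)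
      nlinarith
  have h2 : IntegrableOn (fun l => min 1 (l ^ 2) / ‖Ψ l‖) {l | δ ≤ |l|} := by
    refine (S.integrableOn_inv_norm hδ).mono' ?_ (Eventually.of_forall fun l => ?_)
    · have := S.measurable_norm_exponent
      exact Measurable.aestronglyMeasurable (by fun_prop)
    · rw [norm_of_nonneg (by positivity), div_eq_mul_inv]
      exact mul_le_of_le_one_left (by positivity) (min_le_left _ _)
  rw [← integrableOn_univ]
  refine (h1.union h2).mono_set fun l _ => ?_
  rcases le_total δ |l| with hl | hl
  · exact Or.inr hl
  · exact Or.inl (abs_le.1 hl)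

theorem one_sub_cos_le_mul_min (l x : ℝ) :
    1 - cos (l * x) ≤ (2 + x ^ 2) * min 1 (l ^ 2) := by
  have h1 := neg_one_le_cos (l * x)
  have h2 := one_sub_cos_le_sq_half (l * x)
  rcases le_total 1 (l ^ 2) with h | h
  · rw [min_eq_left h]
    nlinarith [sq_nonneg x]
  · rw [min_eq_right h]
    nlinarith [sq_nonneg x, sq_nonneg l, mul_nonneg (sq_nonneg x) (sq_nonneg l)]

theorem integrable_one_sub_cos_div_norm (S : ResolventFamily Ψ U) (x : ℝ) :
    Integrable fun l => (1 - cos (l * x)) / ‖Ψ l‖ := by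
  refine (S.integrable_min_sq_div_norm.const_mul (2 + x ^ 2)).mono' ?_
    (Eventually.of_forall fun l => ?_)
  · have := S.measurable_norm_exponent
    exact Measurable.aestronglyMeasurable (by fun_prop)
  · rw [norm_of_nonneg (div_nonneg (sub_nonneg.2 (cos_le_one _)) (norm_nonneg _)), ← mul_div_assoc]
    exact div_le_div_of_nonneg_right (one_sub_cos_le_mul_min l x) (norm_nonneg _)

theorem tendsto_renormBound_zero (S : ResolventFamily Ψ U) :
    Tendsto (renormBound Ψ) (𝓝 0) (𝓝 0) := by
  have h : Tendsto (fun x => ∫ l, (1 - cos (l * x)) / ‖Ψ l‖) (𝓝 0) (𝓝 (∫ _ : ℝ, (0 : ℝ))) := by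
    refine tendsto_integral_filter_of_dominated_convergence
      (fun l => 3 * (min 1 (l ^ 2) / ‖Ψ l‖)) ?_ ?_ (S.integrable_min_sq_div_norm.const_mul 3) ?_
    · exact Eventually.of_forall fun x =>
        (S.integrable_one_sub_cos_div_norm x).aestronglyMeasurable
    · filter_upwards [Metric.ball_mem_nhds (0 : ℝ) one_pos] with x hx
      refine Eventually.of_forall fun l => ?_
      rw [norm_of_nonneg (div_nonneg (sub_nonneg.2 (cos_le_one _)) (norm_nonneg _)),
        ← mul_div_assoc]
      refine div_le_div_of_nonneg_right ((one_sub_cos_le_mul_min l x).trans ?_) (norm_nonneg _)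
      refine mul_le_mul_of_nonneg_right ?_ (by positivity)
      rw [mem_ball_zero_iff, norm_eq_abs] at hx
      have := (sq_le_one_iff_abs_le_one x).2 hx.le
      linarith
    · refine Eventually.of_forall fun l => ?_
      have hc : Continuous fun x : ℝ => (1 - cos (l * x)) / ‖Ψ l‖ := by fun_prop
      simpa using hc.tendsto 0
  have h2 := h.const_mul π⁻¹
  rw [integral_zero, mul_zero] at h2
  exact h2

theorem renormBound_nonneg (Ψ : ℝ → ℂ) (x : ℝ) : 0 ≤ renormBound Ψ x :=
  mul_nonneg (by positivity) (integral_nonneg fun _ =>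
    div_nonneg (sub_nonneg.2 (cos_le_one _)) (norm_nonneg _))

theorem renormBound_neg (Ψ : ℝ → ℂ) (x : ℝ) : renormBound Ψ (-x) = renormBound Ψ x := by
  simp [renormBound]

theorem renormKernel_eq_integral (S : ResolventFamily Ψ U) {q : ℝ} (hq : 0 < q) (x : ℝ) :
    renormKernel Ψ q x =
      (2 * π)⁻¹ * ∫ l : ℝ, ((1 - Complex.exp ((l * x : ℝ) * Complex.I)) * ((q : ℂ) + Ψ l)⁻¹).re := by
  have h0 := (integrable_exp_mul (S.integrable_inv q hq) 0).re
  have hx := (integrable_exp_mul (S.integrable_inv q hq) (-x)).re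
  have hsub := integral_sub h0 hx
  simp only [RCLike.re_to_complex] at hsub
  rw [renormKernel, resolventKernel, resolventKernel, invDensity, invDensity, ← mul_sub, ← hsub]
  congr 1
  refine integral_congr_ae (Eventually.of_forall fun l => ?_)
  beta_reduce
  rw [← Complex.sub_re, ← sub_mul]
  congr 3
  · simp
  · congr 1
    push_cast
    ring

theorem norm_inv_add_le (S : ResolventFamily Ψ U) {q : ℝ} (hq : 0 < q) {l : ℝ} (hl : l ≠ 0) :
    ‖((q : ℂ) + Ψ l)⁻¹‖ ≤ ‖Ψ l‖⁻¹ := by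
  rw [norm_inv]
  exact inv_anti₀ (norm_pos_iff.2 (S.exponent_ne_zero hl)) (S.norm_le_norm_add hq.le l)

theorem integrable_renormKernel_integrand (S : ResolventFamily Ψ U) {q : ℝ} (hq : 0 < q) (x : ℝ) :
    Integrable fun l : ℝ =>
      (1 - Complex.exp ((l * x : ℝ) * Complex.I)) * ((q : ℂ) + Ψ l)⁻¹ := by
  refine (S.integrable_inv q hq).bdd_mul (c := 2) (by fun_prop) (Eventually.of_forall fun l => ?_)
  refine (norm_sub_le _ _).trans ?_
  rw [Complex.norm_exp_ofReal_mul_I, norm_one]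
  norm_num

/-- Symmetrising turns `1 - exp (i l x)`, of order `l` only, into the real factor `2 (1 - cos (l
x))` of order `l²`, which is integrable against `1 / ‖Ψ‖`. Since both summands are nonnegative, each
is then bounded separately. -/
theorem renormKernel_add_neg_le (S : ResolventFamily Ψ U) {q : ℝ} (hq : 0 < q) (x : ℝ) :
    renormKernel Ψ q x + renormKernel Ψ q (-x) ≤ renormBound Ψ x := by
  have hadd := integral_add (S.integrable_renormKernel_integrand hq x).re
    (S.integrable_renormKernel_integrand hq (-x)).re
  simp only [RCLike.re_to_complex] at hadd
  rw [S.renormKernel_eq_integral hq, S.renormKernel_eq_integral hq, ← mul_add, ← hadd, renormBound,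
    mul_inv, mul_comm 2⁻¹, mul_assoc, ← integral_const_mul]
  refine mul_le_mul_of_nonneg_left ?_ (by positivity)
  refine integral_mono ?_ (S.integrable_one_sub_cos_div_norm x) fun l => ?_
  · exact (((S.integrable_renormKernel_integrand hq x).re).add
      (S.integrable_renormKernel_integrand hq (-x)).re).const_mul _
  · beta_reduce
    rw [← Complex.add_re, ← add_mul]
    have e : (1 - Complex.exp ((l * x : ℝ) * Complex.I)) +
        (1 - Complex.exp ((l * -x : ℝ) * Complex.I)) = ((2 * (1 - cos (l * x)) : ℝ) : ℂ) := by
      push_cast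
      rw [Complex.cos]
      ring_nf
    rw [e, Complex.re_ofReal_mul]
    rcases eq_or_ne l 0 with rfl | hl
    · simp
    have h1 := (Complex.re_le_norm ((q : ℂ) + Ψ l)⁻¹).trans (S.norm_inv_add_le hq hl)
    have h2 := sub_nonneg.2 (cos_le_one (l * x))
    rw [div_eq_mul_inv]
    have := mul_le_mul_of_nonneg_left h1 h2
    linarith

theorem renormKernel_le (S : ResolventFamily Ψ U) {q : ℝ} (hq : 0 < q) (x : ℝ) :
    renormKernel Ψ q x ≤ renormBound Ψ x := by
  have := S.renormKernel_add_neg_le hq x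
  have := S.renormKernel_nonneg hq (-x)
  linarith

theorem abs_renormKernel_add_sub_le (S : ResolventFamily Ψ U) {q : ℝ} (hq : 0 < q) (x y : ℝ) :
    |renormKernel Ψ q (x + y) - renormKernel Ψ q x| ≤ renormBound Ψ y := by
  have h1 := S.renormKernel_add_le hq x y
  have h2 := S.renormKernel_add_le hq (x + y) (-y)
  rw [add_neg_cancel_right] at h2
  have h3 := S.renormKernel_le hq y
  have h4 := S.renormKernel_le hq (-y)
  rw [renormBound_neg] at h4
  rw [abs_le]
  constructor <;> linarith

/-- Cut `x` into `⌈|x|⌉` steps of length at most one and use subadditivity. The bound is uniform in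
`q`, for use in dominated convergence against `U 1`. -/
theorem exists_renormKernel_le_linear (S : ResolventFamily Ψ U) :
    ∃ C, 0 ≤ C ∧ ∀ q, 0 < q → ∀ x, renormKernel Ψ q x ≤ C * (1 + |x|) := by
  set D := π⁻¹ * ∫ l, 3 * (min 1 (l ^ 2) / ‖Ψ l‖) with hD
  have hD0 : 0 ≤ D := mul_nonneg (by positivity) (integral_nonneg fun l => by positivity)
  have hw : ∀ x, |x| ≤ 1 → renormBound Ψ x ≤ D := by
    intro x hx
    refine mul_le_mul_of_nonneg_left ?_ (by positivity)
    refine integral_mono (S.integrable_one_sub_cos_div_norm x)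
      (S.integrable_min_sq_div_norm.const_mul 3) fun l => ?_
    beta_reduce
    rw [← mul_div_assoc]
    refine div_le_div_of_nonneg_right ((one_sub_cos_le_mul_min l x).trans ?_) (norm_nonneg _)
    refine mul_le_mul_of_nonneg_right ?_ (by positivity)
    have := (sq_le_one_iff_abs_le_one x).2 hx
    linarith
  refine ⟨D, hD0, fun q hq x => ?_⟩
  set n := ⌈|x|⌉₊ with hn
  have hn1 : |x| ≤ n := Nat.le_ceil _
  have hn2 : (n : ℝ) < |x| + 1 := Nat.ceil_lt_add_one (abs_nonneg x)
  rcases eq_or_ne x 0 with rfl | hx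
  · rw [renormKernel_zero]; positivity
  have hn0 : (0 : ℝ) < n := (abs_pos.2 hx).trans_le hn1
  have h1 := S.renormKernel_natCast_mul_le hq n (x / n)
  rw [mul_div_cancel₀ _ hn0.ne'] at h1
  have h2 : renormKernel Ψ q (x / n) ≤ D := (S.renormKernel_le hq _).trans (hw _ (by
    rw [abs_div, abs_of_pos hn0]
    exact div_le_one_of_le₀ hn1 hn0.le))
  nlinarith

end ResolventFamily

/-! ### Asymptotically additive functions -/

theorem eq_mul_of_additive {d w : ℝ → ℝ} (hadd : ∀ x y, d (x + y) = d x + d y)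
    (hdw : ∀ x, |d x| ≤ w x) (hw : Tendsto w (𝓝 0) (𝓝 0)) (x : ℝ) : d x = x * d 1 := by
  let D : ℝ →+ ℝ := AddMonoidHom.mk' d hadd
  have hD : Continuous D := by
    refine continuous_of_continuousAt_zero D ?_
    rw [ContinuousAt, map_zero]
    exact squeeze_zero_norm hdw hw
  have := map_real_smul D hD x 1
  simpa [D] using this

theorem exists_tendsto_of_ultrafilter {ι : Type*} (𝒰 : Ultrafilter ι) {f : ι → ℝ} {C : ℝ}
    (h : ∀ᶠ i in 𝒰, |f i| ≤ C) : ∃ a, Tendsto f 𝒰 (𝓝 a) := by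
  obtain ⟨a, -, ha⟩ := (isCompact_Icc (a := -C) (b := C)).ultrafilter_le_nhds (𝒰.map f) (by
    rw [le_principal_iff]
    exact h.mono fun i hi => abs_le.1 hi)
  exact ⟨a, ha⟩

/-- Equicontinuous functions that are asymptotically additive are asymptotically linear. -/
theorem tendsto_sub_mul_of_additive {ι : Type*} {𝓕 : Filter ι} {k : ι → ℝ → ℝ} {w : ℝ → ℝ}
    (hw : Tendsto w (𝓝 0) (𝓝 0)) (hk : ∀ᶠ i in 𝓕, ∀ x, |k i x| ≤ w x)
    (hadd : ∀ x y, Tendsto (fun i => k i (x + y) - k i x - k i y) 𝓕 (𝓝 0)) (x : ℝ) :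
    Tendsto (fun i => k i x - x * k i 1) 𝓕 (𝓝 0) := by
  -- Along an ultrafilter all the bounded families converge; the pointwise limit `d` is additive and
  -- continuous at `0`, hence linear.
  rw [tendsto_iff_ultrafilter]
  intro 𝒰 h𝒰
  choose d hd using fun x => exists_tendsto_of_ultrafilter 𝒰 (f := fun i => k i x) (C := w x)
    ((hk.filter_mono h𝒰).mono fun i hi => hi x)
  have hd1 : ∀ x y, d (x + y) = d x + d y := by
    intro x y
    have h1 := ((hd (x + y)).sub (hd x)).sub (hd y)
    have h2 := tendsto_nhds_unique h1 ((hadd x y).mono_left h𝒰)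
    linarith
  have hd2 : ∀ x, |d x| ≤ w x := fun x =>
    le_of_tendsto (hd x).abs ((hk.filter_mono h𝒰).mono fun i hi => hi x)
  have h := (hd x).sub ((hd 1).const_mul x)
  rwa [← eq_mul_of_additive hd1 hd2 hw x, sub_self] at h

/-- Cauchy criterion: convergence of the additive defects makes the differences `k i - k j`
asymptotically additive along `𝓕 ×ˢ 𝓕`, so the previous theorem applies to them. -/
theorem exists_tendsto_sub_mul {ι : Type*} {𝓕 : Filter ι} [NeBot 𝓕] {k : ι → ℝ → ℝ} {w : ℝ → ℝ}
    (hw : Tendsto w (𝓝 0) (𝓝 0)) (hk : ∀ᶠ i in 𝓕, ∀ x, |k i x| ≤ w x)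
    (hadd : ∀ x y, ∃ L, Tendsto (fun i => k i x + k i y - k i (x + y)) 𝓕 (𝓝 L)) (x : ℝ) :
    ∃ L, Tendsto (fun i => k i x - x * k i 1) 𝓕 (𝓝 L) := by
  have h := tendsto_sub_mul_of_additive (𝓕 := 𝓕 ×ˢ 𝓕) (k := fun p x => k p.1 x - k p.2 x)
    (w := fun x => 2 * w x) (by simpa using hw.const_mul 2) ?_ ?_ x
  · refine cauchy_map_iff_exists_tendsto.1 (cauchy_map_iff.2 ⟨inferInstance, ?_⟩)
    rw [Metric.uniformity_eq_comap_nhds_zero, tendsto_comap_iff]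
    have h2 := h.abs
    rw [abs_zero] at h2
    refine h2.congr fun p => ?_
    simp only [Function.comp, dist_eq]
    congr 1
    ring
  · filter_upwards [hk.prod_mk hk] with p hp x
    have h1 := abs_sub (k p.1 x) (k p.2 x)
    have h2 := hp.1 x
    have h3 := hp.2 x
    linarith
  · intro y z
    obtain ⟨L, hL⟩ := hadd y z
    have h := (hL.comp tendsto_snd).sub (hL.comp (tendsto_fst (f := 𝓕) (g := 𝓕)))
    rw [sub_self] at h
    refine h.congr fun p => ?_
    simp only [Function.comp]
    ring

/-- Cesàro means of the unit increments give the limit along the integers; the increment bound makes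
the passage from `⌊x⌋₊` to `x` cost `O(1)`. -/
theorem tendsto_div_atTop_of_increment {h : ℝ → ℝ} {c C : ℝ}
    (hC : ∀ x y, |h (x + y) - h x| ≤ C * (1 + |y|))
    (hc : Tendsto (fun x => h (x + 1) - h x) atTop (𝓝 c)) :
    Tendsto (fun x => h x / x) atTop (𝓝 c) := by
  have h1 := (hc.comp tendsto_natCast_atTop_atTop).cesaro
  have h2 : Tendsto (fun n : ℕ => (n : ℝ)⁻¹ * (h n - h 0)) atTop (𝓝 c) := by
    refine h1.congr fun n => ?_
    congr 1
    have := Finset.sum_range_sub (fun i : ℕ => h i) n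
    simp only [Nat.cast_add, Nat.cast_one, Nat.cast_zero] at this
    simpa using this
  have hfl : Tendsto (fun x : ℝ => ⌊x⌋₊) atTop atTop := tendsto_nat_floor_atTop
  have h3 := (h2.comp hfl).mul (tendsto_nat_floor_div_atTop (R := ℝ))
  rw [mul_one] at h3
  have h4 : Tendsto (fun x : ℝ => (h x - h ⌊x⌋₊ + h 0) / x) atTop (𝓝 0) := by
    refine squeeze_zero_norm' (a := fun x : ℝ => (C * 2 + |h 0|) / x) ?_
      (tendsto_const_nhds.div_atTop tendsto_id)
    filter_upwards [eventually_gt_atTop 0] with x hx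
    have h5 := hC ⌊x⌋₊ (x - ⌊x⌋₊)
    rw [add_sub_cancel] at h5
    have h6 : |x - ⌊x⌋₊| ≤ 1 := by
      rw [abs_of_nonneg (sub_nonneg.2 (Nat.floor_le hx.le))]
      linarith [Nat.lt_floor_add_one x]
    have hC0 : 0 ≤ C := by
      have := (abs_nonneg _).trans (hC 0 0)
      simpa using this
    rw [norm_div, norm_of_nonneg hx.le, norm_eq_abs]
    refine div_le_div_of_nonneg_right ?_ hx.le
    refine (abs_add_le _ _).trans (add_le_add (h5.trans ?_) le_rfl)
    exact mul_le_mul_of_nonneg_left (by linarith) hC0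
  have h5 := h3.add h4
  rw [add_zero] at h5
  refine h5.congr' ?_
  filter_upwards [eventually_ge_atTop 1] with x hx
  have hn : (0 : ℝ) < ⌊x⌋₊ := by exact_mod_cast Nat.floor_pos.2 hx
  simp only [Function.comp]
  field_simp
  ring

theorem tendsto_div_abs_atBot_of_increment {h : ℝ → ℝ} {c C : ℝ}
    (hC : ∀ x y, |h (x + y) - h x| ≤ C * (1 + |y|))
    (hc : Tendsto (fun x => h (x + 1) - h x) atBot (𝓝 c)) :
    Tendsto (fun x => h x / |x|) atBot (𝓝 (-c)) := by
  have h1 : Tendsto (fun x => h (-x) / x) atTop (𝓝 (-c)) := by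
    refine tendsto_div_atTop_of_increment (h := fun x => h (-x)) (C := C) (fun x y => ?_) ?_
    · have := hC (-x) (-y)
      rwa [abs_neg, ← neg_add] at this
    · have h2 := (hc.comp (tendsto_neg_atTop_atBot.comp (tendsto_atTop_add_const_right _ 1
        tendsto_id))).neg
      refine h2.congr fun x => ?_
      simp only [Function.comp, id]
      rw [show -(x + 1) + 1 = -x by ring]
      ring
  have h2 := h1.comp tendsto_neg_atBot_atTop
  refine h2.congr' ?_
  filter_upwards [eventually_le_atBot 0] with x hx
  simp [abs_of_nonpos hx]

/-! ### Subsequential limits of the renormalized densities -/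

/-- `h` is the pointwise limit of the renormalized resolvent densities along `q = u n → 0+`. -/
structure IsKernelLimit (Ψ : ℝ → ℂ) (u : ℕ → ℝ) (h : ℝ → ℝ) : Prop where
  tendsto_index : Tendsto u atTop (𝓝[>] 0)
  tendsto : ∀ x, Tendsto (fun n => renormKernel Ψ (u n) x) atTop (𝓝 (h x))

theorem norm_exp_ofReal_mul_I_sub_one_le (x : ℝ) :
    ‖Complex.exp (x * Complex.I) - 1‖ ≤ |x| := by
  rw [mul_comm]
  exact norm_exp_I_mul_ofReal_sub_one_le

theorem norm_exp_ofReal_mul_I_sub_one_le_two (x : ℝ) :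
    ‖Complex.exp (x * Complex.I) - 1‖ ≤ 2 := by
  refine (norm_sub_le _ _).trans ?_
  rw [Complex.norm_exp_ofReal_mul_I, norm_one]
  norm_num

namespace ResolventFamily

variable {Ψ : ℝ → ℂ} {U : ℝ → Measure ℝ}

/-- The killed kernel increases as `q` decreases and is bounded by `renormBound`, so it converges;
the product term is a bounded quantity over `r_q(0) → ∞`. -/
theorem exists_tendsto_renormKernel_cocycle (S : ResolventFamily Ψ U)
    (hrec : Tendsto (fun q => resolventKernel Ψ q 0) (𝓝[>] 0) atTop) (x y : ℝ) :
    ∃ L, Tendsto (fun q => renormKernel Ψ q x + renormKernel Ψ q y - renormKernel Ψ q (x + y))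
      (𝓝[>] 0) (𝓝 L) := by
  have heq (q : ℝ) (hq : 0 < q) : renormKernel Ψ q x + renormKernel Ψ q y -
      renormKernel Ψ q (x + y) = killedKernel Ψ q x (-y) +
        renormKernel Ψ q x * renormKernel Ψ q y / resolventKernel Ψ q 0 := by
    have h := S.renormKernel_sub_eq hq x (-y)
    rwa [neg_neg, sub_neg_eq_add] at h
  have h1 : Tendsto (fun q => renormKernel Ψ q x * renormKernel Ψ q y / resolventKernel Ψ q 0)
      (𝓝[>] 0) (𝓝 0) := by
    refine squeeze_zero' (g := fun q => renormBound Ψ x * renormBound Ψ y / resolventKernel Ψ q 0)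
      ?_ ?_ (tendsto_const_nhds.div_atTop hrec)
    · filter_upwards [self_mem_nhdsWithin] with q hq
      exact div_nonneg (mul_nonneg (S.renormKernel_nonneg hq x) (S.renormKernel_nonneg hq y))
        (S.kernel_zero_pos hq).le
    · filter_upwards [self_mem_nhdsWithin] with q hq
      refine div_le_div_of_nonneg_right ?_ (S.kernel_zero_pos hq).le
      exact mul_le_mul (S.renormKernel_le hq x) (S.renormKernel_le hq y)
        (S.renormKernel_nonneg hq y) (renormBound_nonneg Ψ x)
  have h2 : Tendsto (fun q => killedKernel Ψ q x (-y)) (𝓝[>] 0)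
      (𝓝 (sSup ((fun q => killedKernel Ψ q x (-y)) '' Ioi 0))) := by
    refine AntitoneOn.tendsto_nhdsGT (fun p hp q hq hpq => S.killedKernel_antitone hp hpq x (-y))
      ?_
    refine ⟨renormBound Ψ x + renormBound Ψ y, ?_⟩
    rintro _ ⟨q, hq, rfl⟩
    have hq : 0 < q := hq
    have e := heq q hq
    have := S.renormKernel_le hq x
    have := S.renormKernel_le hq y
    have := S.renormKernel_nonneg hq (x + y)
    have : 0 ≤ renormKernel Ψ q x * renormKernel Ψ q y / resolventKernel Ψ q 0 :=
      div_nonneg (mul_nonneg (S.renormKernel_nonneg hq x) (S.renormKernel_nonneg hq y))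
        (S.kernel_zero_pos hq).le
    simp only
    linarith
  refine ⟨_, (h2.add h1).congr' ?_⟩
  filter_upwards [self_mem_nhdsWithin] with q hq
  exact (heq q hq).symm

theorem exists_tendsto_renormKernel_sub_mul (S : ResolventFamily Ψ U)
    (hrec : Tendsto (fun q => resolventKernel Ψ q 0) (𝓝[>] 0) atTop) (x : ℝ) :
    ∃ L, Tendsto (fun q => renormKernel Ψ q x - x * renormKernel Ψ q 1) (𝓝[>] 0) (𝓝 L) := by
  refine exists_tendsto_sub_mul S.tendsto_renormBound_zero ?_
    (S.exists_tendsto_renormKernel_cocycle hrec) x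
  filter_upwards [self_mem_nhdsWithin] with q hq x
  rw [abs_of_nonneg (S.renormKernel_nonneg hq x)]
  exact S.renormKernel_le hq x

theorem norm_mixed_le (x z l : ℝ) :
    ‖(Complex.exp ((l * x : ℝ) * Complex.I) - 1) * (Complex.exp ((l * z : ℝ) * Complex.I) - 1)‖
      ≤ (4 + |x| * |z|) * min 1 (l ^ 2) := by
  rw [norm_mul]
  have h1 := norm_exp_ofReal_mul_I_sub_one_le (l * x)
  have h2 := norm_exp_ofReal_mul_I_sub_one_le (l * z)
  have h3 := norm_exp_ofReal_mul_I_sub_one_le_two (l * x)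
  have h4 := norm_exp_ofReal_mul_I_sub_one_le_two (l * z)
  have hxz : 0 ≤ |x| * |z| := by positivity
  rcases le_total 1 (l ^ 2) with h | h
  · rw [min_eq_left h]
    have := mul_le_mul h3 h4 (norm_nonneg _) (by norm_num)
    linarith
  · rw [min_eq_right h]
    have h5 := mul_le_mul h1 h2 (norm_nonneg _) (abs_nonneg _)
    have h6 : |l * x| * |l * z| = |x| * |z| * l ^ 2 := by
      rw [abs_mul, abs_mul, ← sq_abs l]; ring
    nlinarith [sq_nonneg l]

theorem integrable_mixed (S : ResolventFamily Ψ U) (x z : ℝ) :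
    Integrable fun l : ℝ => (Complex.exp ((l * x : ℝ) * Complex.I) - 1) *
      (Complex.exp ((l * z : ℝ) * Complex.I) - 1) / Ψ l := by
  refine (S.integrable_min_sq_div_norm.const_mul (4 + |x| * |z|)).mono' ?_
    (Eventually.of_forall fun l => ?_)
  · have := S.continuous_exponent.measurable
    exact Measurable.aestronglyMeasurable (by fun_prop)
  · rw [norm_div, ← mul_div_assoc]
    exact div_le_div_of_nonneg_right (norm_mixed_le x z l) (norm_nonneg _)

theorem renormKernel_mixed (S : ResolventFamily Ψ U) {q : ℝ} (hq : 0 < q) (x z y : ℝ) :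
    renormKernel Ψ q (y + (x + z)) - renormKernel Ψ q (y + x) - renormKernel Ψ q (y + z) +
      renormKernel Ψ q y =
    -(2 * π)⁻¹ * ∫ l : ℝ, (Complex.exp (-(l * -y : ℝ) * Complex.I) *
      ((Complex.exp ((l * x : ℝ) * Complex.I) - 1) *
        (Complex.exp ((l * z : ℝ) * Complex.I) - 1) * ((q : ℂ) + Ψ l)⁻¹)).re := by
  have i1 := (S.integrable_renormKernel_integrand hq (y + (x + z))).re
  have i2 := (S.integrable_renormKernel_integrand hq (y + x)).re
  have i3 := (S.integrable_renormKernel_integrand hq (y + z)).re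
  have i4 := (S.integrable_renormKernel_integrand hq y).re
  have e := integral_add ((i1.sub i2).sub i3) i4
  have e2 := integral_sub (i1.sub i2) i3
  have e3 := integral_sub i1 i2
  simp only [Pi.sub_apply, RCLike.re_to_complex] at e e2 e3
  rw [e2, e3] at e
  rw [S.renormKernel_eq_integral hq, S.renormKernel_eq_integral hq, S.renormKernel_eq_integral hq,
    S.renormKernel_eq_integral hq, ← mul_sub, ← mul_sub, ← mul_add, ← e, neg_mul, ← mul_neg,
    ← integral_neg]
  congr 1
  refine integral_congr_ae (Eventually.of_forall fun l => ?_)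
  beta_reduce
  rw [← Complex.sub_re, ← Complex.sub_re, ← Complex.add_re, ← Complex.neg_re]
  congr 1
  have a1 : Complex.exp ((l * (y + (x + z)) : ℝ) * Complex.I) =
      Complex.exp ((l * y : ℝ) * Complex.I) * (Complex.exp ((l * x : ℝ) * Complex.I) *
        Complex.exp ((l * z : ℝ) * Complex.I)) := by
    rw [← Complex.exp_add, ← Complex.exp_add]; congr 1; push_cast; ring
  have a2 (t : ℝ) : Complex.exp ((l * (y + t) : ℝ) * Complex.I) =
      Complex.exp ((l * y : ℝ) * Complex.I) * Complex.exp ((l * t : ℝ) * Complex.I) := by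
    rw [← Complex.exp_add]; congr 1; push_cast; ring
  have a3 : Complex.exp (-(l * -y : ℝ) * Complex.I) = Complex.exp ((l * y : ℝ) * Complex.I) := by
    congr 1; push_cast; ring
  rw [a1, a2, a2, a3]
  ring

/-- A mixed second difference carries the factor `(exp (i l x) - 1) (exp (i l z) - 1)` of order
`l²`, so `q` can be sent to `0` inside the integral without knowing that `h_q` itself converges. -/
theorem tendsto_renormKernel_mixed (S : ResolventFamily Ψ U) (x z y : ℝ) :
    Tendsto (fun q => renormKernel Ψ q (y + (x + z)) - renormKernel Ψ q (y + x) -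
      renormKernel Ψ q (y + z) + renormKernel Ψ q y) (𝓝[>] 0)
    (𝓝 (-(2 * π)⁻¹ * ∫ l : ℝ, (Complex.exp (-(l * -y : ℝ) * Complex.I) *
      ((Complex.exp ((l * x : ℝ) * Complex.I) - 1) *
        (Complex.exp ((l * z : ℝ) * Complex.I) - 1) / Ψ l)).re)) := by
  have h : Tendsto (fun q : ℝ => ∫ l : ℝ, (Complex.exp (-(l * -y : ℝ) * Complex.I) *
      ((Complex.exp ((l * x : ℝ) * Complex.I) - 1) *
        (Complex.exp ((l * z : ℝ) * Complex.I) - 1) * ((q : ℂ) + Ψ l)⁻¹)).re) (𝓝[>] 0)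
    (𝓝 (∫ l : ℝ, (Complex.exp (-(l * -y : ℝ) * Complex.I) *
      ((Complex.exp ((l * x : ℝ) * Complex.I) - 1) *
        (Complex.exp ((l * z : ℝ) * Complex.I) - 1) / Ψ l)).re)) := by
    have hΨ := S.continuous_exponent.measurable
    refine tendsto_integral_filter_of_dominated_convergence
      (fun l => (4 + |x| * |z|) * (min 1 (l ^ 2) / ‖Ψ l‖)) ?_ ?_
      (S.integrable_min_sq_div_norm.const_mul _) ?_
    · exact Eventually.of_forall fun q => Measurable.aestronglyMeasurable (by fun_prop)
    · filter_upwards [self_mem_nhdsWithin] with q hq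
      refine Eventually.of_forall fun l => ?_
      refine (Complex.abs_re_le_norm _).trans ?_
      rw [norm_mul, norm_exp_neg_mul_I, one_mul, norm_mul]
      rcases eq_or_ne l 0 with rfl | hl
      · simp
      rw [div_eq_mul_inv, ← mul_assoc]
      exact mul_le_mul (norm_mixed_le x z l) (S.norm_inv_add_le hq hl) (norm_nonneg _)
        (by positivity)
    · filter_upwards [compl_mem_ae_iff.2 (measure_singleton (0 : ℝ))] with l hl
      have hl : l ≠ 0 := hl
      have hne := S.exponent_ne_zero hl
      have h1 : Tendsto (fun q : ℝ => (q : ℂ) + Ψ l) (𝓝[>] 0) (𝓝 (Ψ l)) := by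
        have : Continuous fun q : ℝ => (q : ℂ) + Ψ l := by fun_prop
        simpa using (this.tendsto 0).mono_left nhdsWithin_le_nhds
      have h2 := (h1.inv₀ hne).const_mul ((Complex.exp ((l * x : ℝ) * Complex.I) - 1) *
        (Complex.exp ((l * z : ℝ) * Complex.I) - 1))
      have h3 := h2.const_mul (Complex.exp (-(l * -y : ℝ) * Complex.I))
      exact (Complex.continuous_re.tendsto _).comp h3
  refine (h.const_mul _).congr' ?_
  filter_upwards [self_mem_nhdsWithin] with q hq
  rw [S.renormKernel_mixed hq]

end ResolventFamily

namespace IsKernelLimit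

variable {Ψ : ℝ → ℂ} {U : ℝ → Measure ℝ} {u : ℕ → ℝ} {h : ℝ → ℝ}

theorem eventually_pos (H : IsKernelLimit Ψ u h) : ∀ᶠ n in atTop, 0 < u n :=
  H.tendsto_index.eventually self_mem_nhdsWithin

theorem nonneg (H : IsKernelLimit Ψ u h) (S : ResolventFamily Ψ U) (x : ℝ) : 0 ≤ h x :=
  ge_of_tendsto (H.tendsto x) (H.eventually_pos.mono fun _ hn => S.renormKernel_nonneg hn x)

theorem le_renormBound (H : IsKernelLimit Ψ u h) (S : ResolventFamily Ψ U) (x : ℝ) :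
    h x ≤ renormBound Ψ x :=
  le_of_tendsto (H.tendsto x) (H.eventually_pos.mono fun _ hn => S.renormKernel_le hn x)

theorem add_le (H : IsKernelLimit Ψ u h) (S : ResolventFamily Ψ U) (x y : ℝ) :
    h (x + y) ≤ h x + h y :=
  le_of_tendsto_of_tendsto (H.tendsto _) ((H.tendsto x).add (H.tendsto y))
    (H.eventually_pos.mono fun _ hn => S.renormKernel_add_le hn x y)

theorem abs_add_sub_le (H : IsKernelLimit Ψ u h) (S : ResolventFamily Ψ U) (x y : ℝ) :
    |h (x + y) - h x| ≤ renormBound Ψ y :=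
  le_of_tendsto ((H.tendsto _).sub (H.tendsto x)).abs
    (H.eventually_pos.mono fun _ hn => S.abs_renormKernel_add_sub_le hn x y)

theorem continuous (H : IsKernelLimit Ψ u h) (S : ResolventFamily Ψ U) : Continuous h := by
  refine continuous_iff_continuousAt.2 fun x => ?_
  rw [ContinuousAt, tendsto_iff_dist_tendsto_zero]
  have hw : Tendsto (fun y => renormBound Ψ (y - x)) (𝓝 x) (𝓝 0) := by
    refine S.tendsto_renormBound_zero.comp ?_
    have : Continuous fun y : ℝ => y - x := by fun_prop
    simpa using this.tendsto x
  refine squeeze_zero (fun _ => dist_nonneg) (fun y => ?_) hw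
  have := H.abs_add_sub_le S x (y - x)
  rwa [add_sub_cancel, ← dist_eq] at this

theorem exists_abs_add_sub_le (H : IsKernelLimit Ψ u h) (S : ResolventFamily Ψ U) :
    ∃ C, 0 ≤ C ∧ ∀ x y, |h (x + y) - h x| ≤ C * (1 + |y|) := by
  obtain ⟨C, hC0, hC⟩ := S.exists_renormKernel_le_linear
  have hle : ∀ x, h x ≤ C * (1 + |x|) := fun x =>
    le_of_tendsto (H.tendsto x) (H.eventually_pos.mono fun n hn => hC _ hn x)
  refine ⟨C, hC0, fun x y => ?_⟩
  have h1 := H.add_le S x y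
  have h2 := H.add_le S (x + y) (-y)
  rw [add_neg_cancel_right] at h2
  have h3 := hle y
  have h4 := hle (-y)
  rw [abs_neg] at h4
  rw [abs_le]
  constructor <;> linarith

theorem tendsto_mixed (H : IsKernelLimit Ψ u h) (S : ResolventFamily Ψ U) (x z : ℝ) :
    Tendsto (fun y => h (y + (x + z)) - h (y + x) - h (y + z) + h y) (cocompact ℝ) (𝓝 0) := by
  have e (y : ℝ) := tendsto_nhds_unique
    ((((H.tendsto (y + (x + z))).sub (H.tendsto (y + x))).sub (H.tendsto (y + z))).add
      (H.tendsto y)) ((S.tendsto_renormKernel_mixed x z y).comp H.tendsto_index)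
  have h1 := (tendsto_integral_exp_mul_cocompact fun l : ℝ =>
    (Complex.exp ((l * x : ℝ) * Complex.I) - 1) *
        (Complex.exp ((l * z : ℝ) * Complex.I) - 1) / Ψ l).comp
    (Homeomorph.neg ℝ).isClosedEmbedding.tendsto_cocompact
  have h2 := ((Complex.continuous_re.tendsto 0).comp h1).const_mul (-(2 * π)⁻¹)
  rw [Complex.zero_re, mul_zero] at h2
  refine h2.congr fun y => ?_
  rw [e y, integral_exp_mul_re (S.integrable_mixed x z)]
  rfl

/-- At infinity the increments of `h` are asymptotically linear. -/
theorem tendsto_increment_sub_mul (H : IsKernelLimit Ψ u h) (S : ResolventFamily Ψ U)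
    {𝓕 : Filter ℝ} (h𝓕 : 𝓕 ≤ cocompact ℝ) (x : ℝ) :
    Tendsto (fun y => (h (y + x) - h y) - x * (h (y + 1) - h y)) 𝓕 (𝓝 0) := by
  -- The additive defect of the increment `x ↦ h(y + x) - h(y)` is exactly the mixed second
  -- difference at `y`.
  refine tendsto_sub_mul_of_additive (k := fun y x => h (y + x) - h y) S.tendsto_renormBound_zero
    (Eventually.of_forall fun y x => H.abs_add_sub_le S y x) (fun x z => ?_) x
  refine ((H.tendsto_mixed S x z).mono_left h𝓕).congr fun y => ?_
  ring

end IsKernelLimit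

/-! ### Infinite second moment -/

theorem integrable_one_sub_cos_div_sq : Integrable fun u : ℝ => (1 - cos u) / u ^ 2 := by
  refine (integrable_inv_one_add_sq.const_mul (5 / 2)).mono'
    (Measurable.aestronglyMeasurable (by fun_prop)) (Eventually.of_forall fun u => ?_)
  rw [norm_of_nonneg (div_nonneg (sub_nonneg.2 (cos_le_one _)) (sq_nonneg _))]
  rcases eq_or_ne u 0 with rfl | hu
  · norm_num
  have hu2 : 0 < u ^ 2 := by positivity
  rw [← div_eq_mul_inv, div_le_div_iff₀ hu2 (by positivity)]
  have h1 := one_sub_cos_le_sq_half u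
  have h2 := neg_one_le_cos u
  nlinarith

theorem integral_one_sub_cos_mul_div_sq (x : ℝ) :
    ∫ l : ℝ, (1 - cos (l * x)) / l ^ 2 = |x| * ∫ u : ℝ, (1 - cos u) / u ^ 2 := by
  rcases eq_or_ne x 0 with rfl | hx
  · simp
  have h := Measure.integral_comp_mul_right (fun u : ℝ => (1 - cos u) / u ^ 2) x
  have h2 : ∫ l : ℝ, (1 - cos (l * x)) / l ^ 2 =
      x ^ 2 * ∫ l : ℝ, (1 - cos (l * x)) / (l * x) ^ 2 := by
    rw [← integral_const_mul]
    refine integral_congr_ae (Eventually.of_forall fun l => ?_)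
    beta_reduce
    rcases eq_or_ne l 0 with rfl | hl
    · simp
    field_simp
  rw [h2, h, smul_eq_mul, ← mul_assoc, abs_inv, ← sq_abs]
  have : |x| ≠ 0 := abs_ne_zero.2 hx
  field_simp

theorem integrable_one_sub_cos_mul_div_sq (x : ℝ) :
    Integrable fun l : ℝ => (1 - cos (l * x)) / l ^ 2 := by
  rcases eq_or_ne x 0 with rfl | hx
  · simp
  refine ((integrable_one_sub_cos_div_sq.comp_mul_right' hx).const_mul (x ^ 2)).congr
    (Eventually.of_forall fun l => ?_)
  beta_reduce
  rcases eq_or_ne l 0 with rfl | hl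
  · simp
  field_simp

namespace ResolventFamily

variable {Ψ : ℝ → ℂ} {U : ℝ → Measure ℝ}

/-- An infinite second moment gives `‖Ψ l‖ ≥ c l²` near `0` for every `c`. The part of the integral
near the origin is then at most `|x| I / c` by scaling, and the rest is bounded in `x`. -/
theorem tendsto_renormBound_div_abs (S : ResolventFamily Ψ U)
    (hM : ∫⁻ x, ENNReal.ofReal (x ^ 2) ∂(U 1) = ∞) :
    Tendsto (fun x => renormBound Ψ x / |x|) (cocompact ℝ) (𝓝 0) := by
  set I := ∫ u : ℝ, (1 - cos u) / u ^ 2 with hI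
  have hI0 : 0 ≤ I := integral_nonneg fun u =>
    div_nonneg (sub_nonneg.2 (cos_le_one _)) (sq_nonneg _)
  have habs : Tendsto (fun x : ℝ => |x|) (cocompact ℝ) atTop := tendsto_norm_cocompact_atTop
  rw [Metric.tendsto_nhds]
  intro ε hε
  -- Chosen so that `I / c < ε`; the prefactor `1 / π` is at most one.
  set c := (I + 1) / ε with hc
  have hc0 : 0 < c := by positivity
  obtain ⟨δ, hδ, hball⟩ := Metric.eventually_nhds_iff_ball.1
    (S.eventually_mul_sq_le_norm (c := c) (by rw [hM]; exact ENNReal.ofReal_lt_top))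
  set D := ∫ l in {l : ℝ | δ ≤ |l|}, ‖Ψ l‖⁻¹ with hD
  have hs : MeasurableSet {l : ℝ | δ ≤ |l|} := measurableSet_le (by fun_prop) (by fun_prop)
  have hbound (x : ℝ) : renormBound Ψ x ≤ π⁻¹ * (c⁻¹ * (|x| * I) + 2 * D) := by
    refine mul_le_mul_of_nonneg_left ?_ (by positivity)
    rw [← integral_one_sub_cos_mul_div_sq, hD, ← integral_indicator hs, ← integral_const_mul,
      ← integral_const_mul]
    have i1 := (integrable_one_sub_cos_mul_div_sq x).const_mul c⁻¹
    have i2 := ((integrable_indicator_iff hs).2 (S.integrableOn_inv_norm hδ)).const_mul 2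
    rw [← integral_add i1 i2]
    refine integral_mono (S.integrable_one_sub_cos_div_norm x) (i1.add i2) fun l => ?_
    have hcos := sub_nonneg.2 (cos_le_one (l * x))
    have hcos2 := neg_one_le_cos (l * x)
    beta_reduce
    by_cases hl : δ ≤ |l|
    · rw [indicator_of_mem (show l ∈ {l : ℝ | δ ≤ |l|} from hl), div_eq_mul_inv]
      have h1 : 0 ≤ c⁻¹ * ((1 - cos (l * x)) / l ^ 2) := by positivity
      have h2 : (1 - cos (l * x)) * ‖Ψ l‖⁻¹ ≤ 2 * ‖Ψ l‖⁻¹ :=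
        mul_le_mul_of_nonneg_right (by linarith) (by positivity)
      linarith
    · rw [indicator_of_notMem (show l ∉ {l : ℝ | δ ≤ |l|} from hl), mul_zero, add_zero]
      rcases eq_or_ne l 0 with rfl | hl0
      · simp
      have h1 := hball l (by
        rw [Metric.mem_ball, dist_zero_right, norm_eq_abs]; exact lt_of_not_ge hl)
      have h2 : 0 < c * l ^ 2 := by positivity
      calc (1 - cos (l * x)) / ‖Ψ l‖ ≤ (1 - cos (l * x)) / (c * l ^ 2) :=
            div_le_div_of_nonneg_left hcos h2 h1
        _ = c⁻¹ * ((1 - cos (l * x)) / l ^ 2) := by field_simp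
  have hlim : Tendsto (fun x : ℝ => π⁻¹ * (c⁻¹ * I + 2 * D / |x|)) (cocompact ℝ)
      (𝓝 (π⁻¹ * (c⁻¹ * I + 0))) :=
    ((tendsto_const_nhds.div_atTop habs).const_add _).const_mul _
  have hlt : π⁻¹ * (c⁻¹ * I + 0) < ε := by
    have h1 : c⁻¹ * I < ε := by
      rw [hc, inv_div, div_mul_eq_mul_div, div_lt_iff₀ (by positivity)]
      nlinarith
    have h2 : π⁻¹ ≤ 1 := inv_le_one_of_one_le₀ (by linarith [pi_gt_three])
    have h3 : 0 ≤ c⁻¹ * I := by positivity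
    rw [add_zero]
    exact (mul_le_of_le_one_left h3 h2).trans_lt h1
  filter_upwards [hlim.eventually_lt_const hlt, habs.eventually_gt_atTop 0] with x hx hx0
  rw [dist_zero_right, norm_of_nonneg (div_nonneg (renormBound_nonneg Ψ x) hx0.le)]
  refine lt_of_le_of_lt ?_ hx
  rw [div_le_iff₀ hx0]
  refine (hbound x).trans (le_of_eq ?_)
  field_simp

end ResolventFamily

namespace IsKernelLimit

variable {Ψ : ℝ → ℂ} {U : ℝ → Measure ℝ} {u : ℕ → ℝ} {h : ℝ → ℝ}

theorem tendsto_div_abs_of_infinite (H : IsKernelLimit Ψ u h) (S : ResolventFamily Ψ U)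
    (hM : ∫⁻ x, ENNReal.ofReal (x ^ 2) ∂(U 1) = ∞) :
    Tendsto (fun x => h x / |x|) (cocompact ℝ) (𝓝 0) :=
  squeeze_zero (fun x => div_nonneg (H.nonneg S x) (abs_nonneg x))
    (fun x => div_le_div_of_nonneg_right (H.le_renormBound S x) (abs_nonneg x))
    (S.tendsto_renormBound_div_abs hM)

/-- Let `c` be a limit of the unit increments along an ultrafilter. Subadditivity bounds `h(y + x) -
h(y)` by `h(x)`, so `x c ≤ h(x)` for all real `x`; as `h` is sublinear at both ends, letting `x →
±∞` gives `c = 0`. -/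
theorem tendsto_increment_of_infinite (H : IsKernelLimit Ψ u h) (S : ResolventFamily Ψ U)
    (hM : ∫⁻ x, ENNReal.ofReal (x ^ 2) ∂(U 1) = ∞) {𝓕 : Filter ℝ} (h𝓕 : 𝓕 ≤ cocompact ℝ) :
    Tendsto (fun y => h (y + 1) - h y) 𝓕 (𝓝 0) := by
  rw [tendsto_iff_ultrafilter]
  intro 𝒰 h𝒰
  obtain ⟨c, hc⟩ := exists_tendsto_of_ultrafilter 𝒰 (f := fun y => h (y + 1) - h y)
    (Eventually.of_forall fun y => H.abs_add_sub_le S y 1)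
  have hle (x : ℝ) : x * c ≤ h x := by
    have h1 := ((H.tendsto_increment_sub_mul S h𝓕 x).mono_left h𝒰).add (hc.const_mul x)
    rw [zero_add] at h1
    refine le_of_tendsto h1 (Eventually.of_forall fun y => ?_)
    have := H.add_le S y x
    linarith
  have hdiv := H.tendsto_div_abs_of_infinite S hM
  have hc1 : c ≤ 0 := by
    refine ge_of_tendsto (hdiv.mono_left atTop_le_cocompact) ?_
    filter_upwards [eventually_gt_atTop 0] with x hx
    rw [abs_of_pos hx, le_div_iff₀ hx, mul_comm]
    exact hle x
  have hc2 : -c ≤ 0 := by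
    refine ge_of_tendsto (hdiv.mono_left atBot_le_cocompact) ?_
    filter_upwards [eventually_lt_atBot 0] with x hx
    rw [abs_of_neg hx, le_div_iff₀ (neg_pos.2 hx)]
    linarith [hle x]
  rwa [show c = 0 by linarith] at hc

end IsKernelLimit

/-! ### Finite second moment: centring and the Poisson equation -/

namespace ResolventFamily

variable {Ψ : ℝ → ℂ} {U : ℝ → Measure ℝ}

theorem integral_sq_pos (S : ResolventFamily Ψ U) (hM : Integrable (fun x : ℝ => x ^ 2) (U 1)) :
    0 < ∫ x, x ^ 2 ∂(U 1) := by
  have h := S.lintegral_sq_ne_zero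
  rw [← ofReal_integral_eq_lintegral_ofReal hM (Eventually.of_forall fun x => sq_nonneg x)] at h
  simpa using h

theorem one_sub_re_charFun_le_sq (S : ResolventFamily Ψ U)
    (hM : Integrable (fun x : ℝ => x ^ 2) (U 1)) (l : ℝ) :
    1 - (charFun (U 1) l).re ≤ (∫ x, x ^ 2 ∂(U 1)) * l ^ 2 / 2 := by
  have := S.isProbabilityMeasure_one
  have h1 : 1 - (charFun (U 1) l).re = ∫ x, (1 - cos (l * x)) ∂(U 1) := by
    rw [integral_sub (integrable_const _) (integrable_cos_mul _ l), charFun_re]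
    simp
  rw [h1, mul_div_assoc, ← integral_mul_const]
  refine integral_mono ((integrable_const _).sub (integrable_cos_mul _ l)) (hM.mul_const _)
    fun x => ?_
  have := one_sub_cos_le_sq_half (l * x)
  beta_reduce
  linarith [mul_pow l x 2]

/-- With `v` the characteristic function of `U 1` and `t = M l² ≤ 1`, `Re v ≥ 1 - t / 2` gives `Re
(1 / v) ≤ 1 / Re v ≤ 1 + t`. -/
theorem re_exponent_le (S : ResolventFamily Ψ U) (hM : Integrable (fun x : ℝ => x ^ 2) (U 1))
    {l : ℝ} (hl : (∫ x, x ^ 2 ∂(U 1)) * l ^ 2 ≤ 1) :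
    (Ψ l).re ≤ (∫ x, x ^ 2 ∂(U 1)) * l ^ 2 := by
  have h1 := S.one_sub_re_charFun_le_sq hM l
  have h2 : Ψ l = (charFun (U 1) l)⁻¹ - 1 := congrFun S.exponent_eq l
  set v := charFun (U 1) l with hv
  set t := (∫ x, x ^ 2 ∂(U 1)) * l ^ 2 with ht
  have ht0 : 0 ≤ t := mul_nonneg (integral_nonneg fun x => sq_nonneg x) (sq_nonneg l)
  have hre : 0 < v.re := by linarith
  have h3 : v.re * v.re ≤ Complex.normSq v := by
    rw [Complex.normSq_apply]
    nlinarith [mul_self_nonneg v.im]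
  have h4 : v.re / Complex.normSq v ≤ 1 / v.re := by
    rw [div_le_div_iff₀ (lt_of_lt_of_le (by positivity) h3) hre]
    linarith
  have h5 : 1 / v.re ≤ 1 + t := by
    rw [div_le_iff₀ hre]
    nlinarith
  rw [h2, Complex.sub_re, Complex.inv_re, Complex.one_re]
  linarith

theorem memLp_two (hM : Integrable (fun x : ℝ => x ^ 2) (U 1)) :
    MemLp id 2 (U 1) :=
  (memLp_two_iff_integrable_sq (by fun_prop)).2 hM

theorem integrable_id (S : ResolventFamily Ψ U) (hM : Integrable (fun x : ℝ => x ^ 2) (U 1)) :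
    Integrable (fun x : ℝ => x) (U 1) := by
  have := S.isProbabilityMeasure_one
  exact (memLp_two hM).integrable (by norm_num)

/-- The imaginary part of the characteristic function `v` is `m l + O(l²)`, and passing to `Ψ = 1 /
v - 1` only enlarges it in absolute value because `‖v‖ ≤ 1`. -/
theorem exists_abs_im_exponent_ge (S : ResolventFamily Ψ U)
    (hM : Integrable (fun x : ℝ => x ^ 2) (U 1)) (hm : ∫ x, x ∂(U 1) ≠ 0) :
    ∃ c > 0, ∀ᶠ l in 𝓝 (0 : ℝ), c * |l| ≤ |(Ψ l).im| := by
  have := S.isProbabilityMeasure_one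
  set m := ∫ x, x ∂(U 1) with hmdef
  have hmpos : 0 < |m| := abs_pos.2 hm
  refine ⟨|m| / 2, by positivity, ?_⟩
  have h := charFun_taylor_two (memLp_two hM)
  have h1 := h.bound one_pos
  have h2 : ∀ᶠ l in 𝓝 (0 : ℝ), |l| < |m| / 2 := by
    have : Tendsto (fun l : ℝ => |l|) (𝓝 0) (𝓝 0) := by
      simpa using continuous_abs.tendsto (0 : ℝ)
    exact this.eventually_lt_const (by positivity)
  filter_upwards [h1, h2] with l hl1 hl2
  have h3 : Ψ l = (charFun (U 1) l)⁻¹ - 1 := congrFun S.exponent_eq l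
  have h4 : charFun (U 1) l ≠ 0 := by
    rw [S.charFun_eq 1 one_pos]
    exact inv_ne_zero (S.add_ne_zero one_pos l)
  have h5 := norm_charFun_le_one (μ := U 1) l
  set v := charFun (U 1) l with hv
  have h6 : |(Ψ l).im| = |v.im| / Complex.normSq v := by
    rw [h3, Complex.sub_im, Complex.inv_im, Complex.one_im, sub_zero, abs_div, abs_neg,
      abs_of_pos (Complex.normSq_pos.2 h4)]
  have h7 : Complex.normSq v ≤ 1 := by
    rw [Complex.normSq_eq_norm_sq]
    exact pow_le_one₀ (norm_nonneg _) h5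
  have h8 : |v.im| ≤ |(Ψ l).im| := by
    rw [h6, le_div_iff₀ (Complex.normSq_pos.2 h4)]
    exact mul_le_of_le_one_right (abs_nonneg _) h7
  have h9 : |v.im - m * l| ≤ l ^ 2 := by
    have e := (Complex.abs_im_le_norm _).trans hl1
    rw [one_mul, norm_of_nonneg (sq_nonneg l)] at e
    have e2 : (v - (1 + (m : ℂ) * l * Complex.I -
        ((∫ x, x ^ 2 ∂(U 1) : ℝ) : ℂ) * l ^ 2 / 2)).im = v.im - m * l := by
      have e3 : (((∫ x, x ^ 2 ∂(U 1) : ℝ) : ℂ) * l ^ 2 / 2) =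
        (((∫ x, x ^ 2 ∂(U 1)) * l ^ 2 / 2 : ℝ) : ℂ) := by push_cast; rfl
      rw [e3, ← Complex.ofReal_mul]
      simp only [Complex.sub_im, Complex.add_im, Complex.one_im, Complex.ofReal_im,
        Complex.mul_im, Complex.I_im, Complex.I_re, Complex.ofReal_re]
      ring
    rwa [e2] at e
  have h10 : |m * l| ≤ |v.im| + l ^ 2 := by
    have := abs_sub_abs_le_abs_sub (m * l) v.im
    rw [abs_sub_comm] at this
    linarith
  rw [abs_mul] at h10
  have h11 : l ^ 2 ≤ |m| / 2 * |l| := by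
    rw [← sq_abs, sq]
    exact mul_le_mul_of_nonneg_right hl2.le (abs_nonneg l)
  linarith

theorem integrable_div_add_sq {c q : ℝ} (hc : 0 < c) (hq : 0 < q) :
    Integrable (fun l : ℝ => q / (q ^ 2 + (c * l) ^ 2)) ∧
      ∫ l : ℝ, q / (q ^ 2 + (c * l) ^ 2) = π / c := by
  have e : (fun l : ℝ => q / (q ^ 2 + (c * l) ^ 2)) =
      fun l => q⁻¹ * (1 + (c / q * l) ^ 2)⁻¹ := by
    funext l
    field_simp
  rw [e]
  refine ⟨(integrable_inv_one_add_sq.comp_mul_left' (by positivity)).const_mul _, ?_⟩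
  rw [integral_const_mul, Measure.integral_comp_mul_left (fun u : ℝ => (1 + u ^ 2)⁻¹),
    integral_univ_inv_one_add_sq, abs_of_pos (by positivity), smul_eq_mul]
  field_simp

/-- If the second moment is finite and the mean does not vanish, the family is transient. -/
theorem bddAbove_kernel_zero_of_mean_ne_zero (S : ResolventFamily Ψ U)
    (hM : Integrable (fun x : ℝ => x ^ 2) (U 1)) (hm : ∫ x, x ∂(U 1) ≠ 0) :
    ∃ K, ∀ q, 0 < q → resolventKernel Ψ q 0 ≤ K := by
  set M := ∫ x, x ^ 2 ∂(U 1) with hMdef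
  have hM0 := S.integral_sq_pos hM
  obtain ⟨c, hc, him⟩ := S.exists_abs_im_exponent_ge hM hm
  have hsmall : ∀ᶠ l in 𝓝 (0 : ℝ), M * l ^ 2 ≤ 1 := by
    have : Continuous fun l : ℝ => M * l ^ 2 := by fun_prop
    have h := this.tendsto 0
    simp only [ne_eq, OfNat.ofNat_ne_zero, not_false_eq_true, zero_pow, mul_zero] at h
    exact (h.eventually_lt_const one_pos).mono fun l hl => hl.le
  obtain ⟨δ, hδ, hball⟩ := Metric.eventually_nhds_iff_ball.1 (him.and hsmall)
  set D := ∫ l in {l : ℝ | δ ≤ |l|}, ‖Ψ l‖⁻¹ with hD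
  have hs : MeasurableSet {l : ℝ | δ ≤ |l|} := measurableSet_le (by fun_prop) (by fun_prop)
  -- Near the origin `Re (1 / (q + Ψ))` is at most `(q + M l²) / (q² + c² l²)`: a Poisson kernel, of
  -- integral `π / c` whatever `q`, plus a term at most `M / c²` on an interval of length `2 δ`.
  -- Away from it, `1 / ‖Ψ‖` contributes `D`.
  refine ⟨(2 * π)⁻¹ * ((π / c + 2 * δ * (M / c ^ 2)) + D), fun q hq => ?_⟩
  rw [resolventKernel, invDensity]
  refine mul_le_mul_of_nonneg_left ?_ (by positivity)
  obtain ⟨i1, e1⟩ := integrable_div_add_sq hc hq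
  have i2 : Integrable ((Ioo (-δ) δ).indicator fun _ : ℝ => M / c ^ 2) :=
    (integrable_indicator_iff measurableSet_Ioo).2 (by simp)
  have e2 : ∫ l, (Ioo (-δ) δ).indicator (fun _ : ℝ => M / c ^ 2) l = 2 * δ * (M / c ^ 2) := by
    rw [integral_indicator_const _ measurableSet_Ioo, smul_eq_mul, measureReal_def,
      Real.volume_Ioo, ENNReal.toReal_ofReal (by linarith)]
    ring
  have i3 := (integrable_indicator_iff hs).2 (S.integrableOn_inv_norm hδ)
  have i4 : Integrable fun l => q / (q ^ 2 + (c * l) ^ 2) +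
      (Ioo (-δ) δ).indicator (fun _ : ℝ => M / c ^ 2) l := i1.add i2
  rw [← e1, ← e2, hD, ← integral_indicator hs, ← integral_add i1 i2, ← integral_add i4 i3]
  refine integral_mono (integrable_exp_mul (S.integrable_inv q hq) 0).re (i4.add i3)
    fun l => ?_
  simp only [mul_zero, Complex.ofReal_zero, neg_zero, zero_mul, Complex.exp_zero, one_mul]
  have hq0 : 0 ≤ q / (q ^ 2 + (c * l) ^ 2) := by positivity
  by_cases hl : δ ≤ |l|
  · rw [indicator_of_mem (show l ∈ {l : ℝ | δ ≤ |l|} from hl)]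
    have hl0 : l ≠ 0 := by
      rintro rfl
      rw [abs_zero] at hl
      linarith
    have h1 := (Complex.re_le_norm ((q : ℂ) + Ψ l)⁻¹).trans (S.norm_inv_add_le hq hl0)
    have h2 : 0 ≤ (Ioo (-δ) δ).indicator (fun _ : ℝ => M / c ^ 2) l :=
      indicator_nonneg (fun _ _ => by positivity) l
    linarith
  · have hlt := lt_of_not_ge hl
    rw [indicator_of_notMem (show l ∉ {l : ℝ | δ ≤ |l|} from hl),
      indicator_of_mem (show l ∈ Ioo (-δ) δ from abs_lt.1 hlt), add_zero]
    obtain ⟨h1, h2⟩ := hball l (by rwa [Metric.mem_ball, dist_zero_right, norm_eq_abs])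
    have h3 := S.re_exponent_le hM h2
    have h4 := S.re_nonneg l
    have h5 : (c * l) ^ 2 ≤ (Ψ l).im ^ 2 := by
      rw [← sq_abs (Ψ l).im, ← sq_abs (c * l), abs_mul, abs_of_pos hc]
      exact pow_le_pow_left₀ (by positivity) h1 2
    have hden : q ^ 2 + (c * l) ^ 2 ≤ Complex.normSq ((q : ℂ) + Ψ l) := by
      rw [Complex.normSq_apply]
      simp only [Complex.add_re, Complex.ofReal_re, Complex.add_im, Complex.ofReal_im, zero_add]
      nlinarith
    have hpos : 0 < q ^ 2 + (c * l) ^ 2 := by positivity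
    rw [Complex.inv_re, Complex.add_re, Complex.ofReal_re]
    calc (q + (Ψ l).re) / Complex.normSq ((q : ℂ) + Ψ l)
        ≤ (q + M * l ^ 2) / (q ^ 2 + (c * l) ^ 2) :=
          div_le_div₀ (by positivity) (by linarith) hpos hden
      _ = q / (q ^ 2 + (c * l) ^ 2) + M * l ^ 2 / (q ^ 2 + (c * l) ^ 2) := add_div _ _ _
      _ ≤ q / (q ^ 2 + (c * l) ^ 2) + M / c ^ 2 := by
          refine add_le_add le_rfl ?_
          rw [div_le_div_iff₀ hpos (by positivity)]
          nlinarith [mul_nonneg hM0.le (sq_nonneg q)]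

theorem mean_eq_zero (S : ResolventFamily Ψ U) (hM : Integrable (fun x : ℝ => x ^ 2) (U 1))
    (hrec : Tendsto (fun q => resolventKernel Ψ q 0) (𝓝[>] 0) atTop) :
    ∫ x, x ∂(U 1) = 0 := by
  by_contra hm
  obtain ⟨K, hK⟩ := S.bddAbove_kernel_zero_of_mean_ne_zero hM hm
  obtain ⟨q, hq, hq0⟩ := ((hrec.eventually_gt_atTop K).and self_mem_nhdsWithin).exists
  exact absurd (hK q hq0) (not_le.2 hq)

theorem tendsto_exponent_div_sq (S : ResolventFamily Ψ U)
    (hM : Integrable (fun x : ℝ => x ^ 2) (U 1)) (hm : ∫ x, x ∂(U 1) = 0) :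
    Tendsto (fun l : ℝ => Ψ l / (l : ℂ) ^ 2) (𝓝[≠] 0)
      (𝓝 (((∫ x, x ^ 2 ∂(U 1)) / 2 : ℝ) : ℂ)) := by
  have := S.isProbabilityMeasure_one
  have h := charFun_taylor_two (memLp_two hM)
  rw [hm] at h
  have h1 : Tendsto (fun l : ℝ => (charFun (U 1) l -
      (1 + ((0 : ℝ) : ℂ) * l * Complex.I - ((∫ x, x ^ 2 ∂(U 1) : ℝ) : ℂ) * l ^ 2 / 2)) /
        ((l ^ 2 : ℝ) : ℂ)) (𝓝[≠] 0) (𝓝 0) := by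
    have h2 : (fun l : ℝ => charFun (U 1) l -
      (1 + ((0 : ℝ) : ℂ) * l * Complex.I - ((∫ x, x ^ 2 ∂(U 1) : ℝ) : ℂ) * l ^ 2 / 2))
        =o[𝓝 0] fun l : ℝ => ((l ^ 2 : ℝ) : ℂ) :=
      h.trans_isBigO (Asymptotics.isBigO_of_le _ fun l => by simp)
    exact h2.tendsto_div_nhds_zero.mono_left nhdsWithin_le_nhds
  have h3 : Tendsto (fun l => (charFun (U 1) l)⁻¹) (𝓝[≠] 0) (𝓝 1) := by
    have hc : Continuous (charFun (U 1)) := continuous_charFun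
    have h0 := hc.tendsto 0
    rw [charFun_zero, probReal_univ, Complex.ofReal_one] at h0
    simpa using (h0.inv₀ one_ne_zero).mono_left nhdsWithin_le_nhds
  have h4 := ((h1.neg.add_const (((∫ x, x ^ 2 ∂(U 1)) / 2 : ℝ) : ℂ))).mul h3
  simp only [neg_zero, zero_add, mul_one] at h4
  refine h4.congr' ?_
  filter_upwards [self_mem_nhdsWithin] with l hl
  have hl : (l : ℂ) ≠ 0 := by exact_mod_cast hl
  have hne : charFun (U 1) l ≠ 0 := by
    rw [S.charFun_eq 1 one_pos]
    exact inv_ne_zero (S.add_ne_zero one_pos l)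
  rw [congrFun S.exponent_eq l]
  push_cast
  field_simp
  ring

/-- The integrand `q / (q + Ψ)` tends to `0` off the origin and is dominated by `2 / ‖1 + Ψ‖` for `q
< 1`. This removes the error term when the Poisson equation is derived. -/
theorem tendsto_mul_kernel_zero (S : ResolventFamily Ψ U) :
    Tendsto (fun q => q * resolventKernel Ψ q 0) (𝓝[>] 0) (𝓝 0) := by
  have hΨ := S.continuous_exponent.measurable
  have h : Tendsto (fun q : ℝ => ∫ l : ℝ, (((q : ℂ)) * ((q : ℂ) + Ψ l)⁻¹).re) (𝓝[>] 0)
      (𝓝 (∫ _ : ℝ, (0 : ℝ))) := by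
    refine tendsto_integral_filter_of_dominated_convergence
      (fun l => 2 * ‖(((1 : ℝ) : ℂ) + Ψ l)⁻¹‖) ?_ ?_ ((S.integrable_inv 1 one_pos).norm.const_mul 2)
      ?_
    · exact Eventually.of_forall fun q => Measurable.aestronglyMeasurable (by fun_prop)
    · filter_upwards [Ioo_mem_nhdsGT (show (0 : ℝ) < 1 from one_pos)] with q hq
      refine Eventually.of_forall fun l => (Complex.abs_re_le_norm _).trans ?_
      have h1 : ‖((1 : ℝ) : ℂ) + Ψ l‖ ≤ ‖(q : ℂ) + Ψ l‖ + (1 - q) := by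
        have := norm_add_le ((q : ℂ) + Ψ l) ((1 - q : ℝ) : ℂ)
        rw [Complex.norm_real, norm_of_nonneg (by linarith [hq.2])] at this
        refine le_trans (le_of_eq ?_) this
        congr 1
        push_cast
        ring
      have h2 := S.le_norm_add q l
      have p1 : 0 < ‖((1 : ℝ) : ℂ) + Ψ l‖ := norm_pos_iff.2 (S.add_ne_zero one_pos l)
      have p2 : 0 < ‖(q : ℂ) + Ψ l‖ := norm_pos_iff.2 (S.add_ne_zero hq.1 l)
      rw [norm_mul, norm_inv, norm_inv, Complex.norm_real, norm_of_nonneg hq.1.le,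
        ← div_eq_mul_inv, ← div_eq_mul_inv, div_le_div_iff₀ p2 p1]
      have hq1 := hq.1
      have hq2 := hq.2
      nlinarith
    · filter_upwards [compl_mem_ae_iff.2 (measure_singleton (0 : ℝ))] with l hl
      have hne := S.exponent_ne_zero (show l ≠ 0 from hl)
      have h1 : ContinuousAt (fun q : ℝ => (((q : ℂ)) * ((q : ℂ) + Ψ l)⁻¹).re) 0 := by
        refine Complex.continuous_re.continuousAt.comp ?_
        refine Complex.continuous_ofReal.continuousAt.mul (ContinuousAt.inv₀ (by fun_prop) ?_)
        simpa using hne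
      simpa using h1.tendsto.mono_left nhdsWithin_le_nhds
  have h2 := h.const_mul (2 * π)⁻¹
  rw [integral_zero, mul_zero] at h2
  refine h2.congr fun q => ?_
  rw [resolventKernel, invDensity, mul_left_comm, ← integral_const_mul (q : ℝ)]
  congr 1
  refine integral_congr_ae (Eventually.of_forall fun l => ?_)
  simp

/-- The resolvent equation between `q` and `1`; its limit as `q → 0+` is the Poisson equation. -/
theorem one_sub_mul_integral_renormKernel (S : ResolventFamily Ψ U) {q : ℝ} (hq : 0 < q) (x : ℝ) :
    (1 - q) * ∫ y, renormKernel Ψ q (x + y) ∂(U 1) =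
      renormKernel Ψ q x + resolventKernel Ψ 1 (-x) - q * resolventKernel Ψ q 0 := by
  have := S.isProbabilityMeasure_one
  have e := S.resolvent_kernel one_pos hq (-x)
  rw [← S.integral_eq_integral_mul_kernel one_pos fun y => resolventKernel Ψ q (-x - y)] at e
  have hk := S.continuous_kernel hq
  obtain ⟨C, hC⟩ := S.bddAbove_kernel hq
  have e2 : ∫ y, renormKernel Ψ q (x + y) ∂(U 1) =
      resolventKernel Ψ q 0 - ∫ y, resolventKernel Ψ q (-x - y) ∂(U 1) := by
    simp only [renormKernel, neg_add, ← sub_eq_add_neg]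
    rw [integral_sub (integrable_const _) (S.integrable_of_bounded one_pos
      (f := fun y => resolventKernel Ψ q (-x - y)) (by fun_prop) fun y => hC _)]
    simp
  rw [e2, mul_sub, ← e, renormKernel]
  ring

end ResolventFamily

namespace IsKernelLimit

variable {Ψ : ℝ → ℂ} {U : ℝ → Measure ℝ} {u : ℕ → ℝ} {h : ℝ → ℝ}

/-- The limit `h` solves the Poisson equation for the measure `U 1`. -/
theorem integral_add (H : IsKernelLimit Ψ u h) (S : ResolventFamily Ψ U)
    (hM : Integrable (fun x : ℝ => x ^ 2) (U 1)) (x : ℝ) :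
    ∫ y, h (x + y) ∂(U 1) = h x + resolventKernel Ψ 1 (-x) := by
  have := S.isProbabilityMeasure_one
  obtain ⟨C, hC0, hC⟩ := S.exists_renormKernel_le_linear
  have hu0 : Tendsto u atTop (𝓝 0) := H.tendsto_index.mono_right nhdsWithin_le_nhds
  have h1 : Tendsto (fun n => ∫ y, renormKernel Ψ (u n) (x + y) ∂(U 1)) atTop
      (𝓝 (∫ y, h (x + y) ∂(U 1))) := by
    refine tendsto_integral_filter_of_dominated_convergence (fun y => C * (1 + |x| + |y|)) ?_ ?_
      (((integrable_const _).add (S.integrable_id hM).abs).const_mul C)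
      (Eventually.of_forall fun y => H.tendsto _)
    · filter_upwards [H.eventually_pos] with n hn
      have := S.continuous_renormKernel hn
      exact Continuous.aestronglyMeasurable (by fun_prop)
    · filter_upwards [H.eventually_pos] with n hn
      refine Eventually.of_forall fun y => ?_
      rw [norm_of_nonneg (S.renormKernel_nonneg hn _)]
      refine (hC _ hn _).trans (mul_le_mul_of_nonneg_left ?_ hC0)
      linarith [abs_add_le x y]
  have h2 := ((tendsto_const_nhds (x := (1 : ℝ))).sub hu0).mul h1
  rw [sub_zero, one_mul] at h2
  have h3 := ((H.tendsto x).add_const (resolventKernel Ψ 1 (-x))).sub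
    (S.tendsto_mul_kernel_zero.comp H.tendsto_index)
  rw [sub_zero] at h3
  refine tendsto_nhds_unique (h2.congr' ?_) h3
  filter_upwards [H.eventually_pos] with n hn
  exact S.one_sub_mul_integral_renormKernel hn x

end IsKernelLimit

/-! ### Finite second moment: the flux of the increments -/

/-- The integrated increments `∫ ∫_0^y (h(B + v) - h(B)) dv dμ(y)` of `h` at `B`. -/
noncomputable def incrementFlux (μ : Measure ℝ) (h : ℝ → ℝ) (B : ℝ) : ℝ :=
  ∫ y, (∫ v in (0 : ℝ)..y, (h (B + v) - h B)) ∂μ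

theorem abs_intervalIntegral_le_of_linear {f : ℝ → ℝ} {C : ℝ}
    (hf : ∀ v, |f v| ≤ C * (1 + |v|)) (hC : 0 ≤ C) (y : ℝ) :
    |∫ v in (0 : ℝ)..y, f v| ≤ C * (1 + |y|) * |y| := by
  have h := intervalIntegral.norm_integral_le_of_norm_le_const (a := 0) (b := y) (f := f)
    (C := C * (1 + |y|)) fun v hv => (hf v).trans (mul_le_mul_of_nonneg_left (by
      have : |v| ≤ |y| := by
        rcases le_total 0 y with hy | hy
        · rw [uIoc_of_le hy] at hv
          rw [abs_of_pos hv.1, abs_of_nonneg hy]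
          exact hv.2
        · rw [uIoc_of_ge hy] at hv
          rw [abs_of_nonpos hv.2, abs_of_nonpos hy]
          linarith [hv.1]
      linarith) hC)
  rwa [sub_zero] at h

namespace IsKernelLimit

variable {Ψ : ℝ → ℂ} {U : ℝ → Measure ℝ} {u : ℕ → ℝ} {h : ℝ → ℝ}

theorem integrable_quadratic (S : ResolventFamily Ψ U)
    (hM : Integrable (fun x : ℝ => x ^ 2) (U 1)) (C : ℝ) :
    Integrable (fun y : ℝ => C * (1 + |y|) * |y|) (U 1) := by
  have h1 := (S.integrable_id hM).abs
  refine ((h1.add hM).const_mul C).congr (Eventually.of_forall fun y => ?_)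
  simp only [Pi.add_apply]
  rw [← sq_abs]
  ring

theorem integrable_flux (H : IsKernelLimit Ψ u h) (S : ResolventFamily Ψ U)
    (hM : Integrable (fun x : ℝ => x ^ 2) (U 1)) (B : ℝ) :
    Integrable (fun y => ∫ v in (0 : ℝ)..y, (h (B + v) - h B)) (U 1) := by
  obtain ⟨C, hC0, hC⟩ := H.exists_abs_add_sub_le S
  have hc := H.continuous S
  have hc2 : Continuous fun y => ∫ v in (0 : ℝ)..y, (h (B + v) - h B) :=
    intervalIntegral.continuous_primitive
      (fun a b => Continuous.intervalIntegrable (by fun_prop) a b) 0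
  exact (integrable_quadratic S hM C).mono' hc2.aestronglyMeasurable
    (Eventually.of_forall fun y => abs_intervalIntegral_le_of_linear (hC B) hC0 y)

/-- Integrate the Poisson equation over `[A, B]` and exchange the integrals. For fixed `y` the
integral of `h(x + y) - h(x)` reduces to end terms at `A` and `B`, which are the fluxes, plus `y
(h(B) - h(A))`, which has integral zero because `U 1` is centred. -/
theorem incrementFlux_sub (H : IsKernelLimit Ψ u h) (S : ResolventFamily Ψ U)
    (hM : Integrable (fun x : ℝ => x ^ 2) (U 1)) (hm : ∫ x, x ∂(U 1) = 0) (A B : ℝ) :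
    incrementFlux (U 1) h B - incrementFlux (U 1) h A =
      ∫ x in A..B, resolventKernel Ψ 1 (-x) := by
  have := S.isProbabilityMeasure_one
  obtain ⟨C, hC0, hC⟩ := H.exists_abs_add_sub_le S
  have hc := H.continuous S
  have hii (a b : ℝ) : IntervalIntegrable h volume a b := hc.intervalIntegrable a b
  have hpt (y : ℝ) : ∫ x in A..B, (h (x + y) - h x) =
      (∫ v in (0 : ℝ)..y, (h (B + v) - h B)) - (∫ v in (0 : ℝ)..y, (h (A + v) - h A)) +
        y * (h B - h A) := by
    have e1 : ∫ x in A..B, (h (x + y) - h x) =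
        (∫ x in (A + y)..(B + y), h x) - ∫ x in A..B, h x := by
      rw [intervalIntegral.integral_sub (Continuous.intervalIntegrable (by fun_prop) _ _)
        (hii _ _), intervalIntegral.integral_comp_add_right]
    have e2 (D : ℝ) : ∫ v in (0 : ℝ)..y, (h (D + v) - h D) =
        (∫ x in D..(D + y), h x) - y * h D := by
      rw [intervalIntegral.integral_sub (Continuous.intervalIntegrable (by fun_prop) _ _)
        (by simp), intervalIntegral.integral_comp_add_left, intervalIntegral.integral_const]
      simp
    rw [e1, e2, e2]
    have e3 := intervalIntegral.integral_interval_sub_interval_comm (hii (A + y) (B + y))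
      (hii A B) (hii (A + y) A)
    rw [intervalIntegral.integral_symm A (A + y)] at e3
    rw [e3, intervalIntegral.integral_symm B (B + y)]
    ring
  have hswap : Integrable (Function.uncurry fun x y => h (x + y) - h x)
      ((volume.restrict (uIoc A B)).prod (U 1)) := by
    have h1 : Integrable (fun z : ℝ × ℝ => C * (1 + |z.2|))
        ((volume.restrict (uIoc A B)).prod (U 1)) := by
      have : IsFiniteMeasure (volume.restrict (uIoc A B)) := by
        rw [uIoc]; infer_instance
      have h0 : Integrable (fun y : ℝ => C * (1 + |y|)) (U 1) :=
        ((integrable_const _).add (S.integrable_id hM).abs).const_mul C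
      exact h0.comp_snd _
    refine h1.mono' (Continuous.aestronglyMeasurable (by fun_prop))
      (Eventually.of_forall fun z => hC z.1 z.2)
  have e := intervalIntegral_integral_swap hswap
  have e1 : ∫ x in A..B, (∫ y, (h (x + y) - h x) ∂(U 1)) =
      ∫ x in A..B, resolventKernel Ψ 1 (-x) := by
    refine intervalIntegral.integral_congr fun x _ => ?_
    have hi : Integrable (fun y => h (x + y)) (U 1) := by
      have h2 : Integrable (fun y => h (x + y) - h x) (U 1) :=
        (((integrable_const _).add (S.integrable_id hM).abs).const_mul C).mono'
          (Continuous.aestronglyMeasurable (by fun_prop)) (Eventually.of_forall fun y => hC x y)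
      refine (h2.add (integrable_const (h x))).congr (Eventually.of_forall fun y => ?_)
      simp
    rw [integral_sub hi (integrable_const _), H.integral_add S hM]
    simp
  rw [e1] at e
  rw [e]
  simp_rw [hpt]
  have i1 := H.integrable_flux S hM B
  have i2 := H.integrable_flux S hM A
  have i3 : Integrable (fun y => (∫ v in (0 : ℝ)..y, (h (B + v) - h B)) -
      ∫ v in (0 : ℝ)..y, (h (A + v) - h A)) (U 1) := i1.sub i2
  rw [MeasureTheory.integral_add i3 ((S.integrable_id hM).mul_const _), integral_sub i1 i2,
    integral_mul_const, hm, zero_mul, add_zero]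
  rfl

/-- At infinity `h(B + v) - h(B)` is close to `v` times the unit increment; integrating `v` from `0`
to `y` yields `y² / 2`. A quadratic bound, integrable under `U 1`, dominates. -/
theorem tendsto_incrementFlux_sub (H : IsKernelLimit Ψ u h) (S : ResolventFamily Ψ U)
    (hM : Integrable (fun x : ℝ => x ^ 2) (U 1)) {𝓕 : Filter ℝ} [𝓕.IsCountablyGenerated]
    (h𝓕 : 𝓕 ≤ cocompact ℝ) :
    Tendsto (fun B => incrementFlux (U 1) h B - (∫ x, x ^ 2 ∂(U 1)) / 2 * (h (B + 1) - h B))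
      𝓕 (𝓝 0) := by
  obtain ⟨C, hC0, hC⟩ := H.exists_abs_add_sub_le S
  have hc := H.continuous S
  have hbound (B v : ℝ) : |(h (B + v) - h B) - v * (h (B + 1) - h B)| ≤ 3 * C * (1 + |v|) := by
    have h1 := hC B v
    have h2 := hC B 1
    rw [abs_one] at h2
    have h3 := abs_sub (h (B + v) - h B) (v * (h (B + 1) - h B))
    rw [abs_mul] at h3
    have h4 := mul_le_mul_of_nonneg_left h2 (abs_nonneg v)
    nlinarith [abs_nonneg v]
  have hlim : Tendsto (fun B => ∫ y, (∫ v in (0 : ℝ)..y,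
      ((h (B + v) - h B) - v * (h (B + 1) - h B))) ∂(U 1)) 𝓕 (𝓝 (∫ _, (0 : ℝ) ∂(U 1))) := by
    refine tendsto_integral_filter_of_dominated_convergence
      (fun y => 3 * C * (1 + |y|) * |y|) ?_ ?_ (integrable_quadratic S hM (3 * C)) ?_
    · refine Eventually.of_forall fun B => Continuous.aestronglyMeasurable ?_
      exact intervalIntegral.continuous_primitive
        (fun a b => Continuous.intervalIntegrable (by fun_prop) a b) 0
    · exact Eventually.of_forall fun B => Eventually.of_forall fun y =>
        abs_intervalIntegral_le_of_linear (hbound B) (by positivity) y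
    · refine Eventually.of_forall fun y => ?_
      have h0 : Tendsto (fun B => ∫ v in (0 : ℝ)..y, ((h (B + v) - h B) - v * (h (B + 1) - h B)))
          𝓕 (𝓝 (∫ _ in (0 : ℝ)..y, (0 : ℝ))) := by
        refine intervalIntegral.tendsto_integral_filter_of_dominated_convergence
          (fun v => 3 * C * (1 + |v|)) ?_ ?_ (Continuous.intervalIntegrable (by fun_prop) _ _) ?_
        · exact Eventually.of_forall fun B => Continuous.aestronglyMeasurable (by fun_prop)
        · exact Eventually.of_forall fun B => Eventually.of_forall fun v _ => hbound B v
        · exact Eventually.of_forall fun v _ => H.tendsto_increment_sub_mul S h𝓕 v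
      simpa using h0
  rw [integral_zero] at hlim
  refine hlim.congr fun B => ?_
  have e (y : ℝ) : ∫ v in (0 : ℝ)..y, ((h (B + v) - h B) - v * (h (B + 1) - h B)) =
      (∫ v in (0 : ℝ)..y, (h (B + v) - h B)) - y ^ 2 * ((h (B + 1) - h B) / 2) := by
    rw [intervalIntegral.integral_sub (Continuous.intervalIntegrable (by fun_prop) _ _)
      (Continuous.intervalIntegrable (by fun_prop) _ _), intervalIntegral.integral_mul_const,
      integral_id]
    ring
  simp_rw [e]
  rw [integral_sub (H.integrable_flux S hM B) (hM.mul_const _), integral_mul_const, incrementFlux]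
  ring

/-- If `U 1` is centred with finite second moment `M`, the increments of `h` converge at `±∞`,
and the two limits differ by `2 / M`. -/
theorem exists_tendsto_increment (H : IsKernelLimit Ψ u h) (S : ResolventFamily Ψ U)
    (hM : Integrable (fun x : ℝ => x ^ 2) (U 1)) (hm : ∫ x, x ∂(U 1) = 0) :
    ∃ a b, Tendsto (fun y => h (y + 1) - h y) atTop (𝓝 a) ∧
      Tendsto (fun y => h (y + 1) - h y) atBot (𝓝 b) ∧ a - b = 2 / ∫ x, x ^ 2 ∂(U 1) := by
  have hM0 := S.integral_sq_pos hM
  set M := ∫ x, x ^ 2 ∂(U 1) with hMdef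
  set Φ := incrementFlux (U 1) h with hΦ
  have hk : Integrable fun x => resolventKernel Ψ 1 (-x) := (S.integrable_kernel one_pos).comp_neg
  have hflux (B : ℝ) : Φ B = Φ 0 + ∫ x in (0 : ℝ)..B, resolventKernel Ψ 1 (-x) := by
    have := H.incrementFlux_sub S hM hm 0 B
    linarith
  -- The flux is asymptotically `M / 2` times the unit increment, and it converges at both ends
  -- because `r_1` is integrable. The difference of its two limits is the total mass of `r_1`, which
  -- is one.
  have conv {𝓕 : Filter ℝ} [𝓕.IsCountablyGenerated] (h𝓕 : 𝓕 ≤ cocompact ℝ) {J : ℝ}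
      (hJ : Tendsto (fun B => ∫ x in (0 : ℝ)..B, resolventKernel Ψ 1 (-x)) 𝓕 (𝓝 J)) :
      Tendsto (fun y => h (y + 1) - h y) 𝓕 (𝓝 (2 / M * (Φ 0 + J))) := by
    have h1 := ((hJ.const_add (Φ 0)).sub (H.tendsto_incrementFlux_sub S hM h𝓕)).const_mul (2 / M)
    rw [sub_zero] at h1
    refine h1.congr fun B => ?_
    rw [← hflux, ← hMdef, ← hΦ]
    field_simp
    ring
  have t1 := intervalIntegral_tendsto_integral_Ioi (l := atTop) 0
    (hk.integrableOn (s := Ioi 0)) tendsto_id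
  have t2 := (intervalIntegral_tendsto_integral_Iic (l := atBot) 0
    (hk.integrableOn (s := Iic 0)) tendsto_id).neg
  refine ⟨_, _, conv atTop_le_cocompact t1, conv atBot_le_cocompact (t2.congr fun B => ?_), ?_⟩
  · simp only [id]
    rw [intervalIntegral.integral_symm]
    simp
  · have e : ∫ x, resolventKernel Ψ 1 (-x) = 1 := by
      rw [integral_neg_eq_self (fun x => resolventKernel Ψ 1 x), S.integral_kernel one_pos, inv_one]
    rw [← intervalIntegral.integral_Iic_add_Ioi (hk.integrableOn (s := Iic 0))
      (hk.integrableOn (s := Ioi 0))] at e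
    rw [← mul_sub]
    have : Φ 0 + (∫ x in Ioi 0, resolventKernel Ψ 1 (-x)) -
        (Φ 0 + -∫ x in Iic 0, resolventKernel Ψ 1 (-x)) = 1 := by linarith
    rw [this, mul_one]

end IsKernelLimit

/-! ### Finite second moment: diffusive scaling and the lower bound -/

theorem eq_of_withDensity_ofReal_eq {f g : ℝ → ℝ} (hf : Continuous f) (hg : Continuous g)
    (hf0 : ∀ x, 0 ≤ f x) (hg0 : ∀ x, 0 ≤ g x)
    (h : (volume.withDensity fun x => ENNReal.ofReal (f x)) =
      volume.withDensity fun x => ENNReal.ofReal (g x)) : f = g := by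
  have hfm := hf.measurable
  have hgm := hg.measurable
  rw [withDensity_eq_iff_of_sigmaFinite (by fun_prop) (by fun_prop)] at h
  refine (Continuous.ae_eq_iff_eq volume hf hg).1 (h.mono fun x hx => ?_)
  exact (ENNReal.ofReal_eq_ofReal_iff (hf0 x) (hg0 x)).1 hx

theorem integral_exp_mul_exp_neg_abs (l : ℝ) :
    Integrable (fun x : ℝ => Complex.exp (l * x * Complex.I) * (exp (-|x|) : ℝ)) ∧
    ∫ x : ℝ, Complex.exp (l * x * Complex.I) * (exp (-|x|) : ℝ) = 2 / (1 + (l : ℂ) ^ 2) := by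
  have ha : 0 < ((l : ℂ) * Complex.I + 1).re := by simp
  have hb : ((l : ℂ) * Complex.I - 1).re < 0 := by simp
  have ea : EqOn (fun x : ℝ => Complex.exp (((l : ℂ) * Complex.I + 1) * x))
      (fun x : ℝ => Complex.exp (l * x * Complex.I) * (exp (-|x|) : ℝ)) (Iic 0) := by
    intro x hx
    have hx : x ≤ 0 := hx
    simp only
    rw [abs_of_nonpos hx, neg_neg, Complex.ofReal_exp, ← Complex.exp_add]
    congr 1
    ring
  have eb : EqOn (fun x : ℝ => Complex.exp (((l : ℂ) * Complex.I - 1) * x))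
      (fun x : ℝ => Complex.exp (l * x * Complex.I) * (exp (-|x|) : ℝ)) (Ioi 0) := by
    intro x hx
    have hx : 0 < x := hx
    simp only
    rw [abs_of_pos hx, Complex.ofReal_exp, ← Complex.exp_add]
    congr 1
    push_cast
    ring
  have ia := (integrableOn_exp_mul_complex_Iic ha 0).congr_fun ea measurableSet_Iic
  have ib := (integrableOn_exp_mul_complex_Ioi hb 0).congr_fun eb measurableSet_Ioi
  refine ⟨?_, ?_⟩
  · rw [← integrableOn_univ, ← Iic_union_Ioi (a := (0 : ℝ))]
    exact ia.union ib
  · rw [← intervalIntegral.integral_Iic_add_Ioi ia ib, ← setIntegral_congr_fun measurableSet_Iic ea,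
      ← setIntegral_congr_fun measurableSet_Ioi eb, integral_exp_mul_complex_Iic ha,
      integral_exp_mul_complex_Ioi hb]
    have h1 : (l : ℂ) * Complex.I + 1 ≠ 0 := fun h => by
      have := congrArg Complex.re h; simp at this
    have h2 : (l : ℂ) * Complex.I - 1 ≠ 0 := fun h => by
      have := congrArg Complex.re h; simp at this
    have h3 : (1 + (l : ℂ) ^ 2) = -((l : ℂ) * Complex.I + 1) * ((l : ℂ) * Complex.I - 1) := by
      linear_combination (l : ℂ) ^ 2 * Complex.I_sq
    rw [h3]
    simp only [Complex.ofReal_zero, mul_zero, Complex.exp_zero]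
    field_simp
    ring

/-- The Laplace density `exp (-|x|) / 2` has the integrable characteristic function `1 / (1 + l²)`;
the inversion formula, read at `s`, is the claim. -/
theorem integral_cos_div_one_add_sq (s : ℝ) :
    ∫ l : ℝ, cos (l * s) * (1 + l ^ 2)⁻¹ = π * exp (-|s|) := by
  have hint0 : Integrable fun x : ℝ => exp (-|x|) / 2 := by
    have h := (integral_exp_mul_exp_neg_abs 0).1.norm.div_const 2
    refine h.congr (Eventually.of_forall fun x => ?_)
    beta_reduce
    rw [norm_mul, Complex.norm_real, norm_of_nonneg (exp_pos _).le]
    simp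
  set μ : Measure ℝ := volume.withDensity fun x => ENNReal.ofReal (exp (-|x|) / 2) with hμ
  have hfin : IsFiniteMeasure μ := by
    refine ⟨?_⟩
    rw [hμ, withDensity_apply _ MeasurableSet.univ, setLIntegral_univ,
      ← ofReal_integral_eq_lintegral_ofReal hint0 (Eventually.of_forall fun x => by positivity)]
    exact ENNReal.ofReal_lt_top
  have hcf : charFun μ = fun l : ℝ => (((1 + l ^ 2)⁻¹ : ℝ) : ℂ) := by
    funext l
    rw [charFun_apply_real, hμ,
      integral_withDensity_eq_integral_toReal_smul (by fun_prop) (by simp)]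
    have e := (integral_exp_mul_exp_neg_abs l).2
    have e2 : ∀ x : ℝ, (ENNReal.ofReal (exp (-|x|) / 2)).toReal • Complex.exp (l * x * Complex.I) =
        (2 : ℂ)⁻¹ * (Complex.exp (l * x * Complex.I) * (exp (-|x|) : ℝ)) := by
      intro x
      rw [ENNReal.toReal_ofReal (by positivity), Complex.real_smul]
      push_cast
      ring
    simp_rw [e2]
    rw [integral_const_mul, e]
    push_cast
    field_simp
  have hint : Integrable (charFun μ) := by
    rw [hcf]
    exact integrable_inv_one_add_sq.ofReal
  have h1 := withDensity_invDensity_charFun hint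
  have h2 := eq_of_withDensity_ofReal_eq (f := fun x => exp (-|x|) / 2) (by fun_prop)
    (continuous_invDensity hint) (fun x => by positivity) (invDensity_charFun_nonneg hint)
    (hμ.symm.trans h1)
  have h3 := congrFun h2 s
  simp only [invDensity, hcf] at h3
  have h4 : ∫ l : ℝ, cos (l * s) * (1 + l ^ 2)⁻¹ =
      ∫ l : ℝ, (Complex.exp (-(l * s : ℝ) * Complex.I) * (((1 + l ^ 2)⁻¹ : ℝ) : ℂ)).re := by
    refine integral_congr_ae (Eventually.of_forall fun l => ?_)
    beta_reduce
    rw [Complex.re_mul_ofReal, ← Complex.ofReal_neg, Complex.exp_ofReal_mul_I_re, cos_neg]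
  rw [h4]
  have hpi := pi_ne_zero
  generalize (∫ l : ℝ, (Complex.exp (-(l * s : ℝ) * Complex.I) *
    (((1 + l ^ 2)⁻¹ : ℝ) : ℂ)).re) = J at h3 ⊢
  field_simp at h3
  linarith

theorem integral_one_sub_cos_div_one_add_sq {a : ℝ} (ha : 0 < a) (s : ℝ) :
    ∫ l : ℝ, (1 - cos (l * s)) * (1 + (a * l) ^ 2)⁻¹ = π / a * (1 - exp (-|s / a|)) := by
  have h := Measure.integral_comp_mul_left
    (fun v : ℝ => (1 - cos (v * (s / a))) * (1 + v ^ 2)⁻¹) a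
  have e : ∀ l : ℝ, (1 - cos (a * l * (s / a))) * (1 + (a * l) ^ 2)⁻¹ =
      (1 - cos (l * s)) * (1 + (a * l) ^ 2)⁻¹ := by
    intro l
    congr 3
    field_simp
  simp_rw [e] at h
  rw [h, abs_of_pos (by positivity), smul_eq_mul]
  have i1 : Integrable fun v : ℝ => cos (v * (s / a)) * (1 + v ^ 2)⁻¹ :=
    integrable_inv_one_add_sq.bdd_mul (c := 1) (by fun_prop)
      (Eventually.of_forall fun v => abs_cos_le_one _)
  simp_rw [sub_mul, one_mul]
  rw [integral_sub integrable_inv_one_add_sq i1, integral_univ_inv_one_add_sq,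
    integral_cos_div_one_add_sq]
  field_simp

namespace ResolventFamily

variable {Ψ : ℝ → ℂ} {U : ℝ → Measure ℝ}

theorem exists_mul_sq_le_re_exponent (S : ResolventFamily Ψ U)
    (hM : Integrable (fun x : ℝ => x ^ 2) (U 1)) (hm : ∫ x, x ∂(U 1) = 0) :
    ∃ c > 0, ∃ δ > 0, ∀ l, |l| < δ → c * l ^ 2 ≤ (Ψ l).re := by
  have hM0 := S.integral_sq_pos hM
  have h := (Complex.continuous_re.tendsto _).comp (S.tendsto_exponent_div_sq hM hm)
  rw [Complex.ofReal_re] at h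
  have h2 := h.eventually_const_lt (show (∫ x, x ^ 2 ∂(U 1)) / 4 < (∫ x, x ^ 2 ∂(U 1)) / 2 by
    linarith)
  rw [eventually_nhdsWithin_iff] at h2
  obtain ⟨δ, hδ, hball⟩ := Metric.eventually_nhds_iff_ball.1 h2
  refine ⟨(∫ x, x ^ 2 ∂(U 1)) / 4, by positivity, δ, hδ, fun l hl => ?_⟩
  rcases eq_or_ne l 0 with rfl | hl0
  · simp [S.zero]
  have h3 := hball l (by rwa [Metric.mem_ball, dist_zero_right, norm_eq_abs]) hl0
  simp only [Function.comp] at h3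
  rw [← Complex.ofReal_pow, Complex.div_ofReal_re, lt_div_iff₀ (by positivity)] at h3
  exact h3.le

/-- Diffusive scaling limit of the renormalized resolvent densities. -/
theorem tendsto_sqrt_mul_renormKernel (S : ResolventFamily Ψ U)
    (hM : Integrable (fun x : ℝ => x ^ 2) (U 1)) (hm : ∫ x, x ∂(U 1) = 0)
    {u t : ℕ → ℝ} {s : ℝ} (hu : Tendsto u atTop (𝓝[>] 0))
    (ht : Tendsto (fun n => √(u n) * t n) atTop (𝓝 s)) :
    Tendsto (fun n => √(u n) * renormKernel Ψ (u n) (t n)) atTop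
      (𝓝 ((2 * π)⁻¹ * ∫ v : ℝ, (1 - cos (v * s)) *
        (1 + (√((∫ x, x ^ 2 ∂(U 1)) / 2) * v) ^ 2)⁻¹)) := by
  have hM0 := S.integral_sq_pos hM
  set M := ∫ x, x ^ 2 ∂(U 1) with hMdef
  have hΨ := S.continuous_exponent.measurable
  obtain ⟨c, hc, δ, hδ, hre⟩ := S.exists_mul_sq_le_re_exponent hM hm
  have hupos : ∀ᶠ n in atTop, 0 < u n := hu.eventually self_mem_nhdsWithin
  have hu0 : Tendsto u atTop (𝓝 0) := hu.mono_right nhdsWithin_le_nhds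
  have hsq : Tendsto (fun n => √(u n)) atTop (𝓝 0) := by
    have := (continuous_sqrt.tendsto 0).comp hu0
    rwa [sqrt_zero] at this
  set f : ℕ → ℝ → ℝ := fun n l =>
    ((1 - Complex.exp ((l * t n : ℝ) * Complex.I)) * ((u n : ℂ) + Ψ l)⁻¹).re with hf
  set s1 := {l : ℝ | |l| < δ} with hs1
  have ms1 : MeasurableSet s1 := measurableSet_lt (by fun_prop) (by fun_prop)
  have hs1c : s1ᶜ = {l : ℝ | δ ≤ |l|} := by ext l; simp [hs1]
  set D := ∫ l in {l : ℝ | δ ≤ |l|}, ‖Ψ l‖⁻¹ with hD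
  have hnorm2 (x : ℝ) : ‖1 - Complex.exp (x * Complex.I)‖ ≤ 2 := by
    rw [norm_sub_rev]
    exact norm_exp_ofReal_mul_I_sub_one_le_two x
  have hfi (n : ℕ) (hn : 0 < u n) : Integrable (f n) :=
    (S.integrable_renormKernel_integrand hn (t n)).re
  -- the part of the integral away from the origin is negligible
  have far : Tendsto (fun n => √(u n) * ∫ l in s1ᶜ, f n l) atTop (𝓝 0) := by
    refine squeeze_zero_norm' (a := fun n => √(u n) * (2 * D)) ?_ (by simpa using hsq.mul_const _)
    filter_upwards [hupos] with n hn
    rw [norm_mul, norm_of_nonneg (sqrt_nonneg _)]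
    refine mul_le_mul_of_nonneg_left ?_ (sqrt_nonneg _)
    rw [hD, ← integral_const_mul, hs1c]
    refine norm_integral_le_of_norm_le ((S.integrableOn_inv_norm hδ).const_mul 2) ?_
    refine (ae_restrict_iff' (hs1c ▸ ms1.compl)).2 (Eventually.of_forall fun l hl => ?_)
    have hl : δ ≤ |l| := hl
    have hl0 : l ≠ 0 := by
      rintro rfl
      rw [abs_zero] at hl
      linarith
    refine (Complex.abs_re_le_norm _).trans ?_
    rw [norm_mul]
    exact mul_le_mul (hnorm2 _) (S.norm_inv_add_le hn hl0) (norm_nonneg _) (by norm_num)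
  have near : Tendsto (fun n => √(u n) * ∫ l in s1, f n l) atTop
      (𝓝 (∫ v : ℝ, (1 - cos (v * s)) * (1 + (√(M / 2) * v) ^ 2)⁻¹)) := by
    -- Substituting `l = √u v` produces `u / (u + Ψ(√u v))`, which tends to `1 / (1 + M v² / 2)`
    -- because `Ψ(l) / l² → M / 2`. The lower bound `c l² ≤ Re Ψ(l)` on the cut-off region gives the
    -- dominating function.
    have hsub : ∀ᶠ n in atTop, √(u n) * ∫ l in s1, f n l =
        ∫ v : ℝ, u n * s1.indicator (f n) (√(u n) * v) := by
      filter_upwards [hupos] with n hn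
      have hsn : 0 < √(u n) := sqrt_pos.2 hn
      rw [← integral_indicator ms1, integral_const_mul,
        Measure.integral_comp_mul_left (s1.indicator (f n)), abs_of_pos (by positivity),
        smul_eq_mul, ← mul_assoc]
      congr 1
      nth_rewrite 2 [← sq_sqrt hn.le]
      field_simp
    refine Tendsto.congr' (hsub.mono fun n hn => hn.symm) ?_
    refine tendsto_integral_filter_of_dominated_convergence
      (fun v => 2 * (1 + (√c * v) ^ 2)⁻¹) ?_ ?_ ?_ ?_
    · refine Eventually.of_forall fun n => Measurable.aestronglyMeasurable ?_
      have : Measurable (s1.indicator (f n)) := Measurable.indicator (by fun_prop) ms1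
      fun_prop
    · filter_upwards [hupos] with n hn
      refine Eventually.of_forall fun v => ?_
      by_cases hv : √(u n) * v ∈ s1
      · rw [indicator_of_mem hv, norm_mul, norm_of_nonneg hn.le]
        have h1 := hre _ hv
        have h2 : u n * (1 + (√c * v) ^ 2) ≤ ‖(u n : ℂ) + Ψ (√(u n) * v)‖ := by
          refine le_trans ?_ (Complex.re_le_norm _)
          rw [Complex.add_re, Complex.ofReal_re]
          rw [mul_pow, sq_sqrt hn.le] at h1
          rw [mul_pow, sq_sqrt hc.le]
          linarith
        have h3 : ‖f n (√(u n) * v)‖ ≤ 2 * (u n * (1 + (√c * v) ^ 2))⁻¹ := by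
          refine (Complex.abs_re_le_norm _).trans ?_
          rw [norm_mul, norm_inv]
          exact mul_le_mul (hnorm2 _) (inv_anti₀ (by positivity) h2) (by positivity) (by norm_num)
        refine (mul_le_mul_of_nonneg_left h3 hn.le).trans (le_of_eq ?_)
        field_simp
      · rw [indicator_of_notMem hv, mul_zero, norm_zero]
        positivity
    · exact (integrable_inv_one_add_sq.comp_mul_left' (sqrt_pos.2 hc).ne').const_mul 2
    · filter_upwards [compl_mem_ae_iff.2 (measure_singleton (0 : ℝ))] with v hv
      have hv : v ≠ 0 := hv
      have hl : Tendsto (fun n => √(u n) * v) atTop (𝓝[≠] 0) := by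
        refine tendsto_nhdsWithin_iff.2 ⟨by simpa using hsq.mul_const v, ?_⟩
        filter_upwards [hupos] with n hn
        exact mul_ne_zero (sqrt_pos.2 hn).ne' hv
      have hmem : ∀ᶠ n in atTop, √(u n) * v ∈ s1 := by
        have : s1 ∈ 𝓝 (0 : ℝ) := by
          have : s1 = Metric.ball 0 δ := by ext; simp [hs1]
          rw [this]
          exact Metric.ball_mem_nhds _ hδ
        exact (hl.mono_right nhdsWithin_le_nhds).eventually this
      have h1 := (S.tendsto_exponent_div_sq hM hm).comp hl
      have h2 := ((h1.mul_const ((v : ℂ) ^ 2)).const_add 1).inv₀ (by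
        rw [← Complex.ofReal_pow, ← Complex.ofReal_mul, ← Complex.ofReal_one,
          ← Complex.ofReal_add, Complex.ofReal_ne_zero]
        positivity)
      have h3 : Tendsto (fun n => 1 - Complex.exp ((v * (√(u n) * t n) : ℝ) * Complex.I)) atTop
          (𝓝 (1 - Complex.exp ((v * s : ℝ) * Complex.I))) := by
        have hcont : Continuous fun y : ℝ => 1 - Complex.exp ((v * y : ℝ) * Complex.I) := by
          fun_prop
        exact (hcont.tendsto s).comp ht
      have h4 := (Complex.continuous_re.tendsto _).comp (h3.mul h2)
      have hval : ((1 - Complex.exp ((v * s : ℝ) * Complex.I)) *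
          (1 + ((M / 2 : ℝ) : ℂ) * (v : ℂ) ^ 2)⁻¹).re =
          (1 - cos (v * s)) * (1 + (√(M / 2) * v) ^ 2)⁻¹ := by
        rw [← Complex.ofReal_pow, ← Complex.ofReal_mul, ← Complex.ofReal_one,
          ← Complex.ofReal_add, ← Complex.ofReal_inv, Complex.re_mul_ofReal, Complex.sub_re,
          Complex.exp_ofReal_mul_I_re, Complex.ofReal_re, mul_pow, sq_sqrt (by positivity)]
      rw [← hMdef, hval] at h4
      refine h4.congr' ?_
      filter_upwards [hupos, hmem] with n hn hmem
      rw [indicator_of_mem hmem]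
      simp only [Function.comp, hf]
      rw [← Complex.re_ofReal_mul]
      congr 1
      have e1 : v * (√(u n) * t n) = √(u n) * v * t n := by ring
      have e2 : ((√(u n) : ℝ) : ℂ) ^ 2 = (u n : ℂ) := by
        rw [← Complex.ofReal_pow, sq_sqrt hn.le]
      have hun : (u n : ℂ) ≠ 0 := Complex.ofReal_ne_zero.2 hn.ne'
      have hvc : (v : ℂ) ≠ 0 := Complex.ofReal_ne_zero.2 hv
      rw [e1, Complex.ofReal_mul (√(u n)) v, mul_pow, e2]
      have h5 := S.add_ne_zero hn (√(u n) * v)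
      have h6 : 1 + Ψ (√(u n) * v) / ((u n : ℂ) * (v : ℂ) ^ 2) * (v : ℂ) ^ 2 =
          ((u n : ℂ) + Ψ (√(u n) * v)) / (u n : ℂ) := by
        field_simp
      rw [h6, inv_div]
      ring
  have total := ((near.add far).const_mul (2 * π)⁻¹)
  rw [add_zero] at total
  refine total.congr' ?_
  filter_upwards [hupos] with n hn
  rw [← mul_add, integral_add_compl ms1 (hfi n hn), S.renormKernel_eq_integral hn]
  ring

end ResolventFamily

namespace IsKernelLimit

variable {Ψ : ℝ → ℂ} {U : ℝ → Measure ℝ} {u : ℕ → ℝ} {h : ℝ → ℝ}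

/-- Subadditivity gives `h_q(k x) ≤ k h_q(x)`. Taking `k` of order `s / (√q |x|)`, multiplying by
`√q` and letting `q → 0` along the sequence yields `(1 - exp (-s / a)) / (2 a) ≤ (s / |x|) h(x)`
with `a² = M / 2`. Dividing by `s` and letting `s → 0` gives the bound; the scaling limit is even in
`s`, so both signs of `x` are covered. -/
theorem abs_div_le (H : IsKernelLimit Ψ u h) (S : ResolventFamily Ψ U)
    (hM : Integrable (fun x : ℝ => x ^ 2) (U 1)) (hm : ∫ x, x ∂(U 1) = 0) (x : ℝ) :
    |x| / ∫ y, y ^ 2 ∂(U 1) ≤ h x := by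
  rcases eq_or_ne x 0 with rfl | hx
  · simpa using H.nonneg S 0
  have hM0 := S.integral_sq_pos hM
  set M := ∫ x, x ^ 2 ∂(U 1) with hMdef
  set a := √(M / 2) with ha
  have ha0 : 0 < a := sqrt_pos.2 (by positivity)
  have haM : a ^ 2 = M / 2 := sq_sqrt (by positivity)
  have hx0 : 0 < |x| := abs_pos.2 hx
  have hu0 : Tendsto u atTop (𝓝 0) := H.tendsto_index.mono_right nhdsWithin_le_nhds
  have hsq : Tendsto (fun n => √(u n)) atTop (𝓝 0) := by
    have := (continuous_sqrt.tendsto 0).comp hu0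
    rwa [sqrt_zero] at this
  -- the bound at a fixed scale `s`
  have hscale (s : ℝ) (hs : 0 < s) : (2 * a ^ 2 * (1 + s / a))⁻¹ * |x| ≤ h x := by
    set k : ℕ → ℕ := fun n => ⌈s / (√(u n) * |x|)⌉₊ with hk
    have hk1 : Tendsto (fun n => √(u n) * k n) atTop (𝓝 (s / |x|)) := by
      refine tendsto_of_tendsto_of_tendsto_of_le_of_le' tendsto_const_nhds
        (show Tendsto (fun n => s / |x| + √(u n)) atTop (𝓝 (s / |x|)) by
          simpa using hsq.const_add (s / |x|)) ?_ ?_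
      · filter_upwards [H.eventually_pos] with n hn
        have hsn := sqrt_pos.2 hn
        have h1 := mul_le_mul_of_nonneg_left (Nat.le_ceil (s / (√(u n) * |x|))) hsn.le
        refine le_trans (le_of_eq ?_) h1
        field_simp
      · filter_upwards [H.eventually_pos] with n hn
        have hsn := sqrt_pos.2 hn
        have h1 := mul_le_mul_of_nonneg_left
          (Nat.ceil_lt_add_one (show 0 ≤ s / (√(u n) * |x|) by positivity)).le hsn.le
        refine h1.trans (le_of_eq ?_)
        field_simp
    have hk2 : Tendsto (fun n => √(u n) * (k n * x)) atTop (𝓝 (s / |x| * x)) :=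
      (hk1.mul_const x).congr fun n => by ring
    have l1 := S.tendsto_sqrt_mul_renormKernel hM hm H.tendsto_index hk2
    rw [← hMdef, ← ha, integral_one_sub_cos_div_one_add_sq ha0] at l1
    have l2 := hk1.mul (H.tendsto x)
    have hle := le_of_tendsto_of_tendsto l1 l2 (by
      filter_upwards [H.eventually_pos] with n hn
      have := mul_le_mul_of_nonneg_left (S.renormKernel_natCast_mul_le hn (k n) x)
        (sqrt_nonneg (u n))
      linarith)
    have e1 : |s / |x| * x / a| = s / a := by
      rw [abs_div, abs_mul, abs_div, abs_abs, abs_of_pos hs, abs_of_pos ha0]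
      field_simp
    rw [e1] at hle
    -- A rational lower bound from `exp t ≥ 1 + t`, sharp to first order at `t = 0`, so that the
    -- limit `s → 0` is elementary.
    have e2 : s / a / (1 + s / a) ≤ 1 - exp (-(s / a)) := by
      have hsa : 0 < s / a := by positivity
      have h1 := add_one_le_exp (s / a)
      rw [exp_neg]
      have h2 : (exp (s / a))⁻¹ ≤ (1 + s / a)⁻¹ := inv_anti₀ (by positivity) (by linarith)
      have h3 : s / a / (1 + s / a) = 1 - (1 + s / a)⁻¹ := by field_simp; ring
      linarith
    have e3 : (2 * π)⁻¹ * (π / a * (s / a / (1 + s / a))) ≤ s / |x| * h x :=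
      le_trans (mul_le_mul_of_nonneg_left (mul_le_mul_of_nonneg_left e2 (by positivity))
        (by positivity)) hle
    have e4 : (2 * π)⁻¹ * (π / a * (s / a / (1 + s / a))) =
        s / |x| * ((2 * a ^ 2 * (1 + s / a))⁻¹ * |x|) := by
      have := pi_ne_zero
      field_simp
    rw [e4] at e3
    exact le_of_mul_le_mul_left e3 (by positivity)
  have hlim : Tendsto (fun s : ℝ => (2 * a ^ 2 * (1 + s / a))⁻¹ * |x|) (𝓝[>] 0)
      (𝓝 (|x| / M)) := by
    have hc : ContinuousAt (fun s : ℝ => (2 * a ^ 2 * (1 + s / a))⁻¹ * |x|) 0 := by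
      refine ContinuousAt.mul (ContinuousAt.inv₀ (by fun_prop) ?_) continuousAt_const
      simp [ha0.ne']
    have := hc.tendsto.mono_left (nhdsWithin_le_nhds (s := Ioi 0))
    have e : (2 * a ^ 2 * (1 + 0 / a))⁻¹ * |x| = |x| / M := by
      rw [zero_div, add_zero, mul_one, haM, mul_div_cancel₀ _ two_ne_zero, inv_mul_eq_div]
    rwa [e] at this
  exact le_of_tendsto hlim (by
    filter_upwards [self_mem_nhdsWithin] with s hs
    exact hscale s hs)

end IsKernelLimit

/-! ### The slopes at infinity and convergence of the renormalized densities -/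

namespace ResolventFamily

variable {Ψ : ℝ → ℂ} {U : ℝ → Measure ℝ}

theorem integrable_sq_iff : Integrable (fun x : ℝ => x ^ 2) (U 1) ↔
    ∫⁻ x, ENNReal.ofReal (x ^ 2) ∂(U 1) ≠ ∞ := by
  rw [← lt_top_iff_ne_top, ← hasFiniteIntegral_iff_ofReal (Eventually.of_forall fun x => sq_nonneg x)]
  exact ⟨fun h => h.2, fun h => ⟨by fun_prop, h⟩⟩

end ResolventFamily

namespace IsKernelLimit

variable {Ψ : ℝ → ℂ} {U : ℝ → Measure ℝ} {u : ℕ → ℝ} {h : ℝ → ℝ}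

/-- In the finite case the two slopes satisfy `a ≥ 1 / M`, `-b ≥ 1 / M` and `a - b = 2 / M`, which
leaves only equality. -/
theorem tendsto_unit_increment (H : IsKernelLimit Ψ u h) (S : ResolventFamily Ψ U)
    (hrec : Tendsto (fun q => resolventKernel Ψ q 0) (𝓝[>] 0) atTop) :
    Tendsto (fun y => h (y + 1) - h y) atTop
      (𝓝 (∫⁻ x, ENNReal.ofReal (x ^ 2) ∂(U 1))⁻¹.toReal) ∧
    Tendsto (fun y => h (y + 1) - h y) atBot
      (𝓝 (-(∫⁻ x, ENNReal.ofReal (x ^ 2) ∂(U 1))⁻¹.toReal)) := by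
  by_cases hinf : ∫⁻ x, ENNReal.ofReal (x ^ 2) ∂(U 1) = ∞
  · rw [hinf, ENNReal.inv_top, ENNReal.toReal_zero, neg_zero]
    exact ⟨H.tendsto_increment_of_infinite S hinf atTop_le_cocompact,
      H.tendsto_increment_of_infinite S hinf atBot_le_cocompact⟩
  have hM := ResolventFamily.integrable_sq_iff.2 hinf
  have hm := S.mean_eq_zero hM hrec
  have hM0 := S.integral_sq_pos hM
  obtain ⟨C, -, hC⟩ := H.exists_abs_add_sub_le S
  obtain ⟨a, b, ha, hb, hab⟩ := H.exists_tendsto_increment S hM hm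
  have hlow := H.abs_div_le S hM hm
  rw [← ofReal_integral_eq_lintegral_ofReal hM (Eventually.of_forall fun x => sq_nonneg x),
    ENNReal.toReal_inv, ENNReal.toReal_ofReal hM0.le]
  set M := ∫ x, x ^ 2 ∂(U 1) with hMdef
  have h1 : M⁻¹ ≤ a := by
    refine ge_of_tendsto (tendsto_div_atTop_of_increment hC ha) ?_
    filter_upwards [eventually_gt_atTop 0] with x hx
    have := hlow x
    rw [abs_of_pos hx] at this
    rw [le_div_iff₀ hx, inv_mul_eq_div]
    exact this
  have h2 : M⁻¹ ≤ -b := by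
    refine ge_of_tendsto (tendsto_div_abs_atBot_of_increment hC hb) ?_
    filter_upwards [eventually_lt_atBot 0] with x hx
    rw [le_div_iff₀ (abs_pos.2 hx.ne), inv_mul_eq_div]
    exact hlow x
  have h3 : (2 : ℝ) / M = M⁻¹ + M⁻¹ := by rw [div_eq_mul_inv]; ring
  have ea : a = M⁻¹ := by linarith
  have eb : b = -M⁻¹ := by linarith
  exact ⟨ea ▸ ha, eb ▸ hb⟩

theorem tendsto_increment (H : IsKernelLimit Ψ u h) (S : ResolventFamily Ψ U)
    (hrec : Tendsto (fun q => resolventKernel Ψ q 0) (𝓝[>] 0) atTop) (x : ℝ) :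
    Tendsto (fun y => h (x + y) - h y) atTop
      (𝓝 (x * (∫⁻ x, ENNReal.ofReal (x ^ 2) ∂(U 1))⁻¹.toReal)) ∧
    Tendsto (fun y => h (x + y) - h y) atBot
      (𝓝 (-(x * (∫⁻ x, ENNReal.ofReal (x ^ 2) ∂(U 1))⁻¹.toReal))) := by
  obtain ⟨h1, h2⟩ := H.tendsto_unit_increment S hrec
  have key {𝓕 : Filter ℝ} (h𝓕 : 𝓕 ≤ cocompact ℝ) {c : ℝ}
      (hc : Tendsto (fun y => h (y + 1) - h y) 𝓕 (𝓝 c)) :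
      Tendsto (fun y => h (x + y) - h y) 𝓕 (𝓝 (x * c)) := by
    have := (H.tendsto_increment_sub_mul S h𝓕 x).add (hc.const_mul x)
    rw [zero_add] at this
    refine this.congr fun y => ?_
    rw [add_comm x y]
    ring
  refine ⟨key atTop_le_cocompact h1, ?_⟩
  rw [← mul_neg]
  exact key atBot_le_cocompact h2

theorem tendsto_div_abs (H : IsKernelLimit Ψ u h) (S : ResolventFamily Ψ U)
    (hrec : Tendsto (fun q => resolventKernel Ψ q 0) (𝓝[>] 0) atTop) :
    Tendsto (fun x => h x / |x|) atTop (𝓝 (∫⁻ x, ENNReal.ofReal (x ^ 2) ∂(U 1))⁻¹.toReal) ∧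
    Tendsto (fun x => h x / |x|) atBot (𝓝 (∫⁻ x, ENNReal.ofReal (x ^ 2) ∂(U 1))⁻¹.toReal) := by
  obtain ⟨h1, h2⟩ := H.tendsto_unit_increment S hrec
  obtain ⟨C, -, hC⟩ := H.exists_abs_add_sub_le S
  refine ⟨(tendsto_div_atTop_of_increment hC h1).congr' ?_, ?_⟩
  · filter_upwards [eventually_gt_atTop 0] with x hx
    rw [abs_of_pos hx]
  · have := tendsto_div_abs_atBot_of_increment hC h2
    rwa [neg_neg] at this

end IsKernelLimit

namespace ResolventFamily

variable {Ψ : ℝ → ℂ} {U : ℝ → Measure ℝ}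

/-- Since `h_q(x) - x h_q(1)` converges for every `x`, extracting a convergent subsequence from the
bounded numbers `h_q(1)` gives convergence at all `x` at once. -/
theorem exists_isKernelLimit_comp (S : ResolventFamily Ψ U) {f : ℝ → ℝ}
    (hf : ∀ x, Tendsto (fun q => renormKernel Ψ q x - x * renormKernel Ψ q 1) (𝓝[>] 0) (𝓝 (f x)))
    {u : ℕ → ℝ} (hu : Tendsto u atTop (𝓝[>] 0)) :
    ∃ φ : ℕ → ℕ, ∃ b : ℝ, IsKernelLimit Ψ (u ∘ φ) (fun x => f x + x * b) ∧
      Tendsto (fun n => renormKernel Ψ (u (φ n)) 1) atTop (𝓝 b) := by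
  have hmem : ∀ᶠ n in atTop, renormKernel Ψ (u n) 1 ∈ Icc 0 (renormBound Ψ 1) := by
    filter_upwards [hu.eventually self_mem_nhdsWithin] with n hn
    exact ⟨S.renormKernel_nonneg hn 1, S.renormKernel_le hn 1⟩
  obtain ⟨b, -, φ, hφ, hb⟩ := isCompact_Icc.tendsto_subseq' hmem.frequently
  have huφ := hu.comp hφ.tendsto_atTop
  refine ⟨φ, b, ⟨huφ, fun x => ?_⟩, hb⟩
  refine (((hf x).comp huφ).add (hb.const_mul x)).congr fun n => ?_
  simp only [Function.comp]
  ring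

/-- The renormalized resolvent densities converge as `q → 0+`. -/
theorem exists_tendsto_renormKernel (S : ResolventFamily Ψ U)
    (hrec : Tendsto (fun q => resolventKernel Ψ q 0) (𝓝[>] 0) atTop) :
    ∃ h : ℝ → ℝ, ∀ x, Tendsto (fun q => renormKernel Ψ q x) (𝓝[>] 0) (𝓝 (h x)) := by
  choose f hf using S.exists_tendsto_renormKernel_sub_mul hrec
  obtain ⟨u₀, hu₀⟩ := exists_seq_tendsto (𝓝[>] (0 : ℝ))
  obtain ⟨φ₀, b₀, H₀, -⟩ := S.exists_isKernelLimit_comp hf hu₀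
  have hone : Tendsto (fun q => renormKernel Ψ q 1) (𝓝[>] 0) (𝓝 b₀) := by
    -- Two subsequential limits differ by `x (b - b₀)` but have the same slope at `+∞`, so `b = b₀`.
    refine tendsto_of_subseq_tendsto fun u hu => ?_
    obtain ⟨φ, b, H, hb⟩ := S.exists_isKernelLimit_comp hf hu
    have hdiff := (H.tendsto_div_abs S hrec).1.sub (H₀.tendsto_div_abs S hrec).1
    rw [sub_self] at hdiff
    have hconst : Tendsto (fun x => (f x + x * b) / |x| - (f x + x * b₀) / |x|) atTop
        (𝓝 (b - b₀)) := by
      refine tendsto_const_nhds.congr' ?_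
      filter_upwards [eventually_gt_atTop 0] with x hx
      rw [abs_of_pos hx]
      field_simp
      ring
    rw [sub_eq_zero.1 (tendsto_nhds_unique hconst hdiff)] at hb
    exact ⟨φ, hb⟩
  refine ⟨fun x => f x + x * b₀, fun x => ((hf x).add (hone.const_mul x)).congr fun q => ?_⟩
  ring

end ResolventFamily

/-! ### Lévy processes: the exponent and joint measurability -/

/-- A bounded right-continuous multiplicative function on `[0, ∞)` is an exponential. -/
theorem exists_eq_exp_of_multiplicative {g : ℝ → ℂ} (hmeas : Measurable g)
    (hbdd : ∀ t, ‖g t‖ ≤ 1) (hzero : g 0 = 1)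
    (hmul : ∀ s t, 0 ≤ s → 0 ≤ t → g (s + t) = g s * g t)
    (hright : ∀ t, 0 ≤ t → ContinuousWithinAt g (Ici t) t) :
    ∃ z : ℂ, ∀ t : ℝ, 0 ≤ t → g t = Complex.exp (-(t : ℂ) * z) := by
  have hint (a b : ℝ) : IntervalIntegrable g volume a b :=
    (intervalIntegrable_const (c := (1 : ℝ))).mono_fun hmeas.aestronglyMeasurable
      (Eventually.of_forall fun t => by simpa using hbdd t)
  set G : ℝ → ℂ := fun t => ∫ s in (0 : ℝ)..t, g s with hG
  have hGc : Continuous G := intervalIntegral.continuous_primitive hint 0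
  obtain ⟨δ, hδ, hGδ⟩ : ∃ δ > 0, G δ ≠ 0 := by
    have h1 : ∀ᶠ t in 𝓝[≥] (0 : ℝ), ‖g t - 1‖ < 1 / 2 := by
      have h := hright 0 le_rfl
      rw [ContinuousWithinAt, hzero] at h
      have h2 := Metric.tendsto_nhds.1 h (1 / 2) (by norm_num)
      simpa [dist_eq_norm] using h2
    obtain ⟨δ, hδ, hball⟩ := mem_nhdsGE_iff_exists_Icc_subset.1 h1
    have hδ : 0 < δ := hδ
    refine ⟨δ, hδ, fun h0 => ?_⟩
    have h3 : ‖∫ s in (0 : ℝ)..δ, (g s - 1)‖ ≤ 1 / 2 * |δ - 0| := by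
      refine intervalIntegral.norm_integral_le_of_norm_le_const fun s hs => ?_
      rw [uIoc_of_le hδ.le] at hs
      have : ‖g s - 1‖ < 1 / 2 := hball ⟨hs.1.le, hs.2⟩
      exact this.le
    rw [intervalIntegral.integral_sub (hint 0 δ) intervalIntegrable_const] at h3
    have h0' : ∫ s in (0 : ℝ)..δ, g s = 0 := h0
    rw [h0', intervalIntegral.integral_const, zero_sub, norm_neg, norm_smul, norm_one, mul_one,
      sub_zero, norm_eq_abs, abs_of_pos hδ] at h3
    linarith
  -- Integrating `g(t + s) = g(t) g(s)` over `s` in `[0, δ]` expresses `g` through its primitive;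
  -- this upgrades right continuity to continuity and right differentiability.
  have hrep (t : ℝ) (ht : 0 ≤ t) : g t = (G (t + δ) - G t) / G δ := by
    rw [eq_div_iff hGδ, hG]
    have h1 : ∫ s in (0 : ℝ)..t + δ, g s = (∫ s in (0 : ℝ)..t, g s) + ∫ s in t..t + δ, g s :=
      (intervalIntegral.integral_add_adjacent_intervals (hint 0 t) (hint t (t + δ))).symm
    simp only
    rw [h1, add_sub_cancel_left, ← intervalIntegral.integral_const_mul]
    have h2 := intervalIntegral.integral_comp_add_left (a := 0) (b := δ) g t
    rw [add_zero] at h2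
    rw [← h2]
    refine intervalIntegral.integral_congr fun s hs => ?_
    rw [uIcc_of_le hδ.le] at hs
    exact (hmul t s ht hs.1).symm
  have hGd (t : ℝ) (ht : 0 ≤ t) : HasDerivWithinAt G (g t) (Ici t) t :=
    intervalIntegral.integral_hasDerivWithinAt_right (hint 0 t)
      hmeas.stronglyMeasurable.stronglyMeasurableAtFilter
      ((hright t ht).mono Ioi_subset_Ici_self)
  set z : ℂ := (1 - g δ) / G δ with hz
  have hgd (t : ℝ) (ht : 0 ≤ t) : HasDerivWithinAt g (-z * g t) (Ici t) t := by
    have h1 : HasDerivWithinAt (fun s => G (s + δ)) (g (t + δ)) (Ici t) t := by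
      have := (hGd (t + δ) (by linarith)).scomp t
        ((hasDerivWithinAt_id t (Ici t)).add_const δ) (fun s hs => by
          have hs : t ≤ s := hs
          show t + δ ≤ s + δ
          linarith)
      rw [one_smul] at this
      exact this
    have h2 := (h1.sub (hGd t ht)).div_const (G δ)
    have e : (g (t + δ) - g t) / G δ = -z * g t := by
      rw [hmul t δ ht hδ.le, hz]
      field_simp
      ring
    rw [e] at h2
    exact h2.congr (fun s hs => hrep s (ht.trans hs)) (hrep t ht)
  refine ⟨z, fun t ht => ?_⟩
  have hcont : ContinuousOn (fun s : ℝ => g s * Complex.exp (s * z)) (Icc 0 t) := by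
    have : ContinuousOn g (Icc 0 t) :=
      ContinuousOn.congr (f := fun s => (G (s + δ) - G s) / G δ) (by fun_prop)
        fun s hs => hrep s hs.1
    fun_prop
  -- The right derivative satisfies `g' = -z g`, so `g(s) exp (s z)` is continuous with vanishing
  -- right derivative, hence constant.
  have hconst := constant_of_has_deriv_right_zero hcont (fun s hs => by
    have h1 : HasDerivAt (fun s : ℝ => Complex.exp (s * z)) (Complex.exp (s * z) * z) s := by
      have : HasDerivAt (fun s : ℝ => (s : ℂ) * z) (1 * z) s :=
        (Complex.ofRealCLM.hasDerivAt).mul_const z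
      rw [one_mul] at this
      exact this.cexp
    refine ((hgd s hs.1).mul h1.hasDerivWithinAt).congr_deriv ?_
    ring) t ⟨ht, le_rfl⟩
  rw [hzero, Complex.ofReal_zero, zero_mul, Complex.exp_zero, mul_one] at hconst
  rw [neg_mul, Complex.exp_neg]
  exact eq_inv_of_mul_eq_one_left hconst

namespace IsLevyProcess

variable {Ω : Type*} [MeasurableSpace Ω] {P : Measure Ω} {X : ℝ≥0 → Ω → ℝ}

/-- Replace `t` by the grid point `(⌊t (n + 1)⌋ + 1) / (n + 1)`, which approaches `t` from the
right; right continuity of the paths makes the process a pointwise limit of the discretised, jointly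
measurable ones. -/
theorem measurable_uncurry (hX : IsLevyProcess X P) :
    Measurable fun p : ℝ≥0 × Ω => X p.1 p.2 := by
  let τ : ℕ → ℕ → ℝ≥0 := fun n k => ((k : ℝ≥0) + 1) / ((n : ℝ≥0) + 1)
  refine measurable_of_tendsto_metrizable
    (f := fun n p => X (τ n ⌊p.1 * ((n : ℝ≥0) + 1)⌋₊) p.2) (fun n => ?_) ?_
  · have h1 : Measurable fun p : ℕ × Ω => X (τ n p.1) p.2 :=
      measurable_from_prod_countable_right fun k => hX.measurable (τ n k)
    have h2 : Measurable fun p : ℝ≥0 × Ω => (⌊p.1 * ((n : ℝ≥0) + 1)⌋₊, p.2) := by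
      refine Measurable.prodMk (Nat.measurable_floor.comp ?_) measurable_snd
      fun_prop
    have h3 := h1.comp h2
    simpa only [Function.comp_def] using h3
  · rw [tendsto_pi_nhds]
    rintro ⟨t, ω⟩
    refine (hX.right_continuous ω t).tendsto.comp (tendsto_nhdsWithin_iff.2 ⟨?_, ?_⟩)
    · refine tendsto_of_tendsto_of_tendsto_of_le_of_le tendsto_const_nhds
        (h := fun n : ℕ => t + ((n : ℝ≥0) + 1)⁻¹) ?_ (fun n => ?_) (fun n => ?_)
      · have : Tendsto (fun n : ℕ => ((n : ℝ≥0) + 1)⁻¹) atTop (𝓝 0) := by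
          simpa using tendsto_one_div_add_atTop_nhds_zero_nat (𝕜 := ℝ≥0)
        simpa using this.const_add t
      · exact (le_div_iff₀ (by positivity)).2 (Nat.lt_floor_add_one _).le
      · simp only [τ]
        rw [add_div, one_div]
        gcongr
        exact (div_le_iff₀ (by positivity)).2 (Nat.floor_le (by positivity))
    · refine Eventually.of_forall fun n => mem_Ici.2 ?_
      exact (le_div_iff₀ (by positivity)).2 (Nat.lt_floor_add_one _).le

theorem charFun_eq_integral (hX : IsLevyProcess X P) (t : ℝ≥0) (l : ℝ) :
    charFun (P.map (X t)) l = ∫ ω, Complex.exp (l * X t ω * Complex.I) ∂P := by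
  rw [charFun_apply_real, integral_map (hX.measurable t).aemeasurable (by fun_prop)]

variable [IsProbabilityMeasure P]

theorem charFun_add (hX : IsLevyProcess X P) (s t : ℝ≥0) (l : ℝ) :
    charFun (P.map (X (s + t))) l = charFun (P.map (X s)) l * charFun (P.map (X t)) l := by
  have hind := hX.indep_increments.indepFun_eval_sub (zero_le (a := s)) (le_self_add (a := s) (b := t))
    hX.start_zero
  have h := hind.charFun_map_add_eq_mul (hX.measurable s).aemeasurable
    ((hX.measurable (s + t)).sub (hX.measurable s)).aemeasurable
  rw [add_sub_cancel] at h
  have h2 : P.map (X (s + t) - X s) = P.map (X t) := (hX.stationary_increments s t).map_eq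
  rw [h, Pi.mul_apply, h2]

/-- `charExponent` is a choice, so it suffices that some exponent exists: `t ↦ E[exp (i l X_t)]` is
multiplicative by independence and stationarity, and right continuous by dominated convergence along
paths. -/
theorem charFun_eq_exp (hX : IsLevyProcess X P) (l : ℝ) (t : ℝ≥0) :
    charFun (P.map (X t)) l = Complex.exp (-((t : ℝ) : ℂ) * charExponent X P l) := by
  refine Classical.epsilon_spec (p := fun z : ℂ =>
    ∀ t : ℝ≥0, charFun (P.map (X t)) l = Complex.exp (-((t : ℝ) : ℂ) * z)) ?_ t
  have hprob (t : ℝ≥0) : IsProbabilityMeasure (P.map (X t)) :=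
    Measure.isProbabilityMeasure_map (hX.measurable t).aemeasurable
  have hXm := hX.measurable_uncurry
  suffices h : ∃ z : ℂ, ∀ t : ℝ, 0 ≤ t →
      charFun (P.map (X t.toNNReal)) l = Complex.exp (-(t : ℂ) * z) by
    obtain ⟨z, hz⟩ := h
    refine ⟨z, fun t => ?_⟩
    have := hz t t.2
    rwa [Real.toNNReal_coe] at this
  refine exists_eq_exp_of_multiplicative
    (g := fun t : ℝ => charFun (P.map (X t.toNNReal)) l) ?_ (fun t => norm_charFun_le_one l) ?_
    (fun s t hs ht => ?_) (fun t ht => ?_)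
  · simp_rw [hX.charFun_eq_integral]
    refine (StronglyMeasurable.integral_prod_right' (f := fun p : ℝ × Ω =>
      Complex.exp (l * X p.1.toNNReal p.2 * Complex.I)) ?_).measurable
    have : Measurable fun p : ℝ × Ω => X p.1.toNNReal p.2 :=
      hXm.comp (by fun_prop : Measurable fun p : ℝ × Ω => (p.1.toNNReal, p.2))
    exact Measurable.stronglyMeasurable (by fun_prop)
  · rw [Real.toNNReal_zero, hX.charFun_eq_integral]
    have : ∫ ω, Complex.exp (l * X 0 ω * Complex.I) ∂P = ∫ ω, (1 : ℂ) ∂P :=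
      integral_congr_ae (hX.start_zero.mono fun ω hω => by simp [hω])
    simpa using this
  · rw [Real.toNNReal_add hs ht]
    exact hX.charFun_add _ _ l
  · simp_rw [ContinuousWithinAt, hX.charFun_eq_integral]
    refine tendsto_integral_filter_of_dominated_convergence (fun _ => 1) ?_ ?_
      (integrable_const 1) ?_
    · refine Eventually.of_forall fun s => Measurable.aestronglyMeasurable ?_
      have := hX.measurable s.toNNReal
      fun_prop
    · refine Eventually.of_forall fun s => Eventually.of_forall fun ω => ?_
      rw [← Complex.ofReal_mul, Complex.norm_exp_ofReal_mul_I]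
    · refine Eventually.of_forall fun ω => ?_
      have h1 : Tendsto (fun s : ℝ => X s.toNNReal ω) (𝓝[≥] t) (𝓝 (X t.toNNReal ω)) := by
        refine (hX.right_continuous ω t.toNNReal).tendsto.comp (tendsto_nhdsWithin_iff.2 ⟨?_, ?_⟩)
        · exact (continuous_real_toNNReal.tendsto t).mono_left nhdsWithin_le_nhds
        · filter_upwards [self_mem_nhdsWithin] with s hs
          exact Real.toNNReal_le_toNNReal hs
      have hc : Continuous fun y : ℝ => Complex.exp (l * y * Complex.I) := by fun_prop
      exact (hc.tendsto _).comp h1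

theorem re_charExponent_nonneg (hX : IsLevyProcess X P) (l : ℝ) :
    0 ≤ (charExponent X P l).re := by
  have : IsProbabilityMeasure (P.map (X 1)) :=
    Measure.isProbabilityMeasure_map (hX.measurable 1).aemeasurable
  have h := norm_charFun_le_one (μ := P.map (X 1)) l
  rw [hX.charFun_eq_exp, Complex.norm_exp, exp_le_one_iff] at h
  simpa using h

end IsLevyProcess

/-! ### Lévy processes: resolvent measures and recurrence -/

/-- The measure `exp (-q t) dt` on `(0, ∞)`. -/
noncomputable def expMeasure (q : ℝ) : Measure ℝ :=
  (volume.restrict (Ioi (0 : ℝ))).withDensity fun t => ENNReal.ofReal (exp (-q * t))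

theorem isFiniteMeasure_expMeasure {q : ℝ} (hq : 0 < q) : IsFiniteMeasure (expMeasure q) :=
  isFiniteMeasure_withDensity_ofReal (integrableOn_exp_mul_Ioi (by linarith) 0).2

instance sFinite_expMeasure (q : ℝ) : SFinite (expMeasure q) := by
  unfold expMeasure; infer_instance

/-- The resolvent measure `f ↦ E[∫_0^∞ exp (-q t) f(X_t) dt]`. -/
noncomputable def resolventMeasure {Ω : Type*} [MeasurableSpace Ω] (X : ℝ≥0 → Ω → ℝ)
    (P : Measure Ω) (q : ℝ) : Measure ℝ :=
  (P.prod (expMeasure q)).map fun p => X p.2.toNNReal p.1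

namespace IsLevyProcess

variable {Ω : Type*} [MeasurableSpace Ω] {P : Measure Ω} {X : ℝ≥0 → Ω → ℝ}

theorem measurable_eval (hX : IsLevyProcess X P) :
    Measurable fun p : Ω × ℝ => X p.2.toNNReal p.1 :=
  hX.measurable_uncurry.comp (by fun_prop : Measurable fun p : Ω × ℝ => (p.2.toNNReal, p.1))

theorem lintegral_resolventMeasure (hX : IsLevyProcess X P) (q : ℝ) {f : ℝ → ℝ≥0∞}
    (hf : Measurable f) :
    ∫⁻ x, f x ∂(resolventMeasure X P q) =
      ∫⁻ ω, (∫⁻ t in Ioi (0 : ℝ), ENNReal.ofReal (exp (-q * t)) * f (X t.toNNReal ω)) ∂P := by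
  have hfX : Measurable fun p : Ω × ℝ => f (X p.2.toNNReal p.1) := hf.comp hX.measurable_eval
  rw [resolventMeasure, lintegral_map hf hX.measurable_eval, lintegral_prod _ hfX.aemeasurable]
  refine lintegral_congr fun ω => ?_
  rw [expMeasure, lintegral_withDensity_eq_lintegral_mul _ (by fun_prop)]
  · rfl
  · exact hfX.comp (by fun_prop : Measurable fun t : ℝ => (ω, t))

variable [IsProbabilityMeasure P]

theorem isFiniteMeasure_resolventMeasure {q : ℝ} (hq : 0 < q) :
    IsFiniteMeasure (resolventMeasure X P q) := by
  have := isFiniteMeasure_expMeasure hq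
  unfold resolventMeasure
  infer_instance

theorem charFun_resolventMeasure (hX : IsLevyProcess X P) {q : ℝ} (hq : 0 < q) (l : ℝ) :
    charFun (resolventMeasure X P q) l = ((q : ℂ) + charExponent X P l)⁻¹ := by
  have := isFiniteMeasure_expMeasure hq
  have hXm := hX.measurable_eval
  have hre := hX.re_charExponent_nonneg l
  rw [charFun_apply_real, resolventMeasure, integral_map hXm.aemeasurable (by fun_prop),
    integral_prod_symm, expMeasure,
    integral_withDensity_eq_integral_toReal_smul (by fun_prop) (by simp)]
  · have h1 : ∀ t ∈ Ioi (0 : ℝ), (ENNReal.ofReal (exp (-q * t))).toReal •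
        ∫ ω, Complex.exp (l * X t.toNNReal ω * Complex.I) ∂P =
        Complex.exp (-((q : ℂ) + charExponent X P l) * t) := by
      intro t ht
      have ht : 0 < t := ht
      rw [← hX.charFun_eq_integral, hX.charFun_eq_exp, ENNReal.toReal_ofReal (exp_pos _).le,
        Complex.real_smul, Complex.ofReal_exp, ← Complex.exp_add, Real.coe_toNNReal t ht.le]
      congr 1
      push_cast
      ring
    rw [setIntegral_congr_fun measurableSet_Ioi h1, integral_exp_mul_complex_Ioi]
    · rw [Complex.ofReal_zero, mul_zero, Complex.exp_zero, neg_div_neg_eq, one_div]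
    · rw [Complex.neg_re, Complex.add_re, Complex.ofReal_re]
      linarith
  · refine (integrable_const (1 : ℝ)).mono' ?_ (Eventually.of_forall fun p => ?_)
    · have hc : Continuous fun y : ℝ => Complex.exp (l * y * Complex.I) := by fun_prop
      exact (hc.measurable.comp hXm).aestronglyMeasurable
    rw [← Complex.ofReal_mul, Complex.norm_exp_ofReal_mul_I]

theorem charExponent_zero (hX : IsLevyProcess X P) : charExponent X P 0 = 0 := by
  have h := hX.charFun_resolventMeasure one_pos 0
  have h1 : resolventMeasure X P 1 univ = 1 := by
    rw [← lintegral_one, hX.lintegral_resolventMeasure 1 measurable_const]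
    simp only [mul_one]
    rw [lintegral_const, measure_univ, mul_one,
      ← ofReal_integral_eq_lintegral_ofReal (integrableOn_exp_mul_Ioi (by norm_num) 0)
        (Eventually.of_forall fun t => (exp_pos _).le), integral_exp_mul_Ioi (by norm_num)]
    simp
  rw [charFun_zero, measureReal_def, h1, ENNReal.toReal_one, Complex.ofReal_one, eq_comm,
    inv_eq_one] at h
  simpa using h

/-- Condition (A) controls only `l > 0`; the negative half line follows since the characteristic
function at `-l` is the complex conjugate of that at `l`. -/
theorem integrable_inv_charExponent (hX : IsLevyProcess X P) (hA : ConditionA X P) {q : ℝ}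
    (hq : 0 < q) : Integrable fun l => ((q : ℂ) + charExponent X P l)⁻¹ := by
  have := isFiniteMeasure_resolventMeasure (X := X) (P := P) hq
  have e : (fun l => ((q : ℂ) + charExponent X P l)⁻¹) = charFun (resolventMeasure X P q) :=
    funext fun l => (hX.charFun_resolventMeasure hq l).symm
  have hcont : Continuous (charFun (resolventMeasure X P q)) := continuous_charFun
  have hpos : IntegrableOn (charFun (resolventMeasure X P q)) (Ioi 0) := by
    refine ⟨hcont.aestronglyMeasurable, ?_⟩
    rw [← e]
    have := hA q hq
    simp_rw [one_div] at this
    exact this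
  have hneg : IntegrableOn (charFun (resolventMeasure X P q)) (Iic 0) := by
    rw [integrableOn_Iic_iff_integrableOn_Iio, IntegrableOn, ← integrable_norm_iff hcont.aestronglyMeasurable]
    have h0 : IntegrableOn (fun l => ‖charFun (resolventMeasure X P q) l‖) (Ioi (-0)) := by
      rw [neg_zero]
      exact hpos.norm
    have h1 := h0.comp_neg_Iio
    refine h1.congr (Eventually.of_forall fun l => ?_)
    beta_reduce
    rw [charFun_neg, RCLike.norm_conj]
  rw [e, ← integrableOn_univ, ← Iic_union_Ioi (a := (0 : ℝ))]
  exact hneg.union hpos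

theorem resolventFamily (hX : IsLevyProcess X P) (hA : ConditionA X P) :
    ResolventFamily (charExponent X P) (resolventMeasure X P) where
  re_nonneg := hX.re_charExponent_nonneg
  zero := hX.charExponent_zero
  finite _ hq := isFiniteMeasure_resolventMeasure hq
  charFun_eq _ hq l := hX.charFun_resolventMeasure hq l
  integrable_inv _ hq := hX.integrable_inv_charExponent hA hq

theorem isResolventDensity_kernel (hX : IsLevyProcess X P) (hA : ConditionA X P) {q : ℝ}
    (hq : 0 < q) : IsResolventDensity X P q (resolventKernel (charExponent X P) q) := by
  have S := hX.resolventFamily hA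
  have hm := (S.continuous_kernel hq).measurable
  obtain ⟨C, hC⟩ := S.bddAbove_kernel hq
  refine ⟨S.continuous_kernel hq, S.kernel_nonneg hq, ⟨C, fun x => (le_abs_self _).trans (hC x)⟩,
    fun f hf => ?_⟩
  rw [← hX.lintegral_resolventMeasure q hf, S.withDensity_kernel hq,
    lintegral_withDensity_eq_lintegral_mul _ (by fun_prop) hf]
  simp_rw [Pi.mul_apply, mul_comm]

/-- The chosen density and the inversion kernel are continuous densities of the same measure, so
they agree everywhere. -/
theorem resolventDensity_eq (hX : IsLevyProcess X P) (hA : ConditionA X P) {q : ℝ}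
    (hq : 0 < q) : resolventDensity X P q = resolventKernel (charExponent X P) q := by
  have h1 := hX.isResolventDensity_kernel hA hq
  have h2 : IsResolventDensity X P q (resolventDensity X P q) :=
    Classical.epsilon_spec (p := fun r => IsResolventDensity X P q r) ⟨_, h1⟩
  refine eq_of_withDensity_ofReal_eq h2.continuous h1.continuous h2.nonneg h1.nonneg ?_
  refine Measure.ext fun s hs => ?_
  have hi : Measurable (s.indicator fun _ : ℝ => (1 : ℝ≥0∞)) := measurable_const.indicator hs
  have h := (h2.lintegral_eq _ hi).trans (h1.lintegral_eq _ hi).symm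
  have e (r : ℝ → ℝ) : ∫⁻ x, s.indicator (fun _ : ℝ => (1 : ℝ≥0∞)) x * ENNReal.ofReal (r x) =
      volume.withDensity (fun x => ENNReal.ofReal (r x)) s := by
    rw [withDensity_apply _ hs, ← lintegral_indicator hs]
    refine lintegral_congr fun x => ?_
    by_cases hx : x ∈ s <;> simp [hx]
  rwa [e, e] at h

theorem hq_eq (hX : IsLevyProcess X P) (hA : ConditionA X P) {q : ℝ} (hq : 0 < q) (x : ℝ) :
    Levy.hq X P q x = renormKernel (charExponent X P) q x := by
  rw [Levy.hq, hX.resolventDensity_eq hA hq, renormKernel]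

/-- As `r_q` is maximal at `0`, `U_q((-1, 1)) ≤ 2 r_q(0)`. By monotone convergence the left side
increases, as `q` decreases to `0`, to the expected time spent in `(-1, 1)`, which is infinite. -/
theorem tendsto_kernel_zero (hX : IsLevyProcess X P) (hA : ConditionA X P)
    (hrec : IsRecurrent X P) :
    Tendsto (fun q => resolventKernel (charExponent X P) q 0) (𝓝[>] 0) atTop := by
  have S := hX.resolventFamily hA
  set A : Set ℝ := {x : ℝ | |x - 0| < 1} with hAdef
  have hAm : MeasurableSet A := measurableSet_lt (by fun_prop) (by fun_prop)
  set V : ℝ → ℝ≥0∞ := fun q => resolventMeasure X P q A with hV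
  have hi : Measurable (A.indicator fun _ : ℝ => (1 : ℝ≥0∞)) := measurable_const.indicator hAm
  have hVeq (q : ℝ) : V q = ∫⁻ ω, (∫⁻ t in Ioi (0 : ℝ), ENNReal.ofReal (exp (-q * t)) *
      A.indicator (fun _ => (1 : ℝ≥0∞)) (X t.toNNReal ω)) ∂P := by
    rw [← hX.lintegral_resolventMeasure q hi, lintegral_indicator hAm, setLIntegral_one]
  have hVanti {p q : ℝ} (hpq : p ≤ q) : V q ≤ V p := by
    rw [hVeq, hVeq]
    refine lintegral_mono fun ω => setLIntegral_mono' measurableSet_Ioi fun t ht => ?_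
    have ht : 0 < t := ht
    gcongr
  have hle (q : ℝ) (hq : 0 < q) :
      V q ≤ ENNReal.ofReal (2 * resolventKernel (charExponent X P) q 0) := by
    have hball : A = Metric.ball 0 1 := by ext x; simp [hAdef]
    calc V q = ∫⁻ x in A, ENNReal.ofReal (resolventKernel (charExponent X P) q x) := by
          rw [hV]
          simp only
          rw [S.withDensity_kernel hq, withDensity_apply _ hAm]
      _ ≤ ∫⁻ x in A, ENNReal.ofReal (resolventKernel (charExponent X P) q 0) :=
          lintegral_mono fun x => ENNReal.ofReal_le_ofReal (S.kernel_le_kernel_zero hq x)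
      _ = ENNReal.ofReal (2 * resolventKernel (charExponent X P) q 0) := by
          rw [setLIntegral_const, hball, Real.volume_ball, mul_one, mul_comm,
            ENNReal.ofReal_mul (by norm_num)]
  have hlim : Tendsto (fun n : ℕ => V (1 / ((n : ℝ) + 1))) atTop (𝓝 ∞) := by
    have hF : Measurable fun p : Ω × ℝ => A.indicator (fun _ => (1 : ℝ≥0∞)) (X p.2.toNNReal p.1) :=
      hi.comp hX.measurable_eval
    have h := lintegral_tendsto_of_tendsto_of_monotone
      (μ := P.prod (volume.restrict (Ioi (0 : ℝ))))
      (f := fun (n : ℕ) p => ENNReal.ofReal (exp (-(1 / ((n : ℝ) + 1)) * p.2)) *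
        A.indicator (fun _ => (1 : ℝ≥0∞)) (X p.2.toNNReal p.1))
      (F := fun p => A.indicator (fun _ => (1 : ℝ≥0∞)) (X p.2.toNNReal p.1))
      (fun n => by fun_prop) ?_ ?_
    · rw [lintegral_prod _ hF.aemeasurable, hrec 0 1 one_pos] at h
      refine h.congr fun n => ?_
      rw [hVeq, lintegral_prod _ (by fun_prop)]
    · have hpos : ∀ᵐ p ∂(P.prod (volume.restrict (Ioi (0 : ℝ)))), 0 < p.2 := by
        refine (Measure.ae_prod_iff_ae_ae (measurableSet_lt (by fun_prop) (by fun_prop))).2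
          (Eventually.of_forall fun ω => ?_)
        exact ae_restrict_mem measurableSet_Ioi
      filter_upwards [hpos] with p hp m n hmn
      have : (m : ℝ) ≤ n := Nat.cast_le.2 hmn
      beta_reduce
      gcongr
    · refine Eventually.of_forall fun p => ?_
      have h1 : Tendsto (fun n : ℕ => ENNReal.ofReal (exp (-(1 / ((n : ℝ) + 1)) * p.2))) atTop
          (𝓝 1) := by
        have h2 := ((tendsto_one_div_add_atTop_nhds_zero_nat (𝕜 := ℝ)).neg.mul_const p.2)
        have h3 := ENNReal.tendsto_ofReal ((continuous_exp.tendsto _).comp h2)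
        simpa using h3
      have h4 := ENNReal.Tendsto.mul_const
        (b := A.indicator (fun _ => (1 : ℝ≥0∞)) (X p.2.toNNReal p.1)) h1 (Or.inl one_ne_zero)
      simpa only [one_mul] using h4
  refine tendsto_atTop.2 fun K => ?_
  obtain ⟨n, hn⟩ := ((tendsto_order.1 hlim).1 (ENNReal.ofReal (2 * K)) ENNReal.ofReal_lt_top).exists
  filter_upwards [Ioo_mem_nhdsGT (show (0 : ℝ) < 1 / ((n : ℝ) + 1) by positivity)] with q hq
  have h1 := hn.trans_le ((hVanti hq.2.le).trans (hle q hq.1))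
  have h2 := (ENNReal.ofReal_lt_ofReal_iff (mul_pos two_pos (S.kernel_zero_pos hq.1))).1 h1
  linarith

end IsLevyProcess

/-! ### The second moment of `X 1` and that of `U 1` -/

namespace ResolventFamily

variable {Ψ : ℝ → ℂ} {U : ℝ → Measure ℝ}

/-- Near the origin `1 - exp (-Ψ)` is equivalent to `Ψ`, and `Ψ(l) / l² → M / 2` because recurrence
has made the mean vanish; the second moment of `μ` is read off from the real part. -/
theorem lintegral_sq_eq_of_ne_top (S : ResolventFamily Ψ U) {μ : Measure ℝ}
    [IsProbabilityMeasure μ] (hμ : ∀ l, charFun μ l = Complex.exp (-Ψ l))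
    (hrec : Tendsto (fun q => resolventKernel Ψ q 0) (𝓝[>] 0) atTop)
    (hfin : ∫⁻ x, ENNReal.ofReal (x ^ 2) ∂(U 1) ≠ ∞) :
    ∫⁻ x, ENNReal.ofReal (x ^ 2) ∂μ = ∫⁻ x, ENNReal.ofReal (x ^ 2) ∂(U 1) := by
  have hM := integrable_sq_iff.2 hfin
  have hm := S.mean_eq_zero hM hrec
  rw [← ofReal_integral_eq_lintegral_ofReal hM (Eventually.of_forall fun x => sq_nonneg x)]
  refine tendsto_nhds_unique (tendsto_one_sub_charFun_re_div_sq μ) (ENNReal.tendsto_ofReal ?_)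
  set M := ∫ x, x ^ 2 ∂(U 1) with hMdef
  have hΨ0 : Tendsto Ψ (𝓝[≠] 0) (𝓝[≠] 0) := by
    refine tendsto_nhdsWithin_iff.2 ⟨?_, ?_⟩
    · have h := S.continuous_exponent.tendsto 0
      rw [S.zero] at h
      exact h.mono_left nhdsWithin_le_nhds
    · filter_upwards [self_mem_nhdsWithin] with l hl
      exact S.exponent_ne_zero hl
  have hexp : Tendsto (fun w : ℂ => w⁻¹ * (1 - Complex.exp (-w))) (𝓝[≠] 0) (𝓝 1) := by
    have hd : HasDerivAt (fun w : ℂ => 1 - Complex.exp (-w)) 1 0 := by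
      have := ((hasDerivAt_id (0 : ℂ)).neg.cexp).const_sub 1
      simpa using this
    have h := hd.tendsto_slope
    refine h.congr fun w => ?_
    simp [slope_def_field, div_eq_inv_mul]
  have hprod := (hexp.comp hΨ0).mul (S.tendsto_exponent_div_sq hM hm)
  rw [one_mul] at hprod
  have hre := ((Complex.continuous_re.tendsto _).comp hprod).const_mul 2
  rw [Complex.ofReal_re, mul_div_cancel₀ _ two_ne_zero] at hre
  refine hre.congr' ?_
  filter_upwards [self_mem_nhdsWithin] with l hl
  have hl : l ≠ 0 := hl
  have hΨ := S.exponent_ne_zero hl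
  simp only [Function.comp]
  have e : (Ψ l)⁻¹ * (1 - Complex.exp (-Ψ l)) * (Ψ l / (l : ℂ) ^ 2) =
      (1 - Complex.exp (-Ψ l)) / ((l ^ 2 : ℝ) : ℂ) := by
    push_cast
    field_simp
  rw [e, Complex.div_ofReal_re, Complex.sub_re, Complex.one_re, hμ, mul_div_assoc]

/-- Serves to show that an infinite second moment passes from `U 1` to `μ`, so the value of the
constant is irrelevant. With `s = 1 - Re exp (-Ψ)`, near the origin `1 - Re (1 / (1 + Ψ)) ≤ Re Ψ +
‖Ψ‖² ≤ 2 s + 8 s`. -/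
theorem lintegral_sq_le (S : ResolventFamily Ψ U) {μ : Measure ℝ}
    [IsProbabilityMeasure μ] (hμ : ∀ l, charFun μ l = Complex.exp (-Ψ l)) :
    ∫⁻ x, ENNReal.ofReal (x ^ 2) ∂(U 1) ≤ 10 * ∫⁻ x, ENNReal.ofReal (x ^ 2) ∂μ := by
  have := S.isProbabilityMeasure_one
  refine le_of_tendsto_of_tendsto (tendsto_one_sub_charFun_re_div_sq (U 1))
    (ENNReal.Tendsto.const_mul (tendsto_one_sub_charFun_re_div_sq μ) (Or.inr (by simp))) ?_
  have hsmall : ∀ᶠ l in 𝓝 (0 : ℝ), ‖Ψ l‖ < 1 / 2 := by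
    have h := S.continuous_exponent.norm.tendsto 0
    rw [S.zero, norm_zero] at h
    exact h.eventually_lt_const (by norm_num)
  have hsmall2 : ∀ᶠ l in 𝓝 (0 : ℝ), 1 - (charFun μ l).re < 1 / 2 := by
    have h := (Complex.continuous_re.comp (continuous_charFun (μ := μ))).tendsto 0
    simp only [Function.comp, charFun_zero, probReal_univ, Complex.ofReal_one,
      Complex.one_re] at h
    have h2 := h.const_sub 1
    rw [sub_self] at h2
    exact h2.eventually_lt_const (by norm_num)
  filter_upwards [hsmall.filter_mono nhdsWithin_le_nhds, hsmall2.filter_mono nhdsWithin_le_nhds,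
    self_mem_nhdsWithin] with l h1 h2 hl
  have hl : l ≠ 0 := hl
  set s := 1 - (charFun μ l).re with hs
  set θ := (Ψ l).re with hθ
  have hθ0 : 0 ≤ θ := S.re_nonneg l
  have hnorm : ‖charFun μ l‖ = exp (-θ) := by rw [hμ, Complex.norm_exp, Complex.neg_re]
  -- `Re Ψ ≤ 2 s`
  have hθs : θ ≤ 2 * s := by
    have h3 : 1 - s ≤ exp (-θ) := by
      rw [← hnorm, hs, sub_sub_cancel]
      exact Complex.re_le_norm _
    have h4 := add_one_le_exp θ
    have h5 : exp (-θ) * exp θ = 1 := by rw [← exp_add]; simp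
    nlinarith [exp_pos θ]
  -- `‖Ψ‖² ≤ 8 s`
  have hΨs : ‖Ψ l‖ ^ 2 ≤ 8 * s := by
    have h3 : ‖1 - charFun μ l‖ ^ 2 ≤ 2 * s := by
      have h4 : ‖charFun μ l‖ ^ 2 ≤ 1 := by
        have := norm_charFun_le_one (μ := μ) l
        exact pow_le_one₀ (norm_nonneg _) this
      rw [Complex.sq_norm, Complex.normSq_apply] at h4 ⊢
      simp only [Complex.sub_re, Complex.one_re, Complex.sub_im, Complex.one_im]
      rw [hs]
      nlinarith
    -- The quadratic remainder is at most `‖Ψ‖ / 2` since `‖Ψ‖ < 1 / 2`, so `‖Ψ‖` is at most twice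
    -- `‖1 - exp (-Ψ)‖`, whose square is at most `2 s`.
    have h5 : ‖Complex.exp (-Ψ l) - 1 - -Ψ l‖ ≤ ‖-Ψ l‖ ^ 2 :=
      Complex.norm_exp_sub_one_sub_id_le (by rw [norm_neg]; linarith)
    have h6 : ‖Ψ l‖ ≤ ‖1 - charFun μ l‖ + ‖-Ψ l‖ ^ 2 := by
      have e : Ψ l = (1 - charFun μ l) + (Complex.exp (-Ψ l) - 1 - -Ψ l) := by rw [hμ]; ring
      calc ‖Ψ l‖ = ‖(1 - charFun μ l) + (Complex.exp (-Ψ l) - 1 - -Ψ l)‖ := by rw [← e]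
        _ ≤ _ := (norm_add_le _ _).trans (by gcongr)
    rw [norm_neg] at h6
    have h7 : ‖Ψ l‖ ≤ 2 * ‖1 - charFun μ l‖ := by nlinarith [norm_nonneg (Ψ l)]
    nlinarith [norm_nonneg (Ψ l), norm_nonneg (1 - charFun μ l)]
  have hmain : 1 - (charFun (U 1) l).re ≤ 10 * s := by
    rw [S.charFun_eq 1 one_pos, Complex.ofReal_one, Complex.inv_re]
    have hn : 1 ≤ Complex.normSq (1 + Ψ l) := by
      rw [Complex.normSq_apply]
      simp only [Complex.add_re, Complex.one_re, Complex.add_im, Complex.one_im]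
      nlinarith
    have hexpand : Complex.normSq (1 + Ψ l) - (1 + Ψ l).re = θ + ‖Ψ l‖ ^ 2 := by
      rw [Complex.sq_norm, Complex.normSq_apply, Complex.normSq_apply]
      simp only [Complex.add_re, Complex.one_re, Complex.add_im, Complex.one_im]
      rw [hθ]
      ring
    have h3 : 1 - (1 + Ψ l).re / Complex.normSq (1 + Ψ l) =
        (θ + ‖Ψ l‖ ^ 2) / Complex.normSq (1 + Ψ l) := by
      rw [← hexpand, sub_div, div_self (by linarith)]
    rw [h3]
    refine (div_le_self (by positivity) hn).trans (by linarith)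
  rw [← ENNReal.ofReal_ofNat, ← ENNReal.ofReal_mul (by norm_num)]
  refine ENNReal.ofReal_le_ofReal ?_
  rw [← mul_div_assoc]
  exact div_le_div_of_nonneg_right (by linarith) (sq_nonneg l)

theorem lintegral_sq_eq (S : ResolventFamily Ψ U) {μ : Measure ℝ}
    [IsProbabilityMeasure μ] (hμ : ∀ l, charFun μ l = Complex.exp (-Ψ l))
    (hrec : Tendsto (fun q => resolventKernel Ψ q 0) (𝓝[>] 0) atTop) :
    ∫⁻ x, ENNReal.ofReal (x ^ 2) ∂μ = ∫⁻ x, ENNReal.ofReal (x ^ 2) ∂(U 1) := by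
  by_cases hfin : ∫⁻ x, ENNReal.ofReal (x ^ 2) ∂(U 1) = ∞
  · rw [hfin]
    by_contra h
    have := S.lintegral_sq_le hμ
    rw [hfin, top_le_iff] at this
    exact ENNReal.mul_ne_top (by simp) h this
  · exact S.lintegral_sq_eq_of_ne_top hμ hrec hfin

end ResolventFamily

theorem IsLevyProcess.secondMoment_eq {Ω : Type*} [MeasurableSpace Ω] {P : Measure Ω}
    [IsProbabilityMeasure P] {X : ℝ≥0 → Ω → ℝ} (hX : IsLevyProcess X P) (hA : ConditionA X P)
    (hrec : IsRecurrent X P) :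
    secondMoment X P = ∫⁻ x, ENNReal.ofReal (x ^ 2) ∂(resolventMeasure X P 1) := by
  have : IsProbabilityMeasure (P.map (X 1)) :=
    Measure.isProbabilityMeasure_map (hX.measurable 1).aemeasurable
  rw [← (hX.resolventFamily hA).lintegral_sq_eq (μ := P.map (X 1))
    (fun l => by rw [hX.charFun_eq_exp]; simp) (hX.tendsto_kernel_zero hA hrec),
    lintegral_map (by fun_prop) (hX.measurable 1)]
  rfl

end Levy

/-- Besides the two limit assertions, the conclusion records that the objects they involve are
well defined: `m² > 0`, the resolvent densities exist, and `h_q(x) → h(x)` as `q → 0+`. -/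
theorem mainTheorem2 {Ω : Type*} [MeasurableSpace Ω] (P : Measure Ω) [IsProbabilityMeasure P]
    (X : ℝ≥0 → Ω → ℝ) (hX : Levy.IsLevyProcess X P)
    (hrec : Levy.IsRecurrent X P) (hA : Levy.ConditionA X P) :
    0 < Levy.secondMoment X P ∧
    (∀ q : ℝ, 0 < q → Levy.IsResolventDensity X P q (Levy.resolventDensity X P q)) ∧
    (∀ x : ℝ, Tendsto (fun q => Levy.hq X P q x) (𝓝[>] (0 : ℝ))
      (𝓝 (Levy.renormalizedZeroResolvent X P x))) ∧
    Tendsto (fun x : ℝ => Levy.renormalizedZeroResolvent X P x / |x|) atTop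
      (𝓝 (Levy.invSecondMoment X P)) ∧
    Tendsto (fun x : ℝ => Levy.renormalizedZeroResolvent X P x / |x|) atBot
      (𝓝 (Levy.invSecondMoment X P)) ∧
    ∀ x : ℝ,
      Tendsto (fun y : ℝ => Levy.renormalizedZeroResolvent X P (x + y) -
        Levy.renormalizedZeroResolvent X P y) atTop (𝓝 (x * Levy.invSecondMoment X P)) ∧
      Tendsto (fun y : ℝ => Levy.renormalizedZeroResolvent X P (x + y) -
        Levy.renormalizedZeroResolvent X P y) atBot (𝓝 (-(x * Levy.invSecondMoment X P))) := by
  have S := hX.resolventFamily hA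
  have hzero := hX.tendsto_kernel_zero hA hrec
  have hm2 := hX.secondMoment_eq hA hrec
  obtain ⟨h, hh⟩ := S.exists_tendsto_renormKernel hzero
  have hlim (x : ℝ) : Tendsto (fun q => Levy.hq X P q x) (𝓝[>] (0 : ℝ)) (𝓝 (h x)) := by
    refine (hh x).congr' ?_
    filter_upwards [self_mem_nhdsWithin] with q hq
    exact (hX.hq_eq hA hq x).symm
  have heq : Levy.renormalizedZeroResolvent X P = h := funext fun x => (hlim x).limUnder_eq
  obtain ⟨u, hu⟩ := exists_seq_tendsto (𝓝[>] (0 : ℝ))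
  -- Once the full limit `q → 0+` is known, any sequence decreasing into it exhibits `h` as a kernel
  -- limit, and the asymptotics proved for those apply.
  have H : Levy.IsKernelLimit (Levy.charExponent X P) u h := ⟨hu, fun x => (hh x).comp hu⟩
  rw [heq, Levy.invSecondMoment, hm2]
  refine ⟨pos_iff_ne_zero.2 S.lintegral_sq_ne_zero, fun q hq => ?_, hlim,
    (H.tendsto_div_abs S hzero).1, (H.tendsto_div_abs S hzero).2, H.tendsto_increment S hzero⟩
  rw [hX.resolventDensity_eq hA hq]
  exact hX.isResolventDensity_kernel hA hq
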